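/- A map $M$ on the Euclidean plane $\mathbb{E}^2$ is a 2-cell embedding of a locally finite graph without loops: the vertices form a closed discrete subset of $\mathbb{E}^2$, the edges are arcs joining two distinct vertices and containing no other vertex, two distinct edges meet only in common vertices, and the faces (connected components of the complement of the graph) are open discs. A flag of $M$ is an ordered triple $(v,e,F)$ of an incident vertex, edge and face; for $i=0,1,2$ the $i$-adjacent flag of a flag $\Phi$ is the unique flag that differs from $\Phi$ precisely in the vertex, the edge, or the face, respectively. Let $r_i$ be the involution of the set of flags sending every flag to its $i$-adjacent flag, and let $\mathrm{Mon}(M)=\langle r_0,r_1,r_2\rangle$, acting on flags from the right. An automorphism of $M$ is a homeomorphism of $\mathbb{E}^2$ preserving the set of vertices and the set of edges. Suppose that all faces of $M$ are convex polygons (bounded, with line segments as edges). Choose a point $c_F$ in the interior of each face $F$, and represent the flag $(v,e,F)$ by the triangle with corners $v$, the midpoint of $e$, and $c_F$ (corners number $0,1,2$). Let $\widetilde S$ be the surface of the minimal regular cover of $M$: take one triangle with corners labelled $0,1,2$ for each $g\in\mathrm{Mon}(M)$ and, for all $g$ and $i$, identify the sides opposite to corner $i$ of the triangles of $g$ and $g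 r_i$. Fix a base flag $\Phi_0$ and let $\pi:\widetilde S\to\mathbb{E}^2$ be the branched covering that maps the triangle of $g$ affinely, corner by corner, onto the triangle representing $\Phi_0 g$. A branch point of $\pi$ is a point $\pi(s)$ such that $\pi$ is not a local homeomorphism at $s$. **Lemma.** Let $M$ be a map on $\mathbb{E}^2$ whose faces are convex polygons. Assume that two translations $T_1,T_2$ of $\mathbb{E}^2$ by linearly independent vectors are automorphisms of $M$, and that $M$ has two faces of different sizes (numbers of edges). Then, for every choice of the points $c_F$ and of $\Phi_0$, there is a simple closed curve $\gamma$ in $\mathbb{E}^2$ such that 1. the preimage $\pi^{-1}(\gamma)$ is a disjoint union (as a topological space) of simple closed curves; 2. for every simple closed curve $\widetilde\gamma\subset\pi^{-1}(\gamma)$, the restriction of $\pi$ to $\widetilde\gamma$ is a bijection onto $\gamma$; 3. there is a branch point of $\pi$ in the interior of the compact region bounded by $\gamma$, that is, in the bounded component of $\mathbb{E}^2\setminus\gamma$. -/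

import Mathlib

open Set Topology

noncomputable section

/-- The Euclidean plane. -/
abbrev Plane : Type := EuclideanSpace ℝ (Fin 2)

/-- A map on the Euclidean plane: a 2-cell embedding of a locally finite graph without loops.
Vertices and edges are identified with their images; an edge is an arc joining two distinct
vertices. -/
structure PlaneMap where
  /-- the vertices -/
  verts : Set Plane
  /-- the edges -/
  edges : Set (Set Plane)
  /-- the vertices form a closed discrete subset of the plane -/
  verts_isClosed : IsClosed verts
  verts_isDiscrete : IsDiscrete verts
  /-- every edge is an arc which meets the vertex set exactly in its two ends -/
  edge_arc : ∀ e ∈ edges, ∃ p : C(unitInterval, Plane), Function.Injective p ∧ range p = e ∧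
    ∀ t, p t ∈ verts ↔ t = 0 ∨ t = 1
  /-- distinct edges meet only in common vertices -/
  edge_inter : ∀ e ∈ edges, ∀ f ∈ edges, e ≠ f → e ∩ f ⊆ verts
  /-- the graph is locally finite -/
  locally_finite : ∀ v ∈ verts, {e ∈ edges | v ∈ e}.Finite
  /-- the connected components of the complement of the graph are open discs -/
  face_disc : ∀ x ∈ (verts ∪ ⋃₀ edges)ᶜ,
    Nonempty (connectedComponentIn (verts ∪ ⋃₀ edges)ᶜ x ≃ₜ Metric.ball (0 : Plane) 1)

namespace PlaneMap

variable (M : PlaneMap)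

/-- The image of the graph. -/
def skeleton : Set Plane := M.verts ∪ ⋃₀ M.edges

/-- The faces: connected components of the complement of the graph. -/
def faces : Set (Set Plane) := {F | ∃ x ∈ M.skeletonᶜ, F = connectedComponentIn M.skeletonᶜ x}

/-- The size of a face: the number of edges on its boundary. -/
def faceSize (F : Set Plane) : ℕ∞ := {e ∈ M.edges | e ⊆ closure F}.encard

/-- All faces are convex polygons: bounded convex regions whose sides, the edges of the map, are
line segments. (Consecutive edges of a face are allowed to be collinear.) -/
def HasConvexPolygonFaces : Prop :=
  (∀ e ∈ M.edges, ∃ u ∈ M.verts, ∃ v ∈ M.verts, e = segment ℝ u v) ∧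
    ∀ F ∈ M.faces, Convex ℝ F ∧ Bornology.IsBounded F

/-- A homeomorphism of the plane is an automorphism of the map if it preserves the set of
vertices and the set of edges. -/
def IsAutomorphism (φ : Plane ≃ₜ Plane) : Prop :=
  φ '' M.verts = M.verts ∧ (fun e => φ '' e) '' M.edges = M.edges

/-- A flag: an ordered incident triple of a vertex, an edge and a face. -/
@[ext]
structure Flag where
  vert : Plane
  edge : Set Plane
  face : Set Plane
  vert_mem : vert ∈ M.verts
  edge_mem : edge ∈ M.edges
  face_mem : face ∈ M.faces
  vert_edge : vert ∈ edge
  edge_face : edge ⊆ closure face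

variable {M}

/-- `Ψ` differs from `Φ` precisely in the vertex (`i = 0`), the edge (`i = 1`), or the face
(`i = 2`). -/
def Flag.IsAdj (i : Fin 3) (Φ Ψ : M.Flag) : Prop :=
  Ψ ≠ Φ ∧ (i ≠ 0 → Ψ.vert = Φ.vert) ∧ (i ≠ 1 → Ψ.edge = Φ.edge) ∧ (i ≠ 2 → Ψ.face = Φ.face)

theorem Flag.IsAdj.symm {i : Fin 3} {Φ Ψ : M.Flag} (h : Φ.IsAdj i Ψ) : Ψ.IsAdj i Φ :=
  ⟨h.1.symm, fun hi => (h.2.1 hi).symm, fun hi => (h.2.2.1 hi).symm,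
    fun hi => (h.2.2.2 hi).symm⟩

open Classical in
/-- The `i`-adjacent flag of `Φ`: the unique flag that differs from `Φ` precisely in the `i`-th
entry (and `Φ` itself if there is no unique such flag). -/
def Flag.adj (i : Fin 3) (Φ : M.Flag) : M.Flag :=
  if h : ∃! Ψ, Φ.IsAdj i Ψ then h.choose else Φ

theorem Flag.adj_eq_of_isAdj {i : Fin 3} {Φ Ψ : M.Flag} (h : Φ.IsAdj i Ψ)
    (hu : ∀ Ξ, Φ.IsAdj i Ξ → Ξ = Ψ) : Φ.adj i = Ψ := by
  have hex : ∃! Ψ, Φ.IsAdj i Ψ := ⟨Ψ, h, hu⟩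
  unfold Flag.adj
  rw [dif_pos hex]
  exact hu _ hex.choose_spec.1

theorem Flag.adj_agree (i : Fin 3) (Φ : M.Flag) :
    (i ≠ 0 → (Φ.adj i).vert = Φ.vert) ∧ (i ≠ 1 → (Φ.adj i).edge = Φ.edge) ∧
      (i ≠ 2 → (Φ.adj i).face = Φ.face) := by
  by_cases h : ∃! Ψ, Φ.IsAdj i Ψ
  · obtain ⟨Ψ, h1, h2⟩ := h
    rw [Flag.adj_eq_of_isAdj h1 h2]
    exact h1.2
  · simp [Flag.adj, h]

theorem Flag.adj_adj (i : Fin 3) (Φ : M.Flag) : (Φ.adj i).adj i = Φ := by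
  by_cases h : ∃! Ψ, Φ.IsAdj i Ψ
  · obtain ⟨Ψ, h1, h2⟩ := h
    rw [Flag.adj_eq_of_isAdj h1 h2]
    refine Flag.adj_eq_of_isAdj h1.symm fun Ξ hΞ => ?_
    by_contra hne
    exact hΞ.1 (h2 Ξ ⟨hne, fun hi => (hΞ.2.1 hi).trans (h1.2.1 hi),
      fun hi => (hΞ.2.2.1 hi).trans (h1.2.2.1 hi), fun hi => (hΞ.2.2.2 hi).trans (h1.2.2.2 hi)⟩)
  · have h0 : Φ.adj i = Φ := by simp [Flag.adj, h]
    rw [h0, h0]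

variable (M)

/-- The involution on the set of flags that sends every flag to its `i`-adjacent flag. -/
def flagInv (i : Fin 3) : Equiv.Perm M.Flag :=
  Function.Involutive.toPerm (Flag.adj i) (Flag.adj_adj i)

/-- The monodromy group. -/
def Mon : Subgroup (Equiv.Perm M.Flag) := Subgroup.closure (range M.flagInv)

/-- The generators of the monodromy group. -/
def monGen (i : Fin 3) : M.Mon := ⟨M.flagInv i, Subgroup.subset_closure ⟨i, rfl⟩⟩

/-- Disjoint union of triangles, one for each element of the monodromy group. Corner `0` of a
triangle stands for a vertex, corner `1` for the midpoint of an edge and corner `2` for an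
interior point of a face; the side with label `i` is opposite to corner `i`. -/
abbrev Triangles : Type := Σ _ : M.Mon, stdSimplex ℝ (Fin 3)

/-- The sides with label `i` of two triangles that differ by the generator `i` are identified.
(The monodromy group is written as acting on flags from the left, so the triangle that is
`i`-adjacent to the triangle of `g` is the one of `monGen i * g`.) -/
def Glue (a b : M.Triangles) : Prop :=
  ∃ i : Fin 3, b.1 = M.monGen i * a.1 ∧ b.2 = a.2 ∧ a.2.1 i = 0

/-- The surface of the minimal regular cover, with the quotient topology. -/
def CoverSurface : Type := Quot M.Glue

instance : TopologicalSpace M.CoverSurface := inferInstanceAs (TopologicalSpace (Quot M.Glue))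

/-- The midpoint of a straight edge: half the sum of its two ends. -/
def edgeMid (e : Set Plane) : Plane := (2 : ℝ)⁻¹ • ∑ᶠ v ∈ M.verts ∩ e, v

variable {M}

/-- The corners of the triangle in the plane representing a flag, where `c F` is the chosen
interior point of the face `F`. -/
def Flag.corner (c : Set Plane → Plane) (Φ : M.Flag) : Fin 3 → Plane :=
  ![Φ.vert, M.edgeMid Φ.edge, c Φ.face]

theorem Flag.corner_adj (c : Set Plane → Plane) (Φ : M.Flag) {i j : Fin 3} (h : i ≠ j) :
    (Φ.adj i).corner c j = Φ.corner c j := by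
  obtain ⟨h0, h1, h2⟩ := Φ.adj_agree i
  fin_cases j
  · exact h0 h
  · exact congrArg M.edgeMid (h1 h)
  · exact congrArg c (h2 h)

/-- The covering of the plane by the surface of the minimal regular cover with base flag `Φ₀`: the
triangle of `g` is mapped affinely onto the triangle of the flag `g Φ₀`, corner by corner. -/
def coverMap (c : Set Plane → Plane) (Φ₀ : M.Flag) : M.CoverSurface → Plane :=
  Quot.lift (fun a : M.Triangles => ∑ j, a.2.1 j • ((a.1 : Equiv.Perm M.Flag) Φ₀).corner c j) <| by
    rintro ⟨g, x⟩ ⟨h, y⟩ ⟨i, hg, hx, hi⟩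
    dsimp only at hg hx hi ⊢
    subst hg hx
    refine Finset.sum_congr rfl fun j _ => ?_
    by_cases hij : i = j
    · subst hij
      rw [hi, zero_smul, zero_smul]
    · congr 1
      exact (Flag.corner_adj c ((g : Equiv.Perm M.Flag) Φ₀) hij).symm

end PlaneMap

/-- A simple closed curve: a homeomorphic image of the circle. -/
def IsSimpleClosedCurve {X : Type*} [TopologicalSpace X] (C : Set X) : Prop :=
  ∃ f : Circle → X, IsEmbedding f ∧ range f = C

/-- A branch point of a map: a value taken at some point where the map is not a local
homeomorphism. -/
def IsBranchPoint {X Y : Type*} [TopologicalSpace X] [TopologicalSpace Y] (f : X → Y) (b : Y) :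
    Prop :=
  ∃ s, f s = b ∧ ¬ IsLocalHomeomorphOn f {s}

/-- `A` is the topological disjoint union of the members of `𝒞`. -/
def IsDisjointUnion {X : Type*} [TopologicalSpace X] (A : Set X) (𝒞 : Set (Set X)) : Prop :=
  ⋃₀ 𝒞 = A ∧ 𝒞.PairwiseDisjoint id ∧ ∀ C ∈ 𝒞, ∃ U, IsOpen U ∧ C = U ∩ A

end

open Set Topology

noncomputable section

/-! The triangles of the flags triangulate the plane (`Tame.exists_tau`, `Tame.tau_inj`), and a
point that is no corner lies in one triangle or in two that share a side (`Tame.eq_or_adj`). A curve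
without corners can therefore be followed from triangle to triangle, multiplying by a generator of
the monodromy group at every side; a consistent choice of these products is an `IsLabelling`. If a
simple closed curve γ has a labelling m, then for a point over γ in the triangle of g the element
m⁻¹g does not change when a side is crossed. Its values cut the preimage of γ into open and closed
sheets, each of which π maps bijectively onto γ (`Periodic.preimage_of_labelling`). What is needed
is a labelled curve around a branch point.

The curve is the boundary of a parallelogram with sides N t₁ and N t₂ and first vertex p. Monodromy
commutes with translations (`Tame.mon_vadd`). Hence if following the segment from p to p + t₁ gives
u, following it up to p + N t₁ gives u^N; similarly t₂ gives v^N. Flags fall into finitely many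
translation orbits, so for a suitable N both u^N and v^N send every flag to one of its translates
(`Periodic.exists_pow_orbit`). Elements with this property commute (`Tame.commute_of_orbit`), so the
two paths along the boundary from p to the opposite vertex give the same label and the labelling
closes up.

For the branch point, let ρ be the walk around faces, `faceRot`. If π is a local homeomorphism at a
point over the centre of a face of size n, then ρ^n = 1 (`Tame.faceSize_eq`, `faceRot_pow_eq_one`).
If this happened for two faces of different sizes, each size would divide the other. So some face
has a branch point as centre, and so have all its translates. The parallelogram contains a
fundamental domain of the translations by t₁ and t₂, and p is chosen so that its sides contain no
corner; thus one of these centres lies inside.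

All this uses centres that are invariant under translations. Any other choice differs from such a
choice by a piecewise affine homeomorphism of the plane (`Periodic.coverMap_transfer`). -/

/-! ### Determinants and half discs in the plane -/

/-- The determinant of two vectors of the plane. -/
def cr (a b : Plane) : ℝ := a 0 * b 1 - a 1 * b 0

theorem cr_add (a b b' : Plane) : cr a (b + b') = cr a b + cr a b' := by
  simp [cr]; ring

theorem cr_smul (a b : Plane) (k : ℝ) : cr a (k • b) = k * cr a b := by
  simp [cr]; ring

theorem cr_neg_left (a b : Plane) : cr (-a) b = -cr a b := by
  simp [cr]; ring

theorem cr_neg (a b : Plane) : cr a (-b) = -cr a b := by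
  simp [cr]; ring

@[simp] theorem cr_self (a : Plane) : cr a a = 0 := by
  simp [cr]; ring

@[simp] theorem cr_zero (a : Plane) : cr a 0 = 0 := by
  simp [cr]

theorem cr_comm (a b : Plane) : cr a b = -cr b a := by
  simp [cr]; ring

/-- Cramer's rule without division: it expresses one edge direction by another one and the direction
to a point of a face. -/
theorem cr_decomp (w d d' : Plane) : cr w d • d' = cr d' d • w + cr w d' • d := by
  ext i; fin_cases i <;> simp [cr] <;> ring

/-- The rotation by a right angle. -/
def rot (d : Plane) : Plane := !₂[-d 1, d 0]

theorem cr_rot_pos {d : Plane} (hd : d ≠ 0) : 0 < cr d (rot d) := by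
  have h : cr d (rot d) = d 0 ^ 2 + d 1 ^ 2 := by simp [cr, rot]; ring
  rw [h]
  by_contra! hc
  apply hd
  have h0 : d 0 = 0 := by nlinarith [sq_nonneg (d 0), sq_nonneg (d 1)]
  have h1 : d 1 = 0 := by nlinarith [sq_nonneg (d 0), sq_nonneg (d 1)]
  ext i; fin_cases i <;> simp [h0, h1]

/-- An open half disc. -/
def halfBall (x : Plane) (ε : ℝ) (d : Plane) : Set Plane := {y | dist y x < ε ∧ 0 < cr d (y - x)}

theorem convex_halfBall (x : Plane) (ε : ℝ) (d : Plane) : Convex ℝ (halfBall x ε d) := by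
  rintro a ⟨ha, ha'⟩ b ⟨hb, hb'⟩ s t hs ht hst
  refine ⟨convex_ball x ε ha hb hs ht hst, ?_⟩
  have : s • a + t • b - x = s • (a - x) + t • (b - x) := by
    have : x = (s + t) • x := by rw [hst, one_smul]
    nth_rewrite 1 [this]; module
  rw [this, cr_add, cr_smul, cr_smul]
  rcases hs.eq_or_lt with rfl | hs
  · have : t = 1 := by linarith
    subst this; simpa using hb'
  · positivity

theorem eventually_add_smul_mem {U : Set Plane} (hU : IsOpen U) {y : Plane} (hy : y ∈ U)
    (n : Plane) : ∀ᶠ s : ℝ in 𝓝[>] 0, y + s • n ∈ U := by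
  have hc : Continuous fun s : ℝ => y + s • n := by fun_prop
  have : ∀ᶠ s : ℝ in 𝓝 0, y + s • n ∈ U :=
    hc.continuousAt.eventually_mem (hU.mem_nhds (by simpa using hy))
  exact this.filter_mono nhdsWithin_le_nhds

theorem exists_add_smul_mem {U : Set Plane} (hU : IsOpen U) {y : Plane} (hy : y ∈ U)
    (n : Plane) : ∃ s : ℝ, 0 < s ∧ y + s • n ∈ U := by
  obtain ⟨s, h1, h2⟩ := ((eventually_add_smul_mem hU hy n).and self_mem_nhdsWithin).exists
  exact ⟨s, h2, h1⟩

/-- Any point of the diameter is a limit of points pushed in the direction `rot d`. Thus a face that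
contains a half disc has its diameter in the closure. -/
theorem mem_closure_halfBall {x : Plane} {ε : ℝ} {d : Plane} (hd : d ≠ 0) {y : Plane}
    (hy : dist y x < ε) (h0 : cr d (y - x) = 0) : y ∈ closure (halfBall x ε d) := by
  rw [mem_closure_iff]
  intro U hU hyU
  have hopen : IsOpen (U ∩ Metric.ball x ε) := hU.inter Metric.isOpen_ball
  obtain ⟨s, hs, h1, h2⟩ := exists_add_smul_mem hopen ⟨hyU, hy⟩ (rot d)
  refine ⟨_, h1, h2, ?_⟩
  rw [add_sub_right_comm, cr_add, h0, cr_smul, zero_add]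
  exact mul_pos hs (cr_rot_pos hd)

theorem Convex.openSegment_subset_of_isOpen {F : Set Plane} (hF : Convex ℝ F) (ho : IsOpen F)
    {a b : Plane} (ha : a ∈ F) (hb : b ∈ closure F) : openSegment ℝ a b ⊆ F := by
  have := hF.openSegment_interior_closure_subset_interior (ho.interior_eq.symm ▸ ha) hb
  rwa [ho.interior_eq] at this

/-! ### Edges and the faces at an edge -/

namespace PlaneMap

variable {M : PlaneMap}

/-- The standing local hypotheses: faces are convex polygons and the skeleton is locally finite. -/
structure Tame (M : PlaneMap) : Prop where
  hasConvexPolygonFaces : M.HasConvexPolygonFaces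
  star : ∀ x : Plane, ∃ ε > 0, (∀ v ∈ M.verts, dist v x < ε → v = x) ∧
    ∀ e ∈ M.edges, ∀ y ∈ e, dist y x < ε → x ∈ e

/-- The arc shows that exactly two vertices lie on the edge; the two ends of the segment are
distinct vertices on it, hence the same two. -/
theorem exists_edge_ends (hM : M.HasConvexPolygonFaces) {e : Set Plane} (he : e ∈ M.edges) :
    ∃ u ∈ M.verts, ∃ v ∈ M.verts, u ≠ v ∧ e = segment ℝ u v ∧ M.verts ∩ e = {u, v} := by
  obtain ⟨u, hu, v, hv, huv⟩ := hM.1 e he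
  obtain ⟨p, hp, hr, hpv⟩ := M.edge_arc e he
  have h01 : p 0 ≠ p 1 := fun h => zero_ne_one (hp h)
  have hV : M.verts ∩ e = {p 0, p 1} := by
    ext x
    constructor
    · rintro ⟨h1, h2⟩
      rw [← hr] at h2
      obtain ⟨t, rfl⟩ := h2
      rcases (hpv t).1 h1 with rfl | rfl <;> simp
    · rintro (rfl | rfl)
      · exact ⟨(hpv 0).2 (Or.inl rfl), hr ▸ mem_range_self _⟩
      · exact ⟨(hpv 1).2 (Or.inr rfl), hr ▸ mem_range_self _⟩
  have hne : u ≠ v := by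
    rintro rfl
    rw [segment_same] at huv
    have h0 : p 0 ∈ e := hr ▸ mem_range_self _
    have h1 : p 1 ∈ e := hr ▸ mem_range_self _
    rw [huv] at h0 h1
    exact h01 (h0.trans h1.symm)
  have hu' : u ∈ M.verts ∩ e := ⟨hu, huv ▸ left_mem_segment ℝ u v⟩
  have hv' : v ∈ M.verts ∩ e := ⟨hv, huv ▸ right_mem_segment ℝ u v⟩
  refine ⟨u, hu, v, hv, hne, huv, ?_⟩
  rw [hV] at hu' hv' ⊢
  rcases hu' with rfl | rfl <;> rcases hv' with rfl | rfl
  · exact absurd rfl hne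
  · rfl
  · exact pair_comm _ _
  · exact absurd rfl hne

theorem exists_other_end (hM : M.HasConvexPolygonFaces) {e : Set Plane} (he : e ∈ M.edges)
    {v : Plane} (hv : v ∈ M.verts) (hve : v ∈ e) :
    ∃ w ∈ M.verts, w ≠ v ∧ e = segment ℝ v w ∧ M.verts ∩ e = {v, w} := by
  obtain ⟨a, ha, b, hb, hab, hs, hi⟩ := exists_edge_ends hM he
  have : v ∈ M.verts ∩ e := ⟨hv, hve⟩
  rw [hi] at this
  rcases this with rfl | rfl
  · exact ⟨b, hb, hab.symm, hs, hi⟩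
  · exact ⟨a, ha, hab, by rw [hs, segment_symm], by rw [hi, pair_comm]⟩

theorem edgeMid_eq {e : Set Plane} {v w : Plane} (hvw : w ≠ v) (h : M.verts ∩ e = {v, w}) :
    M.edgeMid e = (2 : ℝ)⁻¹ • (v + w) := by
  rw [edgeMid, h, finsum_mem_pair hvw.symm]

theorem isClosed_edge (hM : M.HasConvexPolygonFaces) {e : Set Plane} (he : e ∈ M.edges) :
    IsClosed e := by
  obtain ⟨a, ha, b, hb, hab, hs, hi⟩ := exists_edge_ends hM he
  rw [hs, ← convexHull_pair]
  exact ((Set.toFinite {a, b}).isCompact_convexHull (𝕜 := ℝ)).isClosed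

theorem edge_eq_of_subset {e e' : Set Plane} {v w w' : Plane}
    (hw : w ∈ M.verts) (hwv : w ≠ v) (hs : e = segment ℝ v w)
    (hs' : e' = segment ℝ v w') (hi' : M.verts ∩ e' = {v, w'}) (h : w ∈ e') : e = e' := by
  have : w ∈ M.verts ∩ e' := ⟨hw, h⟩
  rw [hi'] at this
  rcases this with rfl | rfl
  · exact absurd rfl hwv
  · rw [hs, hs']

/-- Of two edges leaving `v` in the same direction, the longer one contains the far end of the
shorter one, and an edge contains no vertices besides its ends. -/
theorem edge_eq_of_parallel {e e' : Set Plane} {v w w' : Plane}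
    (hw : w ∈ M.verts) (hw' : w' ∈ M.verts) (hwv : w ≠ v) (hwv' : w' ≠ v)
    (hs : e = segment ℝ v w) (hi : M.verts ∩ e = {v, w})
    (hs' : e' = segment ℝ v w') (hi' : M.verts ∩ e' = {v, w'}) {k : ℝ} (hk : 0 < k)
    (h : w' - v = k • (w - v)) : e = e' := by
  have key : ∀ {k : ℝ} {w w' : Plane}, 0 < k → k ≤ 1 → w' - v = k • (w - v) →
      w' ∈ segment ℝ v w := by
    intro k w w' hk hk1 h
    rw [segment_eq_image']
    exact ⟨k, ⟨hk.le, hk1⟩, by simp only; rw [← h]; abel⟩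
  rcases le_total k 1 with hk1 | hk1
  · exact (edge_eq_of_subset hw' hwv' hs' hs hi (hs ▸ key hk hk1 h)).symm
  · refine edge_eq_of_subset hw hwv hs hs' hi' (hs' ▸ key (inv_pos.2 hk) (inv_le_one_of_one_le₀ hk1) ?_)
    rw [h, inv_smul_smul₀ hk.ne']

namespace Tame

theorem isClosed_skeleton (hT : M.Tame) : IsClosed M.skeleton := by
  rw [← isOpen_compl_iff, Metric.isOpen_iff]
  intro x hx
  obtain ⟨ε, hε, h1, h2⟩ := hT.star x
  refine ⟨ε, hε, fun y hy hys => hx ?_⟩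
  rcases hys with hv | ⟨e, he, hye⟩
  · exact Or.inl (h1 y hv hy ▸ hv)
  · exact Or.inr ⟨e, he, h2 e he y hye hy⟩

theorem isOpen_face (hT : M.Tame) {F : Set Plane} (hF : F ∈ M.faces) : IsOpen F := by
  obtain ⟨x, -, rfl⟩ := hF
  exact hT.isClosed_skeleton.isOpen_compl.connectedComponentIn

theorem convex_face (hT : M.Tame) {F : Set Plane} (hF : F ∈ M.faces) : Convex ℝ F :=
  (hT.hasConvexPolygonFaces.2 F hF).1

end Tame

theorem disjoint_face_skeleton {F : Set Plane} (hF : F ∈ M.faces) {x : Plane} (hx : x ∈ F) :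
    x ∉ M.skeleton := by
  obtain ⟨y, -, rfl⟩ := hF
  exact connectedComponentIn_subset _ _ hx

theorem face_nonempty {F : Set Plane} (hF : F ∈ M.faces) : F.Nonempty := by
  obtain ⟨y, hy, rfl⟩ := hF
  exact ⟨y, mem_connectedComponentIn hy⟩

theorem exists_face {x : Plane} (hx : x ∉ M.skeleton) : ∃ F ∈ M.faces, x ∈ F :=
  ⟨_, ⟨x, hx, rfl⟩, mem_connectedComponentIn hx⟩

theorem subset_face_of_isPreconnected {F H : Set Plane} (hF : F ∈ M.faces)
    (hH : IsPreconnected H) (hs : H ⊆ M.skeletonᶜ) (hne : (H ∩ F).Nonempty) : H ⊆ F := by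
  obtain ⟨y, hy, rfl⟩ := hF
  obtain ⟨z, hz, hz'⟩ := hne
  rw [connectedComponentIn_eq hz']
  exact hH.subset_connectedComponentIn hz hs

theorem face_eq_of_mem {F F' : Set Plane} (hF : F ∈ M.faces) (hF' : F' ∈ M.faces) {x : Plane}
    (hx : x ∈ F) (hx' : x ∈ F') : F = F' := by
  obtain ⟨y, hy, rfl⟩ := hF
  obtain ⟨z, hz, rfl⟩ := hF'
  rw [connectedComponentIn_eq hx, connectedComponentIn_eq hx']

theorem exists_face_of_halfBall {x : Plane} {ε : ℝ} (hε : 0 < ε) {d : Plane} (hd : d ≠ 0)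
    (h : halfBall x ε d ⊆ M.skeletonᶜ) : ∃ F ∈ M.faces, halfBall x ε d ⊆ F := by
  have hne : (halfBall x ε d).Nonempty := by
    have := mem_closure_halfBall (x := x) (ε := ε) (d := d) hd (y := x) (by simpa) (by simp)
    exact closure_nonempty_iff.1 ⟨x, this⟩
  obtain ⟨y, hy⟩ := hne
  obtain ⟨F, hF, hyF⟩ := exists_face (h hy)
  exact ⟨F, hF, subset_face_of_isPreconnected hF (convex_halfBall _ _ _).isPreconnected h
    ⟨y, hy, hyF⟩⟩

namespace Tame

theorem mem_skeleton_of_mem_closure (hT : M.Tame) {F : Set Plane} (hF : F ∈ M.faces) {x : Plane}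
    (hx : x ∈ closure F) (hxF : x ∉ F) : x ∈ M.skeleton := by
  by_contra hs
  obtain ⟨F', hF', hxF'⟩ := exists_face hs
  obtain ⟨y, hy, hy'⟩ := mem_closure_iff.1 hx F' (hT.isOpen_face hF') hxF'
  exact hxF (face_eq_of_mem hF' hF hy hy' ▸ hxF')

/-- Around a point of an edge that is not a vertex, the skeleton is a line. -/
theorem exists_line (hT : M.Tame) {e : Set Plane} (he : e ∈ M.edges) {x : Plane} (hx : x ∈ e)
    (hxv : x ∉ M.verts) : ∃ ε > 0, ∃ d : Plane, d ≠ 0 ∧ (∀ y ∈ e, cr d (y - x) = 0) ∧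
      ∀ y ∈ M.skeleton, dist y x < ε → cr d (y - x) = 0 := by
  obtain ⟨ε, hε, h1, h2⟩ := hT.star x
  obtain ⟨u, hu, v, hv, huv, hs, hi⟩ := exists_edge_ends hT.hasConvexPolygonFaces he
  have hline : ∀ y ∈ e, cr (v - u) (y - x) = 0 := by
    intro y hy
    rw [hs, segment_eq_image'] at hx hy
    obtain ⟨a, -, rfl⟩ := hx
    obtain ⟨b, -, rfl⟩ := hy
    have : u + b • (v - u) - (u + a • (v - u)) = (b - a) • (v - u) := by module
    rw [this, cr_smul, cr_self, mul_zero]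
  refine ⟨ε, hε, v - u, sub_ne_zero.2 huv.symm, hline, ?_⟩
  rintro y (hyv | ⟨e', he', hye'⟩) hyx
  · exact absurd (h1 y hyv hyx ▸ hyv) hxv
  · have hxe' := h2 e' he' y hye' hyx
    by_cases hee : e' = e
    · subst hee; exact hline y hye'
    · exact absurd (M.edge_inter e' he' e he hee ⟨hxe', hx⟩) hxv

/-- Around an inner point of the edge the skeleton is a line, so a face that accumulates there
contains one of the two half discs. Membership in `closure F` is therefore an open condition on the
open segment as well as a closed one, and the open segment is connected. -/
theorem edge_subset_closure (hT : M.Tame) {F : Set Plane} (hF : F ∈ M.faces) {e : Set Plane}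
    (he : e ∈ M.edges) {z : Plane} (hz : z ∈ e) (hzv : z ∉ M.verts) (hzF : z ∈ closure F) :
    e ⊆ closure F := by
  obtain ⟨u, hu, v, hv, huv, hs, hi⟩ := exists_edge_ends hT.hasConvexPolygonFaces he
  have hloc : ∀ x ∈ e, x ∉ M.verts → x ∈ closure F → ∃ ε > 0, e ∩ Metric.ball x ε ⊆ closure F := by
    intro x hx hxv hxF
    obtain ⟨ε, hε, d, hd, hl, hsk⟩ := hT.exists_line he hx hxv
    refine ⟨ε, hε, ?_⟩
    obtain ⟨y, hyB, hyF⟩ := mem_closure_iff.1 hxF _ Metric.isOpen_ball (Metric.mem_ball_self hε)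
    have hd' : -d ≠ 0 := neg_ne_zero.2 hd
    have hout : ∀ d', (d' = d ∨ d' = -d) → halfBall x ε d' ⊆ M.skeletonᶜ := by
      rintro d' hd' y ⟨h1, h2⟩ hy
      have := hsk y hy h1
      rcases hd' with rfl | rfl
      · exact h2.ne' this
      · rw [cr_neg_left, this, neg_zero] at h2; exact lt_irrefl _ h2
    have hone : ∃ d', (d' = d ∨ d' = -d) ∧ (halfBall x ε d' ∩ F).Nonempty := by
      have hop : IsOpen (F ∩ Metric.ball x ε) := (hT.isOpen_face hF).inter Metric.isOpen_ball
      by_cases h0 : cr d (y - x) = 0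
      · obtain ⟨s, hs, h1, h2⟩ := exists_add_smul_mem hop ⟨hyF, hyB⟩ (rot d)
        refine ⟨d, Or.inl rfl, _, ⟨h2, ?_⟩, h1⟩
        rw [add_sub_right_comm, cr_add, h0, cr_smul, zero_add]
        exact mul_pos hs (cr_rot_pos hd)
      · rcases lt_or_gt_of_ne h0 with h0 | h0
        · exact ⟨-d, Or.inr rfl, y, ⟨hyB, by rw [cr_neg_left]; linarith⟩, hyF⟩
        · exact ⟨d, Or.inl rfl, y, ⟨hyB, h0⟩, hyF⟩
    obtain ⟨d', hdd, hne⟩ := hone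
    have hsub := subset_face_of_isPreconnected hF (convex_halfBall _ _ _).isPreconnected
      (hout d' hdd) hne
    rintro y ⟨hye, hyx⟩
    refine closure_mono hsub (mem_closure_halfBall ?_ hyx ?_)
    · rcases hdd with rfl | rfl <;> assumption
    · have := hl y hye
      rcases hdd with rfl | rfl
      · exact this
      · rw [cr_neg_left, this, neg_zero]
  have hnv : ∀ x ∈ openSegment ℝ u v, x ∉ M.verts := by
    intro x hx hxv
    have : x ∈ M.verts ∩ e := ⟨hxv, hs ▸ openSegment_subset_segment ℝ u v hx⟩
    rw [hi] at this
    rcases this with rfl | rfl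
    · exact huv (left_mem_openSegment_iff.1 hx)
    · exact huv (right_mem_openSegment_iff.1 hx)
  have hz' : z ∈ openSegment ℝ u v := by
    rw [hs, ← insert_endpoints_openSegment] at hz
    rcases hz with rfl | rfl | hz
    · exact absurd hu hzv
    · exact absurd hv hzv
    · exact hz
  have hop : openSegment ℝ u v ⊆ closure F := by
    choose! ε hε hball using hloc
    let U : Set Plane := ⋃ x ∈ openSegment ℝ u v ∩ closure F, Metric.ball x (ε x)
    have hsub : openSegment ℝ u v ⊆ e := hs ▸ openSegment_subset_segment ℝ u v
    by_contra hcon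
    obtain ⟨y, hy, hyF⟩ := not_subset.1 hcon
    have hpre := (convex_openSegment (𝕜 := ℝ) u v).isPreconnected
    obtain ⟨w, hw, hwU, hwF⟩ := hpre U (closure F)ᶜ
      (isOpen_biUnion fun _ _ => Metric.isOpen_ball) isClosed_closure.isOpen_compl
      (by
        intro x hx
        by_cases hxF : x ∈ closure F
        · exact Or.inl (mem_biUnion (show x ∈ _ from ⟨hx, hxF⟩)
            (Metric.mem_ball_self (hε x (hsub hx) (hnv x hx) hxF)))
        · exact Or.inr hxF)
      ⟨z, hz', mem_biUnion (show z ∈ _ from ⟨hz', hzF⟩)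
            (Metric.mem_ball_self (hε z hz hzv hzF))⟩ ⟨y, hy, hyF⟩
    simp only [U, mem_iUnion] at hwU
    obtain ⟨x, ⟨hx, hxF⟩, hwx⟩ := hwU
    exact hwF (hball x (hsub hx) (hnv x hx) hxF ⟨hsub hw, hwx⟩)
  rw [hs, ← closure_openSegment]
  exact closure_minimal hop isClosed_closure

/-- The two half discs at the midpoint of the edge lie in faces. One face cannot contain both: by
convexity it would contain the midpoint. A third face with this edge would have to meet one of the
half discs. -/
theorem exists_two_faces (hT : M.Tame) {e : Set Plane} (he : e ∈ M.edges) :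
    ∃ F₁ ∈ M.faces, ∃ F₂ ∈ M.faces, F₁ ≠ F₂ ∧ ∀ F ∈ M.faces, e ⊆ closure F ↔ F = F₁ ∨ F = F₂ := by
  obtain ⟨u, hu, v, hv, huv, hs, hi⟩ := exists_edge_ends hT.hasConvexPolygonFaces he
  obtain ⟨x, hx⟩ : ∃ x, x = midpoint ℝ u v := ⟨_, rfl⟩
  have hxe : x ∈ e := by rw [hs, hx]; exact midpoint_mem_segment u v
  have hxv : x ∉ M.verts := by
    intro h
    have : x ∈ M.verts ∩ e := ⟨h, hxe⟩
    rw [hi, hx] at this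
    rcases this with h | h
    · exact huv ((midpoint_eq_left_iff (R := ℝ)).1 h)
    · exact huv ((midpoint_eq_right_iff (R := ℝ)).1 h)
  obtain ⟨ε, hε, d, hd, hl, hsk⟩ := hT.exists_line he hxe hxv
  have hd' : -d ≠ 0 := neg_ne_zero.2 hd
  have hout1 : halfBall x ε d ⊆ M.skeletonᶜ := fun y ⟨h1, h2⟩ hy => h2.ne' (hsk y hy h1)
  have hout2 : halfBall x ε (-d) ⊆ M.skeletonᶜ := by
    rintro y ⟨h1, h2⟩ hy
    rw [cr_neg_left, hsk y hy h1, neg_zero] at h2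
    exact lt_irrefl _ h2
  obtain ⟨F₁, hF₁, h1⟩ := exists_face_of_halfBall hε hd hout1
  obtain ⟨F₂, hF₂, h2⟩ := exists_face_of_halfBall hε hd' hout2
  have hx1 : x ∈ closure F₁ := closure_mono h1 (mem_closure_halfBall hd (by simpa) (by simp))
  have hx2 : x ∈ closure F₂ := closure_mono h2 (mem_closure_halfBall hd' (by simpa) (by simp))
  refine ⟨F₁, hF₁, F₂, hF₂, ?_, ?_⟩
  · rintro rfl
    obtain ⟨s, hs, hs1⟩ := exists_add_smul_mem
      (U := Metric.ball x ε) Metric.isOpen_ball (Metric.mem_ball_self hε) (rot d)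
    have hs2 : x - s • rot d ∈ Metric.ball x ε := by
      rw [Metric.mem_ball, dist_eq_norm] at hs1 ⊢
      rw [show x + s • rot d - x = s • rot d by abel] at hs1
      rwa [show x - s • rot d - x = -(s • rot d) by abel, norm_neg]
    have hp := mul_pos hs (cr_rot_pos hd)
    have ha : x + s • rot d ∈ F₁ := h1 ⟨hs1, by
      rw [show x + s • rot d - x = s • rot d by abel, cr_smul]; exact hp⟩
    have hb : x - s • rot d ∈ F₁ := h2 ⟨hs2, by
      rw [show x - s • rot d - x = -(s • rot d) by abel, cr_neg_left, cr_neg, cr_smul, neg_neg]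
      exact hp⟩
    have := (hT.convex_face hF₁).midpoint_mem ha hb
    rw [midpoint_add_sub] at this
    exact disjoint_face_skeleton hF₁ this (Or.inr ⟨e, he, hxe⟩)
  · intro F hF
    constructor
    · intro heF
      obtain ⟨y, hyB, hyF⟩ := mem_closure_iff.1 (heF hxe) _ Metric.isOpen_ball
        (Metric.mem_ball_self hε)
      have hop : IsOpen (F ∩ Metric.ball x ε) := (hT.isOpen_face hF).inter Metric.isOpen_ball
      by_cases h0 : cr d (y - x) = 0
      · obtain ⟨s, hs, hs1, hs2⟩ := exists_add_smul_mem hop ⟨hyF, hyB⟩ (rot d)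
        refine Or.inl (face_eq_of_mem hF hF₁ hs1 (h1 ⟨hs2, ?_⟩))
        rw [add_sub_right_comm, cr_add, h0, cr_smul, zero_add]
        exact mul_pos hs (cr_rot_pos hd)
      · rcases lt_or_gt_of_ne h0 with h0 | h0
        · exact Or.inr (face_eq_of_mem hF hF₂ hyF (h2 ⟨hyB, by rw [cr_neg_left]; linarith⟩))
        · exact Or.inl (face_eq_of_mem hF hF₁ hyF (h1 ⟨hyB, h0⟩))
    · rintro (rfl | rfl)
      · exact hT.edge_subset_closure hF he hxe hxv hx1
      · exact hT.edge_subset_closure hF he hxe hxv hx2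

end Tame
end PlaneMap

/-! ### The two edges of a face at a vertex, and adjacent flags -/

namespace PlaneMap

variable {M : PlaneMap}

theorem mem_segment_iff_add_smul {v w z : Plane} :
    z ∈ segment ℝ v w ↔ ∃ k ∈ Icc (0 : ℝ) 1, z = v + k • (w - v) := by
  rw [segment_eq_image']
  exact ⟨fun ⟨k, hk, h⟩ => ⟨k, hk, h.symm⟩, fun ⟨k, hk, h⟩ => ⟨k, hk, h.symm⟩⟩

namespace Tame

/-- The line through `v` and `f` cuts a small disc at `v` into two halves. If no edge of `F` leaves
`v` into the half given by `d`, then `F` has no boundary points there and fills this half by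
connectedness. -/
theorem halfBall_or_edge (hT : M.Tame) {F : Set Plane} (hF : F ∈ M.faces) {v : Plane}
    (hv : v ∈ M.verts) (hvF : v ∈ closure F) {f : Plane} (hf : f ∈ F) {d : Plane}
    (hd : d = f - v ∨ d = -(f - v)) :
    (∃ ε > 0, halfBall v ε d ⊆ F) ∨ ∃ e ∈ M.edges, e ⊆ closure F ∧ ∃ w ∈ M.verts, w ≠ v ∧
      e = segment ℝ v w ∧ M.verts ∩ e = {v, w} ∧ 0 < cr d (w - v) := by
  obtain ⟨ε, hε, h1, h2⟩ := hT.star v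
  have hFo := hT.isOpen_face hF
  have hvn : v ∉ F := fun h => disjoint_face_skeleton hF h (Or.inl hv)
  have hfv : f - v ≠ 0 := sub_ne_zero.2 fun h => hvn (h ▸ hf)
  have hd0 : d ≠ 0 := by
    rcases hd with rfl | rfl
    · exact hfv
    · exact neg_ne_zero.2 hfv
  have hdf : cr d (f - v) = 0 := by
    rcases hd with rfl | rfl
    · exact cr_self _
    · rw [cr_neg_left, cr_self, neg_zero]
  refine or_iff_not_imp_right.2 fun hno => ⟨ε, hε, ?_⟩
  have hcl : halfBall v ε d ∩ closure F ⊆ F := by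
    rintro z ⟨⟨hz1, hz2⟩, hzF⟩
    by_contra hzn
    have hzv : z ≠ v := by rintro rfl; simp at hz2
    rcases hT.mem_skeleton_of_mem_closure hF hzF hzn with hzs | ⟨e, he, hze⟩
    · exact hzv (h1 z hzs hz1)
    · have hve := h2 e he z hze hz1
      obtain ⟨w, hw, hwv, hs, hi⟩ := exists_other_end hT.hasConvexPolygonFaces he hv hve
      have hsub := hT.edge_subset_closure hF he hze (fun h => hzv (h1 z h hz1)) hzF
      refine hno ⟨e, he, hsub, w, hw, hwv, hs, hi, ?_⟩
      rw [hs, mem_segment_iff_add_smul] at hze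
      obtain ⟨k, ⟨hk, -⟩, rfl⟩ := hze
      rw [add_sub_cancel_left, cr_smul] at hz2
      exact pos_of_mul_pos_right hz2 hk
  have hne : (halfBall v ε d ∩ F).Nonempty := by
    have hvB : v ∈ Metric.ball v ε := Metric.mem_ball_self hε
    obtain ⟨s, hs, hs1⟩ : ∃ s : ℝ, v + s • (f - v) ∈ Metric.ball v ε ∧ s ∈ Ioc (0:ℝ) 1 :=
      ((eventually_add_smul_mem Metric.isOpen_ball hvB (f - v)).and
        (Ioc_mem_nhdsGT one_pos)).exists
    have hsF : v + s • (f - v) ∈ F := by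
      rcases hs1.2.eq_or_lt with rfl | hlt
      · simpa using hf
      · apply (hT.convex_face hF).openSegment_subset_of_isOpen hFo hf hvF
        rw [openSegment_symm, openSegment_eq_image']
        exact ⟨s, ⟨hs1.1, hlt⟩, rfl⟩
    obtain ⟨t, ht, ht1, ht2⟩ := exists_add_smul_mem (hFo.inter Metric.isOpen_ball) ⟨hsF, hs⟩ (rot d)
    refine ⟨_, ⟨ht2, ?_⟩, ht1⟩
    rw [show v + s • (f - v) + t • rot d - v = s • (f - v) + t • rot d by abel, cr_add, cr_smul,
      cr_smul, hdf, mul_zero, zero_add]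
    exact mul_pos ht (cr_rot_pos hd0)
  have hpre := (convex_halfBall v ε d).isPreconnected
  by_contra hcon
  obtain ⟨y, hy, hyF⟩ := not_subset.1 hcon
  obtain ⟨w, hw, hw1, hw2⟩ := hpre F (closure F)ᶜ hFo isClosed_closure.isOpen_compl
    (fun x hx => or_iff_not_imp_right.2 fun h => hcl ⟨hx, not_notMem.1 h⟩) hne
    ⟨y, hy, fun h => hyF (hcl ⟨hy, h⟩)⟩
  exact hw2 (subset_closure hw1)

/-- `F` cannot fill a half disc at `v`. The opposite half would be filled too or contain an edge of
`F`; either way `v` would lie strictly between a point of `F` and a point of `closure F`, hence in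
`F`. -/
theorem exists_edge_side (hT : M.Tame) {F : Set Plane} (hF : F ∈ M.faces) {v : Plane}
    (hv : v ∈ M.verts) (hvF : v ∈ closure F) {f : Plane} (hf : f ∈ F) {d : Plane}
    (hd : d = f - v ∨ d = -(f - v)) :
    ∃ e ∈ M.edges, e ⊆ closure F ∧ ∃ w ∈ M.verts, w ≠ v ∧
      e = segment ℝ v w ∧ M.verts ∩ e = {v, w} ∧ 0 < cr d (w - v) := by
  refine (hT.halfBall_or_edge hF hv hvF hf hd).resolve_left ?_
  rintro ⟨ε, hε, hsub⟩
  have hFo := hT.isOpen_face hF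
  have hvn : v ∉ F := fun h => disjoint_face_skeleton hF h (Or.inl hv)
  have hfv : f - v ≠ 0 := sub_ne_zero.2 fun h => hvn (h ▸ hf)
  have hd0 : d ≠ 0 := by
    rcases hd with rfl | rfl
    · exact hfv
    · exact neg_ne_zero.2 hfv
  have hd' : -d = f - v ∨ -d = -(f - v) := by
    rcases hd with rfl | rfl
    · exact Or.inr rfl
    · exact Or.inl (neg_neg _)
  have hpt : ∀ n : Plane, 0 < cr d n → ∀ᶠ s : ℝ in 𝓝[>] 0, v + s • n ∈ halfBall v ε d := by
    intro n hn
    filter_upwards [eventually_add_smul_mem Metric.isOpen_ball (Metric.mem_ball_self hε) n,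
      self_mem_nhdsWithin] with s h1 h2
    refine ⟨h1, ?_⟩
    rw [add_sub_cancel_left, cr_smul]
    exact mul_pos h2 hn
  rcases hT.halfBall_or_edge hF hv hvF hf hd' with ⟨ε', hε', hsub'⟩ | ⟨e, -, heF, w, -, -, hs, -, hw⟩
  · have hpt' : ∀ᶠ s : ℝ in 𝓝[>] 0, v + s • (-rot d) ∈ halfBall v ε' (-d) := by
      filter_upwards [eventually_add_smul_mem Metric.isOpen_ball (Metric.mem_ball_self hε') (-rot d),
        self_mem_nhdsWithin] with s h1 h2
      refine ⟨h1, ?_⟩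
      rw [add_sub_cancel_left, cr_smul, cr_neg_left, cr_neg, neg_neg]
      exact mul_pos h2 (cr_rot_pos hd0)
    obtain ⟨s, h1, h2⟩ := ((hpt _ (cr_rot_pos hd0)).and hpt').exists
    have := (hT.convex_face hF).midpoint_mem (hsub h1) (hsub' h2)
    rw [smul_neg, ← sub_eq_add_neg, midpoint_add_sub] at this
    exact hvn this
  · rw [cr_neg_left, ← cr_neg] at hw
    obtain ⟨s, h1, h2⟩ := ((hpt _ hw).and self_mem_nhdsWithin).exists
    have hwF : w ∈ closure F := heF (hs ▸ right_mem_segment ℝ v w)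
    refine hvn ((hT.convex_face hF).openSegment_subset_of_isOpen hFo (hsub h1) hwF ?_)
    have h2 : 0 < s := h2
    refine ⟨1 / (1 + s), s / (1 + s), by positivity, by positivity, by field_simp, ?_⟩
    ext i
    simp
    field_simp
    ring

/-- If `w` were on the line through `v` and `f`, then a point of the edge would lie strictly between
`f` and a point of `closure F`, hence in `F`: the point `v` itself when `w` and `f` are on different
sides of `v`, otherwise a point of the edge near `v`. -/
theorem cr_edge_ne_zero (hT : M.Tame) {F : Set Plane} (hF : F ∈ M.faces) {v : Plane}
    {f : Plane} (hf : f ∈ F) {e : Set Plane} (he : e ∈ M.edges)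
    (heF : e ⊆ closure F) {w : Plane} (hwv : w ≠ v) (hs : e = segment ℝ v w) :
    cr (f - v) (w - v) ≠ 0 := by
  intro h0
  have hFo := hT.isOpen_face hF
  have hnot : ∀ x ∈ e, x ∉ F := fun x hx h => disjoint_face_skeleton hF h (Or.inr ⟨e, he, hx⟩)
  have hve : v ∈ e := hs ▸ left_mem_segment ℝ v w
  have hwe : w ∈ e := hs ▸ right_mem_segment ℝ v w
  have hfv : f - v ≠ 0 := sub_ne_zero.2 fun h => hnot v hve (h ▸ hf)
  have hdec := cr_decomp (rot (f - v)) (f - v) (w - v)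
  rw [cr_comm (w - v), h0, neg_zero, zero_smul, zero_add] at hdec
  have hp := cr_rot_pos hfv
  rw [cr_comm (rot _) (f - v)] at hdec
  obtain ⟨k, hk⟩ : ∃ k : ℝ, w - v = k • (f - v) := by
    refine ⟨-(cr (f - v) (rot (f - v)))⁻¹ * cr (rot (f - v)) (w - v), ?_⟩
    rw [mul_smul, ← hdec, smul_smul, neg_mul_neg, inv_mul_cancel₀ hp.ne', one_smul]
  have hw : w = v + k • (f - v) := by rw [← hk]; abel
  have hvw : segment ℝ v w ⊆ e := hs.ge
  rcases lt_trichotomy k 0 with hk0 | hk0 | hk0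
  · refine hnot v hve ((hT.convex_face hF).openSegment_subset_of_isOpen hFo hf (heF hwe) ?_)
    have hk1 : 0 < 1 - k := by linarith
    refine ⟨-k / (1 - k), 1 / (1 - k), div_pos (by linarith) hk1, by positivity, by field_simp; ring, ?_⟩
    rw [hw]
    ext i
    simp
    field_simp
    ring
  · rw [hk0, zero_smul, add_zero] at hw; exact hwv hw
  · have hk1 : 0 < 1 + k := by linarith
    refine hnot (v + (k / (1 + k)) • (f - v)) ?_
      ((hT.convex_face hF).openSegment_subset_of_isOpen hFo hf (heF hve) ?_)
    · rw [hs, mem_segment_iff_add_smul]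
      refine ⟨1 / (1 + k), ⟨by positivity, by rw [div_le_one hk1]; linarith⟩, ?_⟩
      rw [hk, smul_smul]; congr 2; ring
    · rw [openSegment_symm, openSegment_eq_image']
      exact ⟨k / (1 + k), ⟨by positivity, by rw [div_lt_one hk1]; linarith⟩, rfl⟩

/-- Of two edges on the same side in different directions, one has a direction that is a positive
combination of the other one's and of `f - v`. By convexity it enters `F` near `v`, but faces
contain no points of edges. -/
theorem edge_side_unique (hT : M.Tame) {F : Set Plane} (hF : F ∈ M.faces) {v : Plane}
    {f : Plane} (hf : f ∈ F) {d : Plane} (hd : d = f - v ∨ d = -(f - v))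
    {e e' : Set Plane} (he : e ∈ M.edges) (he' : e' ∈ M.edges)
    (heF : e ⊆ closure F) (heF' : e' ⊆ closure F) {w w' : Plane}
    (hw : w ∈ M.verts) (hw' : w' ∈ M.verts) (hwv : w ≠ v) (hwv' : w' ≠ v)
    (hs : e = segment ℝ v w) (hi : M.verts ∩ e = {v, w})
    (hs' : e' = segment ℝ v w') (hi' : M.verts ∩ e' = {v, w'})
    (hc : 0 < cr d (w - v)) (hc' : 0 < cr d (w' - v)) : e = e' := by
  have hFo := hT.isOpen_face hF
  have key : ∀ {α β : ℝ} {e e' : Set Plane} {w w' : Plane}, e' ∈ M.edges → e ⊆ closure F →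
      e = segment ℝ v w → e' = segment ℝ v w' → 0 < α → 0 < β →
      w' - v = α • (f - v) + β • (w - v) → False := by
    intro α β e e' w w' he' heF hs hs' hα hβ h
    have hwF : w ∈ closure F := heF (hs ▸ right_mem_segment ℝ v w)
    have hvF : v ∈ closure F := heF (hs ▸ left_mem_segment ℝ v w)
    have hq : (α / (α + β)) • f + (β / (α + β)) • w ∈ F :=
      (hT.convex_face hF).openSegment_subset_of_isOpen hFo hf hwF
        ⟨_, _, by positivity, by positivity, by field_simp, rfl⟩
    have hq' : v + (1 / (1 + α + β)) • (w' - v) ∈ F := by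
      refine (hT.convex_face hF).openSegment_subset_of_isOpen hFo hq hvF
        ⟨(α + β) / (1 + α + β), 1 / (1 + α + β), by positivity, by positivity, by field_simp; ring, ?_⟩
      rw [h]
      ext i
      simp
      field_simp
      ring
    refine disjoint_face_skeleton hF hq' (Or.inr ⟨e', he', ?_⟩)
    rw [hs', mem_segment_iff_add_smul]
    exact ⟨_, ⟨by positivity, by rw [div_le_one (by positivity)]; linarith⟩, rfl⟩
  have hdec := cr_decomp d (w - v) (w' - v)
  have hsolve : w' - v = ((cr d (w - v))⁻¹ * cr (w' - v) (w - v)) • d +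
      ((cr d (w - v))⁻¹ * cr d (w' - v)) • (w - v) := by
    rw [mul_smul, mul_smul, ← smul_add, ← hdec, smul_smul, inv_mul_cancel₀ hc.ne', one_smul]
  have hsolve' : w - v = ((cr d (w' - v))⁻¹ * cr (w - v) (w' - v)) • d +
      ((cr d (w' - v))⁻¹ * cr d (w - v)) • (w' - v) := by
    rw [mul_smul, mul_smul, ← smul_add, ← cr_decomp d (w' - v) (w - v), smul_smul,
      inv_mul_cancel₀ hc'.ne', one_smul]
  rcases hd with rfl | rfl
  · rcases lt_trichotomy (cr (w' - v) (w - v)) 0 with h | h | h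
    · exact (key he heF' hs' hs (mul_pos (inv_pos.2 hc') (by rw [cr_comm]; linarith))
        (by positivity) hsolve').elim
    · rw [h, mul_zero, zero_smul, zero_add] at hsolve
      exact edge_eq_of_parallel hw hw' hwv hwv' hs hi hs' hi' (by positivity) hsolve
    · exact (key he' heF hs hs' (by positivity) (by positivity) hsolve).elim
  · rcases lt_trichotomy (cr (w' - v) (w - v)) 0 with h | h | h
    · rw [smul_neg, ← neg_smul, ← mul_neg] at hsolve
      exact (key he' heF hs hs' (mul_pos (inv_pos.2 hc) (by linarith)) (by positivity)
        hsolve).elim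
    · rw [h, mul_zero, zero_smul, zero_add] at hsolve
      exact edge_eq_of_parallel hw hw' hwv hwv' hs hi hs' hi' (by positivity) hsolve
    · rw [smul_neg, ← neg_smul, ← mul_neg, ← cr_comm] at hsolve'
      exact (key he heF' hs' hs (by positivity) (by positivity) hsolve').elim

/-- Every edge of a face at a vertex has exactly one neighbour in the face at this vertex. -/
theorem existsUnique_next_edge (hT : M.Tame) {F : Set Plane} (hF : F ∈ M.faces) {v : Plane}
    (hv : v ∈ M.verts) {e : Set Plane} (he : e ∈ M.edges) (hve : v ∈ e) (heF : e ⊆ closure F) :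
    ∃! e', e' ∈ M.edges ∧ v ∈ e' ∧ e' ⊆ closure F ∧ e' ≠ e := by
  obtain ⟨f, hf⟩ := face_nonempty hF
  obtain ⟨w, hw, hwv, hs, hi⟩ := exists_other_end hT.hasConvexPolygonFaces he hv hve
  have hne := hT.cr_edge_ne_zero hF hf he heF hwv hs
  obtain ⟨d, hd, hd', hc⟩ : ∃ d, (d = f - v ∨ d = -(f - v)) ∧ (-d = f - v ∨ -d = -(f - v)) ∧
      0 < cr d (w - v) := by
    rcases lt_or_gt_of_ne hne with h | h
    · exact ⟨_, Or.inr rfl, Or.inl (neg_neg _), by rw [cr_neg_left]; linarith⟩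
    · exact ⟨_, Or.inl rfl, Or.inr rfl, h⟩
  obtain ⟨e', he', heF', w', hw', hwv', hs', hi', hc'⟩ :=
    hT.exists_edge_side hF hv (heF hve) hf hd'
  refine ⟨e', ⟨he', hs' ▸ left_mem_segment ℝ v w', heF', ?_⟩, ?_⟩
  · rintro rfl
    have hww : w = w' := by
      have : w ∈ M.verts ∩ e' := hi ▸ Or.inr rfl
      rw [hi'] at this
      exact this.resolve_left hwv
    subst hww
    rw [cr_neg_left] at hc'
    linarith
  · rintro e'' ⟨he'', hve'', heF'', hne''⟩
    obtain ⟨w'', hw'', hwv'', hs'', hi''⟩ :=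
      exists_other_end hT.hasConvexPolygonFaces he'' hv hve''
    have hne2 : cr d (w'' - v) ≠ 0 := by
      have := hT.cr_edge_ne_zero hF hf he'' heF'' hwv'' hs''
      rcases hd with rfl | rfl
      · exact this
      · rwa [cr_neg_left, neg_ne_zero]
    rcases lt_or_gt_of_ne hne2 with h | h
    · exact hT.edge_side_unique hF hf hd' he'' he' heF'' heF' hw'' hw' hwv'' hwv' hs'' hi'' hs' hi'
        (by rw [cr_neg_left]; linarith) hc'
    · exact absurd (hT.edge_side_unique hF hf hd he'' he heF'' heF hw'' hw hwv'' hwv hs'' hi'' hs hi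
        h hc) hne''

theorem exists_edge_of_mem_closure (hT : M.Tame) {F : Set Plane} (hF : F ∈ M.faces) {z : Plane}
    (hz : z ∈ closure F) (hzF : z ∉ F) : ∃ e ∈ M.edges, z ∈ e ∧ e ⊆ closure F := by
  by_cases hv : z ∈ M.verts
  · obtain ⟨f, hf⟩ := face_nonempty hF
    obtain ⟨e, he, heF, w, -, -, hs, -⟩ := hT.exists_edge_side hF hv hz hf (Or.inl rfl)
    exact ⟨e, he, hs ▸ left_mem_segment ℝ z w, heF⟩
  · rcases hT.mem_skeleton_of_mem_closure hF hz hzF with h | ⟨e, he, hze⟩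
    · exact absurd h hv
    · exact ⟨e, he, hze, hT.edge_subset_closure hF he hze hv hz⟩

/-- Around an isolated vertex a half disc would lie in a face, whose boundary would then contain the
vertex; but boundary points of faces lie on edges. -/
theorem exists_edge_of_vert (hT : M.Tame) {v : Plane} (hv : v ∈ M.verts) :
    ∃ e ∈ M.edges, v ∈ e := by
  by_contra! hno
  obtain ⟨ε, hε, h1, h2⟩ := hT.star v
  obtain ⟨d, hd⟩ := exists_ne (0 : Plane)
  have hsub : halfBall v ε d ⊆ M.skeletonᶜ := by
    rintro y ⟨hy, hy'⟩ (h | ⟨e, he, hye⟩)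
    · rw [h1 y h hy, sub_self, cr_zero] at hy'
      exact lt_irrefl _ hy'
    · exact hno e he (h2 e he y hye hy)
  obtain ⟨F, hF, hFs⟩ := exists_face_of_halfBall hε hd hsub
  have hvF : v ∈ closure F := closure_mono hFs (mem_closure_halfBall hd (by simpa) (by simp))
  obtain ⟨e, he, hve, -⟩ := hT.exists_edge_of_mem_closure hF hvF
    fun h => disjoint_face_skeleton hF h (Or.inl hv)
  exact hno e he hve

/-- All adjacent flags exist and are unique. -/
theorem existsUnique_isAdj (hT : M.Tame) (i : Fin 3) (Φ : M.Flag) : ∃! Ψ, Φ.IsAdj i Ψ := by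
  obtain ⟨v, e, F, hv, he, hF, hve, heF⟩ := Φ
  have h3 : ∀ i : Fin 3, i = 0 ∨ i = 1 ∨ i = 2 := by decide
  rcases h3 i with rfl | rfl | rfl
  · obtain ⟨w, hw, hwv, hs, hi⟩ := exists_other_end hT.hasConvexPolygonFaces he hv hve
    refine ⟨⟨w, e, F, hw, he, hF, hs ▸ right_mem_segment ℝ v w, heF⟩, ⟨?_, ?_⟩, ?_⟩
    · intro h; exact hwv (congrArg Flag.vert h)
    · simp
    · rintro ⟨v', e', F', hv', he', hF', hve', heF'⟩ ⟨hne, -, h1, h2⟩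
      obtain rfl : e' = e := h1 (by decide)
      obtain rfl : F' = F := h2 (by decide)
      have : v' ∈ M.verts ∩ e' := ⟨hv', hve'⟩
      rw [hi] at this
      rcases this with rfl | rfl
      · exact absurd rfl hne
      · rfl
  · obtain ⟨e', ⟨he', hve', heF', hne⟩, hu⟩ := hT.existsUnique_next_edge hF hv he hve heF
    refine ⟨⟨v, e', F, hv, he', hF, hve', heF'⟩, ⟨?_, ?_⟩, ?_⟩
    · intro h; exact hne (congrArg Flag.edge h)
    · simp
    · rintro ⟨v', e'', F', hv', he'', hF', hve'', heF''⟩ ⟨hne', h0, -, h2⟩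
      obtain rfl : v' = v := h0 (by decide)
      obtain rfl : F' = F := h2 (by decide)
      obtain rfl := hu e'' ⟨he'', hve'', heF'', fun h => hne' (by subst h; rfl)⟩
      rfl
  · obtain ⟨F₁, hF₁, F₂, hF₂, hne, h12⟩ := hT.exists_two_faces he
    obtain ⟨G, hG, hGF, hu⟩ : ∃ G ∈ M.faces, G ≠ F ∧ ∀ F' ∈ M.faces, e ⊆ closure F' ↔ F' = F ∨ F' = G := by
      rcases (h12 F hF).1 heF with rfl | rfl
      · exact ⟨F₂, hF₂, hne.symm, h12⟩
      · exact ⟨F₁, hF₁, hne, fun F' hF' => (h12 F' hF').trans or_comm⟩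
    refine ⟨⟨v, e, G, hv, he, hG, hve, (hu G hG).2 (Or.inr rfl)⟩, ⟨?_, ?_⟩, ?_⟩
    · intro h; exact hGF (congrArg Flag.face h)
    · simp
    · rintro ⟨v', e', F', hv', he', hF', hve', heF'⟩ ⟨hne', h0, h1, -⟩
      obtain rfl : v' = v := h0 (by decide)
      obtain rfl : e' = e := h1 (by decide)
      rcases (hu F' hF').1 heF' with rfl | rfl
      · exact absurd rfl hne'
      · rfl

theorem isAdj_adj (hT : M.Tame) (i : Fin 3) (Φ : M.Flag) : Φ.IsAdj i (Φ.adj i) := by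
  obtain ⟨Ψ, h1, h2⟩ := hT.existsUnique_isAdj i Φ
  rwa [Flag.adj_eq_of_isAdj h1 h2]

theorem adj_ne (hT : M.Tame) (i : Fin 3) (Φ : M.Flag) : Φ.adj i ≠ Φ := (hT.isAdj_adj i Φ).1

theorem eq_adj (hT : M.Tame) {i : Fin 3} {Φ Ψ : M.Flag} (h : Φ.IsAdj i Ψ) : Ψ = Φ.adj i :=
  (hT.existsUnique_isAdj i Φ).unique h (hT.isAdj_adj i Φ)

end Tame
end PlaneMap

/-- Used to leave a face along a ray, and at the end to bound the component inside the curve. -/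
theorem IsPreconnected.exists_mem_closure_diff {X : Type*} [TopologicalSpace X] {R F : Set X}
    (hR : IsPreconnected R) (hF : IsOpen F) (h1 : (R ∩ F).Nonempty) (h2 : (R ∩ Fᶜ).Nonempty) :
    ∃ z ∈ R, z ∈ closure F ∧ z ∉ F := by
  by_contra! hno
  obtain ⟨y, hy, hyF⟩ := h2
  obtain ⟨w, -, hw1, hw2⟩ := hR F (closure F)ᶜ hF isClosed_closure.isOpen_compl
    (fun x hx => or_iff_not_imp_right.2 fun h => hno x hx (not_notMem.1 h)) h1
    ⟨y, hy, fun h => hyF (hno y hy h)⟩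
  exact hw2 (subset_closure hw1)

/-! ### The triangulation of the plane by the triangles of the flags -/

namespace PlaneMap

variable {M : PlaneMap}

/-- The affine parametrization of the triangle representing a flag. -/
def Flag.tau (c : Set Plane → Plane) (Φ : M.Flag) (x : stdSimplex ℝ (Fin 3)) : Plane :=
  ∑ j, x.1 j • Φ.corner c j

theorem Flag.tau_eq (c : Set Plane → Plane) (Φ : M.Flag) (x : stdSimplex ℝ (Fin 3)) :
    Φ.tau c x = x.1 0 • Φ.vert + x.1 1 • M.edgeMid Φ.edge + x.1 2 • c Φ.face := by
  simp [Flag.tau, Fin.sum_univ_three, Flag.corner]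

theorem Flag.continuous_tau (c : Set Plane → Plane) (Φ : M.Flag) : Continuous (Φ.tau c) := by
  unfold Flag.tau
  refine continuous_finsetSum _ fun j _ => ?_
  exact ((continuous_apply j).comp continuous_subtype_val).smul continuous_const

theorem Flag.isCompact_tau_image (c : Set Plane → Plane) (Φ : M.Flag)
    {S : Set (stdSimplex ℝ (Fin 3))} (hS : IsClosed S) : IsCompact (Φ.tau c '' S) :=
  hS.isCompact.image (Φ.continuous_tau c)

theorem Flag.isClosed_range_tau (c : Set Plane → Plane) (Φ : M.Flag) :
    IsClosed (range (Φ.tau c)) := by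
  rw [← image_univ]
  exact (Φ.isCompact_tau_image c isClosed_univ).isClosed

theorem Flag.tau_adj (c : Set Plane → Plane) (Φ : M.Flag) {i : Fin 3}
    {x : stdSimplex ℝ (Fin 3)} (hi : x.1 i = 0) : (Φ.adj i).tau c x = Φ.tau c x := by
  refine Finset.sum_congr rfl fun j _ => ?_
  by_cases hij : i = j
  · subst hij; rw [hi, zero_smul, zero_smul]
  · rw [Flag.corner_adj c Φ hij]

theorem simplex_sum (x : stdSimplex ℝ (Fin 3)) : x.1 0 + x.1 1 + x.1 2 = 1 := by
  have := x.2.2; rwa [Fin.sum_univ_three] at this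

/-- The chosen points lie in their faces. -/
def IsCentre (M : PlaneMap) (c : Set Plane → Plane) : Prop := ∀ F ∈ M.faces, c F ∈ F

/-- The corners of all triangles. -/
def corners (M : PlaneMap) (c : Set Plane → Plane) : Set Plane :=
  range fun p : M.Flag × Fin 3 => p.1.corner c p.2

theorem Flag.exists_ends (hM : M.HasConvexPolygonFaces) (Φ : M.Flag) :
    ∃ w ∈ M.verts, w ≠ Φ.vert ∧ Φ.edge = segment ℝ Φ.vert w ∧ M.verts ∩ Φ.edge = {Φ.vert, w} :=
  exists_other_end hM Φ.edge_mem Φ.vert_mem Φ.vert_edge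

/-- A triangle is the cone with apex `c Φ.face` over half an edge. This gives polar coordinates:
`x.1 2` measures the closeness to the centre, and `x.1 1 / (2 * (1 - x.1 2))`, at most 1/2, is the
position on the edge at which the ray arrives. -/
theorem Flag.exists_half_edge (hM : M.HasConvexPolygonFaces) (c : Set Plane → Plane) (Φ : M.Flag)
    (x : stdSimplex ℝ (Fin 3)) (hx : x.1 2 ≠ 1) :
    ∃ w ∈ M.verts, w ≠ Φ.vert ∧ Φ.edge = segment ℝ Φ.vert w ∧ M.verts ∩ Φ.edge = {Φ.vert, w} ∧
      Φ.vert + (x.1 1 / (2 * (1 - x.1 2))) • (w - Φ.vert) ∈ Φ.edge ∧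
      Φ.tau c x = x.1 2 • c Φ.face +
        (1 - x.1 2) • (Φ.vert + (x.1 1 / (2 * (1 - x.1 2))) • (w - Φ.vert)) := by
  obtain ⟨w, hw, hwv, hs, hi⟩ := Φ.exists_ends hM
  have h0 := x.2.1 0
  have h1 := x.2.1 1
  have h2 := x.2.1 2
  have hsum := simplex_sum x
  have hlt : 0 < 1 - x.1 2 := by
    rcases (show x.1 2 ≤ 1 by linarith).lt_or_eq with h | h
    · linarith
    · exact absurd h hx
  refine ⟨w, hw, hwv, hs, hi, ?_, ?_⟩
  · rw [hs, mem_segment_iff_add_smul]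
    refine ⟨_, ⟨by positivity, ?_⟩, rfl⟩
    rw [div_le_one (by positivity)]; linarith
  · rw [Flag.tau_eq, edgeMid_eq hwv hi, smul_add (1 - x.1 2), smul_smul (1 - x.1 2),
      show (1 - x.1 2) * (x.1 1 / (2 * (1 - x.1 2))) = x.1 1 / 2 by field_simp]
    rw [show 1 - x.1 2 = x.1 0 + x.1 1 by linarith]
    module

theorem Flag.edge_subset_skeleton (Φ : M.Flag) : Φ.edge ⊆ M.skeleton :=
  fun _ hx => Or.inr ⟨_, Φ.edge_mem, hx⟩

namespace Tame

theorem tau_mem_face (hT : M.Tame) {c : Set Plane → Plane} (hc : M.IsCentre c) (Φ : M.Flag)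
    {x : stdSimplex ℝ (Fin 3)} (hx : x.1 2 ≠ 0) : Φ.tau c x ∈ Φ.face := by
  have h0 := x.2.1 0
  have h1 := x.2.1 1
  have h2 := x.2.1 2
  have hsum := simplex_sum x
  by_cases hx1 : x.1 2 = 1
  · have e0 : x.1 0 = 0 := by linarith
    have e1 : x.1 1 = 0 := by linarith
    rw [Flag.tau_eq, e0, e1, hx1]
    simpa using hc _ Φ.face_mem
  · obtain ⟨w, -, -, -, -, hz, ht⟩ := Φ.exists_half_edge hT.hasConvexPolygonFaces c x hx1
    rw [ht]
    refine (hT.convex_face Φ.face_mem).openSegment_subset_of_isOpen (hT.isOpen_face Φ.face_mem)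
      (hc _ Φ.face_mem) (Φ.edge_face hz) ⟨_, _, h2.lt_of_ne' hx, ?_, by ring, rfl⟩
    rcases (show x.1 2 ≤ 1 by linarith).lt_or_eq with h | h
    · linarith
    · exact absurd h hx1

theorem tau_mem_edge (hT : M.Tame) (c : Set Plane → Plane) (Φ : M.Flag)
    {x : stdSimplex ℝ (Fin 3)} (hx : x.1 2 = 0) : Φ.tau c x ∈ Φ.edge := by
  obtain ⟨w, -, -, -, -, hz, ht⟩ := Φ.exists_half_edge hT.hasConvexPolygonFaces c x
    (by rw [hx]; norm_num)
  rw [ht]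
  rw [hx] at hz ⊢
  simpa using hz

theorem tau_mem_closure (hT : M.Tame) {c : Set Plane → Plane} (hc : M.IsCentre c) (Φ : M.Flag)
    (x : stdSimplex ℝ (Fin 3)) : Φ.tau c x ∈ closure Φ.face := by
  by_cases hx : x.1 2 = 0
  · exact Φ.edge_face (hT.tau_mem_edge c Φ hx)
  · exact subset_closure (hT.tau_mem_face hc Φ hx)

/-- A ray from a point of an open convex set leaves it only once: if `d < d'`, then `z` would lie
strictly between `c` and `z'`, hence in `F`. -/
theorem eq_of_ray_eq (hT : M.Tame) {F : Set Plane} (hF : F ∈ M.faces) {c z z' : Plane}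
    (hc : c ∈ F) (hz : z ∈ closure F) (hzF : z ∉ F) (hz' : z' ∈ closure F) (hzF' : z' ∉ F)
    {d d' : ℝ} (hd : d < 1) (hd' : d' < 1)
    (h : d • c + (1 - d) • z = d' • c + (1 - d') • z') : d = d' ∧ z = z' := by
  have key : ∀ {z z' : Plane} {d d' : ℝ}, z ∉ F → z' ∈ closure F → d < 1 → d' < 1 →
      d • c + (1 - d) • z = d' • c + (1 - d') • z' → ¬ d < d' := by
    intro z z' d d' hzF hz' hd hd' h hlt
    refine hzF ((hT.convex_face hF).openSegment_subset_of_isOpen (hT.isOpen_face hF) hc hz'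
      ⟨(d' - d) / (1 - d), (1 - d') / (1 - d), div_pos (by linarith) (by linarith),
        div_pos (by linarith) (by linarith), ?_, ?_⟩)
    · rw [← add_div, div_eq_one_iff_eq (by linarith)]; ring
    · have h1 : (1 - d) ≠ 0 := by linarith
      apply smul_right_injective Plane h1
      simp only [smul_add, smul_smul, mul_div_cancel₀ _ h1]
      rw [eq_comm, ← add_right_inj (d • c), h]
      module
  have hdd : d = d' := le_antisymm (not_lt.1 (key hzF' hz hd' hd h.symm)) (not_lt.1 (key hzF hz' hd hd' h))
  subst hdd
  refine ⟨rfl, smul_right_injective Plane (show 1 - d ≠ 0 by linarith) (add_left_cancel h)⟩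

/-- Distinct half edges meet at most in a vertex (parameter 0, where the edge is undetermined) or in
a midpoint (parameter 1/2, where the vertex is undetermined). -/
theorem half_edge_unique {v w v' w' : Plane} {e e' : Set Plane} (he : e ∈ M.edges)
    (he' : e' ∈ M.edges) (hwv : w ≠ v) (hwv' : w' ≠ v')
    (hi : M.verts ∩ e = {v, w}) (hi' : M.verts ∩ e' = {v', w'}) {s s' : ℝ}
    (hs0 : 0 ≤ s) (hs0' : 0 ≤ s') (hs : s ≤ 1 / 2) (hs' : s' ≤ 1 / 2)
    (hz : v + s • (w - v) ∈ e) (hz' : v' + s' • (w' - v') ∈ e')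
    (h : v + s • (w - v) = v' + s' • (w' - v')) :
    s = s' ∧ (s ≠ 1 / 2 → v = v') ∧ (s ≠ 0 → e = e') := by
  have key : ∀ {v w : Plane} {e : Set Plane} {s : ℝ}, w ≠ v → M.verts ∩ e = {v, w} →
      s ≤ 1 / 2 → v + s • (w - v) ∈ e → v + s • (w - v) ∈ M.verts → s = 0 := by
    intro v w e s hwv hi hs hze hzv
    have hm : v + s • (w - v) ∈ M.verts ∩ e := ⟨hzv, hze⟩
    rw [hi] at hm
    have hne := sub_ne_zero.2 hwv
    rcases hm with hm | hm
    · exact (smul_eq_zero.1 (add_eq_left.1 hm)).resolve_right hne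
    · have : (s - 1) • (w - v) = 0 := by
        rw [sub_smul, one_smul]
        have : v + s • (w - v) = w := hm
        rw [sub_eq_zero, eq_sub_iff_add_eq, add_comm, this]
      have := (smul_eq_zero.1 this).resolve_right hne
      linarith
  have hv : v ∈ M.verts := (hi.ge (Or.inl rfl)).1
  have hv' : v' ∈ M.verts := (hi'.ge (Or.inl rfl)).1
  by_cases hzv : v + s • (w - v) ∈ M.verts
  · obtain rfl := key hwv hi hs hz hzv
    obtain rfl := key hwv' hi' hs' hz' (h ▸ hzv)
    exact ⟨rfl, fun _ => by simpa using h, fun h => absurd rfl h⟩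
  · have hee : e = e' := by
      by_contra hne
      exact hzv (M.edge_inter e he e' he' hne ⟨hz, h ▸ hz'⟩)
    subst hee
    have hne := sub_ne_zero.2 hwv
    rw [hi] at hi'
    have hv1 : v ∈ ({v', w'} : Set Plane) := hi'.le (Or.inl rfl)
    have hw1 : w ∈ ({v', w'} : Set Plane) := hi'.le (Or.inr rfl)
    rcases hv1 with rfl | hv1
    · obtain rfl : w = w' := hw1.resolve_left hwv
      refine ⟨?_, fun _ => rfl, fun _ => rfl⟩
      exact smul_left_injective ℝ hne (add_left_cancel h)
    · obtain rfl : v = w' := hv1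
      obtain rfl : w = v' := hw1.resolve_right hwv
      have : (1 - s - s') • (w - v) = 0 := by
        have h2 : (1 - s - s') • (w - v) = (w + s' • (v - w)) - (v + s • (w - v)) := by module
        rw [h2, h, sub_self]
      have := (smul_eq_zero.1 this).resolve_right hne
      exact ⟨by linarith, fun h => absurd (by linarith) h, fun _ => rfl⟩

/-- The triangles of the flags form a triangulation. -/
theorem tau_inj (hT : M.Tame) {c : Set Plane → Plane} (hc : M.IsCentre c) {Φ Ψ : M.Flag}
    {x y : stdSimplex ℝ (Fin 3)} (h : Φ.tau c x = Ψ.tau c y) :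
    x = y ∧ (x.1 0 ≠ 0 → Φ.vert = Ψ.vert) ∧ (x.1 1 ≠ 0 → Φ.edge = Ψ.edge) ∧
      (x.1 2 ≠ 0 → Φ.face = Ψ.face) := by
  have hx0 := x.2.1 0
  have hx1 := x.2.1 1
  have hx2 := x.2.1 2
  have hxs := simplex_sum x
  have hy0 := y.2.1 0
  have hy1 := y.2.1 1
  have hy2 := y.2.1 2
  have hys := simplex_sum y
  have hsk : ∀ {Φ : M.Flag} {z : Plane}, z ∈ Φ.edge → ∀ {F}, F ∈ M.faces → z ∉ F :=
    fun hz _ hF hzF => disjoint_face_skeleton hF hzF (Flag.edge_subset_skeleton _ hz)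
  have hface : x.1 2 ≠ 0 → Φ.face = Ψ.face ∧ y.1 2 ≠ 0 := by
    intro hx
    have hxm := hT.tau_mem_face hc Φ hx
    have hy : y.1 2 ≠ 0 := fun hy => hsk (hT.tau_mem_edge c Ψ hy) Φ.face_mem (h ▸ hxm)
    exact ⟨face_eq_of_mem Φ.face_mem Ψ.face_mem hxm (h ▸ hT.tau_mem_face hc Ψ hy), hy⟩
  have hM := hT.hasConvexPolygonFaces
  have hray : x.1 2 ≠ 1 → y.1 2 ≠ 1 → x = y ∧ (x.1 0 ≠ 0 → Φ.vert = Ψ.vert) ∧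
      (x.1 1 ≠ 0 → Φ.edge = Ψ.edge) := by
    intro hxn hyn
    obtain ⟨w, -, hwv, -, hi, hz, ht⟩ := Φ.exists_half_edge hM c x hxn
    obtain ⟨w', -, hwv', -, hi', hz', ht'⟩ := Ψ.exists_half_edge hM c y hyn
    have hxl : x.1 2 < 1 := lt_of_le_of_ne (by linarith) hxn
    have hyl : y.1 2 < 1 := lt_of_le_of_ne (by linarith) hyn
    have h' := ht.symm.trans (h.trans ht')
    have h2z : x.1 2 = y.1 2 ∧ Φ.vert + (x.1 1 / (2 * (1 - x.1 2))) • (w - Φ.vert) =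
        Ψ.vert + (y.1 1 / (2 * (1 - y.1 2))) • (w' - Ψ.vert) := by
      -- On an edge the centres of the two flags may differ, but they have weight 0; inside a face
      -- both rays start at the same centre.
      by_cases hx : x.1 2 = 0
      · have hy : y.1 2 = 0 := by
          by_contra hy
          have hym := hT.tau_mem_face hc Ψ hy
          exact hsk (hT.tau_mem_edge c Φ hx) Ψ.face_mem (h ▸ hym)
        rw [hx, hy] at h' ⊢
        simpa using h'
      · obtain ⟨hF, hy⟩ := hface hx
        rw [← hF] at h'
        exact hT.eq_of_ray_eq Φ.face_mem (hc _ Φ.face_mem) (Φ.edge_face hz) (hsk hz Φ.face_mem)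
          (hF ▸ Ψ.edge_face hz') (hsk hz' Φ.face_mem) hxl hyl h'
    obtain ⟨h2, hzz⟩ := h2z
    have hxl' : 0 < 1 - x.1 2 := by linarith
    have hyl' : 0 < 1 - y.1 2 := by linarith
    obtain ⟨r1, r2, r3⟩ := half_edge_unique Φ.edge_mem Ψ.edge_mem hwv hwv' hi hi'
      (div_nonneg hx1 (by linarith)) (div_nonneg hy1 (by linarith))
      (by rw [div_le_div_iff₀ (by linarith) two_pos]; linarith)
      (by rw [div_le_div_iff₀ (by linarith) two_pos]; linarith) hz hz' hzz
    have h1 : x.1 1 = y.1 1 := by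
      rw [← h2] at r1
      exact (div_left_inj' (by positivity)).1 r1
    refine ⟨?_, fun hx => r2 ?_, fun hx => r3 ?_⟩
    · ext j
      have h3 : ∀ i : Fin 3, i = 0 ∨ i = 1 ∨ i = 2 := by decide
      rcases h3 j with rfl | rfl | rfl
      · change x.1 0 = y.1 0; linarith
      · exact h1
      · exact h2
    · rw [Ne, div_eq_div_iff (by positivity) two_ne_zero]
      intro h; apply hx; linarith
    · exact div_ne_zero hx (by positivity)
  -- The centre has no ray of its own, so it is treated apart.
  by_cases hx : x.1 2 = 1
  · obtain ⟨hF, hy⟩ := hface (by rw [hx]; norm_num)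
    have e0 : x.1 0 = 0 := by linarith
    have e1 : x.1 1 = 0 := by linarith
    have hy1' : y.1 2 = 1 := by
      by_contra hyn
      obtain ⟨w', -, hwv', -, hi', hz', ht'⟩ := Ψ.exists_half_edge hM c y hyn
      rw [Flag.tau_eq, e0, e1, hx, zero_smul, zero_smul, one_smul, zero_add, zero_add, ht', hF] at h
      refine hsk hz' Ψ.face_mem (?_ : _ ∈ Ψ.face)
      have : (1 - y.1 2) • c Ψ.face = (1 - y.1 2) •
          (Ψ.vert + (y.1 1 / (2 * (1 - y.1 2))) • (w' - Ψ.vert)) := by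
        rw [sub_smul, one_smul, sub_eq_iff_eq_add']
        exact h
      rw [← smul_right_injective Plane (sub_ne_zero.2 (Ne.symm hyn)) this]
      exact hc _ Ψ.face_mem
    refine ⟨?_, fun h => absurd e0 h, fun h => absurd e1 h, fun _ => hF⟩
    ext j
    have h3 : ∀ i : Fin 3, i = 0 ∨ i = 1 ∨ i = 2 := by decide
    rcases h3 j with rfl | rfl | rfl
    · change x.1 0 = y.1 0; linarith
    · change x.1 1 = y.1 1; linarith
    · change x.1 2 = y.1 2; linarith
  · have hyn : y.1 2 ≠ 1 := by
      intro hy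
      have f0 : y.1 0 = 0 := by linarith
      have f1 : y.1 1 = 0 := by linarith
      obtain ⟨w, -, hwv, -, hi, hz, ht⟩ := Φ.exists_half_edge hM c x hx
      have hF : Φ.face = Ψ.face := by
        refine (hface fun hx0 => ?_).1
        exact hsk (hT.tau_mem_edge c Φ hx0) Ψ.face_mem
          (h ▸ hT.tau_mem_face hc Ψ (by rw [hy]; norm_num))
      rw [ht, Flag.tau_eq c Ψ, f0, f1, hy, zero_smul, zero_smul, one_smul, zero_add, zero_add, ← hF] at h
      refine hsk hz Φ.face_mem (?_ : _ ∈ Φ.face)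
      have : (1 - x.1 2) • c Φ.face = (1 - x.1 2) •
          (Φ.vert + (x.1 1 / (2 * (1 - x.1 2))) • (w - Φ.vert)) := by
        rw [sub_smul, one_smul, sub_eq_iff_eq_add']
        exact h.symm
      rw [← smul_right_injective Plane (sub_ne_zero.2 (Ne.symm hx)) this]
      exact hc _ Φ.face_mem
    obtain ⟨a, b, d⟩ := hray hx hyn
    exact ⟨a, b, d, fun h => (hface h).1⟩

theorem exists_tau_of_edge (hT : M.Tame) (c : Set Plane → Plane) {F : Set Plane}
    (hF : F ∈ M.faces) {e : Set Plane} (he : e ∈ M.edges) (heF : e ⊆ closure F) {z : Plane}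
    (hz : z ∈ e) {s : ℝ} (hs0 : 0 ≤ s) (hs1 : s ≤ 1) :
    ∃ (Φ : M.Flag) (x : stdSimplex ℝ (Fin 3)), Φ.tau c x = (1 - s) • c F + s • z := by
  obtain ⟨v, hv, w, hw, hvw, hs, hi⟩ := exists_edge_ends hT.hasConvexPolygonFaces he
  have hv' : v ∈ e := hs ▸ left_mem_segment ℝ v w
  have hw' : w ∈ e := hs ▸ right_mem_segment ℝ v w
  rw [hs, mem_segment_iff_add_smul] at hz
  obtain ⟨k, ⟨hk0, hk1⟩, rfl⟩ := hz
  rcases le_total k (1 / 2) with hk | hk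
  · refine ⟨⟨v, e, F, hv, he, hF, hv', heF⟩,
      ⟨![s * (1 - 2 * k), s * (2 * k), 1 - s], ?_, ?_⟩, ?_⟩
    · intro i
      fin_cases i
      · exact mul_nonneg hs0 (by linarith)
      · exact mul_nonneg hs0 (by linarith)
      · change 0 ≤ 1 - s; linarith
    · simp [Fin.sum_univ_three]; ring
    · rw [Flag.tau_eq]
      simp only [edgeMid_eq hvw.symm hi]
      simp only [Matrix.cons_val_zero, Matrix.cons_val_one, Matrix.cons_val]
      module
  · refine ⟨⟨w, e, F, hw, he, hF, hw', heF⟩,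
      ⟨![s * (2 * k - 1), s * (2 * (1 - k)), 1 - s], ?_, ?_⟩, ?_⟩
    · intro i
      fin_cases i
      · exact mul_nonneg hs0 (by linarith)
      · exact mul_nonneg hs0 (by linarith)
      · change 0 ≤ 1 - s; linarith
    · simp [Fin.sum_univ_three]; ring
    · rw [Flag.tau_eq]
      simp only [edgeMid_eq hvw.symm hi]
      simp only [Matrix.cons_val_zero, Matrix.cons_val_one, Matrix.cons_val]
      module

/-- The ray from `c` through `y` leaves the face, because the face is bounded. -/
theorem exists_frontier_ray (hT : M.Tame) {F : Set Plane} (hF : F ∈ M.faces) {c y : Plane}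
    (hy : y ∈ F) : ∃ z ∈ closure F, z ∉ F ∧ ∃ s ∈ Icc (0 : ℝ) 1, y = (1 - s) • c + s • z := by
  -- For `y = c` any direction `d` will do, with `r = 0`.
  obtain ⟨d, hd, hcd⟩ : ∃ d : Plane, d ≠ 0 ∧ ∃ r ≥ (0 : ℝ), y - c = r • d := by
    by_cases h : y - c = 0
    · obtain ⟨d, hd⟩ := exists_ne (0 : Plane)
      exact ⟨d, hd, 0, le_rfl, by rw [h, zero_smul]⟩
    · exact ⟨y - c, h, 1, zero_le_one, (one_smul _ _).symm⟩
  obtain ⟨r, hr, hcd⟩ := hcd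
  let R : Set Plane := (fun t : ℝ => y + t • d) '' Ici 0
  have hR : IsPreconnected R := isPreconnected_Ici.image _ (by fun_prop)
  have hRF : (R ∩ Fᶜ).Nonempty := by
    obtain ⟨B, hB⟩ := ((hT.hasConvexPolygonFaces.2 F hF).2).exists_norm_le
    have hnd : 0 < ‖d‖ := norm_pos_iff.2 hd
    refine ⟨y + ((B + ‖y‖ + 1) / ‖d‖) • d, ⟨_, ?_, rfl⟩, fun h => ?_⟩
    · have := (norm_nonneg y).trans (hB y hy)
      exact div_nonneg (by positivity) hnd.le
    · have h1 := hB _ h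
      have h2 : ‖((B + ‖y‖ + 1) / ‖d‖) • d‖ ≤ ‖y + ((B + ‖y‖ + 1) / ‖d‖) • d‖ + ‖y‖ := by
        calc _ = ‖(y + ((B + ‖y‖ + 1) / ‖d‖) • d) - y‖ := by rw [add_sub_cancel_left]
          _ ≤ _ := norm_sub_le _ _
      rw [norm_smul, Real.norm_eq_abs, abs_div, abs_norm, div_mul_cancel₀ _ hnd.ne'] at h2
      have := le_abs_self (B + ‖y‖ + 1)
      linarith
  have hyR : y ∈ R := ⟨0, mem_Ici.2 le_rfl, by simp⟩
  obtain ⟨z, ⟨t, ht, rfl⟩, hz⟩ := hR.exists_mem_closure_diff (hT.isOpen_face hF) ⟨y, hyR, hy⟩ hRF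
  have ht : 0 ≤ t := ht
  refine ⟨_, hz.1, hz.2, ?_⟩
  have ht0 : t ≠ 0 := by rintro rfl; exact hz.2 (by simpa using hy)
  have htp : 0 < t := lt_of_le_of_ne ht ht0.symm
  -- Here `y` is `c + r • d`, and the boundary point is `c + (r + t) • d`.
  refine ⟨r / (r + t), ⟨by positivity, by rw [div_le_one (by positivity)]; linarith⟩, ?_⟩
  have hc : c = y - r • d := by rw [← hcd]; abel
  rw [hc]
  have h1 : 1 - r / (r + t) = t / (r + t) := by field_simp; ring
  rw [h1]
  have h2 : (r + t) ≠ 0 := by positivity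
  apply smul_right_injective Plane h2
  simp only [smul_add, smul_smul, smul_sub, mul_div_cancel₀ _ h2]
  have : (r + t) * (t / (r + t) * r) = t * r := by field_simp
  have h3 : (r + t) * (r / (r + t) * t) = r * t := by field_simp
  simp only [this, h3]
  module

theorem exists_tau (hT : M.Tame) (c : Set Plane → Plane) (y : Plane) :
    ∃ (Φ : M.Flag) (x : stdSimplex ℝ (Fin 3)), Φ.tau c x = y := by
  have hedge : ∀ e ∈ M.edges, y ∈ e →
      ∃ (Φ : M.Flag) (x : stdSimplex ℝ (Fin 3)), Φ.tau c x = y := by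
    intro e he hye
    obtain ⟨F, hF, _, _, _, h⟩ := hT.exists_two_faces he
    obtain ⟨Φ, x, h⟩ := hT.exists_tau_of_edge c hF he ((h F hF).2 (Or.inl rfl)) hye zero_le_one le_rfl
    exact ⟨Φ, x, by simpa using h⟩
  by_cases hy : y ∈ M.skeleton
  · rcases hy with hv | ⟨e, he, hye⟩
    · obtain ⟨e, he, hye⟩ := hT.exists_edge_of_vert hv
      exact hedge e he hye
    · exact hedge e he hye
  · obtain ⟨F, hF, hyF⟩ := exists_face hy
    obtain ⟨z, hz, hzF, s, ⟨hs0, hs1⟩, hs⟩ := hT.exists_frontier_ray hF (c := c F) hyF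
    obtain ⟨e, he, hze, heF⟩ := hT.exists_edge_of_mem_closure hF hz hzF
    obtain ⟨Φ, x, h⟩ := hT.exists_tau_of_edge c hF he heF hze hs0 hs1
    exact ⟨Φ, x, h.trans hs.symm⟩

/-- A point that is no corner has at most one vanishing barycentric coordinate, so the two flags
agree in all entries except perhaps the one with that index. -/
theorem eq_or_adj (hT : M.Tame) {c : Set Plane → Plane} (hc : M.IsCentre c) {Φ Ψ : M.Flag}
    {x y : stdSimplex ℝ (Fin 3)} (h : Φ.tau c x = Ψ.tau c y) (hn : Φ.tau c x ∉ M.corners c) :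
    x = y ∧ (Ψ = Φ ∨ ∃ i, x.1 i = 0 ∧ Ψ = Φ.adj i) := by
  obtain ⟨hxy, h0, h1, h2⟩ := hT.tau_inj hc h
  refine ⟨hxy, ?_⟩
  have hsum := simplex_sum x
  have hcor : ∀ j, x.1 j ≠ 1 := by
    intro j hj
    apply hn
    refine ⟨(Φ, j), ?_⟩
    have hx0 := x.2.1 0
    have hx1 := x.2.1 1
    have hx2 := x.2.1 2
    rw [Flag.tau, Finset.sum_eq_single j, hj, one_smul]
    · intro i _ hij
      have : x.1 i = 0 := by
        have h3 : ∀ i : Fin 3, i = 0 ∨ i = 1 ∨ i = 2 := by decide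
        rcases h3 i with rfl | rfl | rfl <;> rcases h3 j with rfl | rfl | rfl <;>
          first | exact absurd rfl hij | linarith
      rw [this, zero_smul]
    · simp
  refine or_iff_not_imp_left.2 fun hne => ?_
  by_cases z0 : x.1 0 = 0
  · refine ⟨0, z0, hT.eq_adj ⟨hne, fun h => absurd rfl h, fun _ => (h1 fun z => ?_).symm,
      fun _ => (h2 fun z => ?_).symm⟩⟩
    · exact hcor 2 (by linarith)
    · exact hcor 1 (by linarith)
  by_cases z1 : x.1 1 = 0
  · refine ⟨1, z1, hT.eq_adj ⟨hne, fun _ => (h0 z0).symm, fun h => absurd rfl h,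
      fun _ => (h2 fun z => ?_).symm⟩⟩
    exact hcor 0 (by linarith)
  by_cases z2 : x.1 2 = 0
  · exact ⟨2, z2, hT.eq_adj ⟨hne, fun _ => (h0 z0).symm, fun _ => (h1 z1).symm,
      fun h => absurd rfl h⟩⟩
  · exact absurd (Flag.ext (h0 z0).symm (h1 z1).symm (h2 z2).symm) hne

end Tame
end PlaneMap

/-! ### Translations of the map and their finiteness properties -/

/-- Translation of a set of points. -/
def tr (t : Plane) (A : Set Plane) : Set Plane := Homeomorph.addRight t '' A

theorem mem_tr {t x : Plane} {A : Set Plane} : x ∈ tr t A ↔ x - t ∈ A := by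
  constructor
  · rintro ⟨y, hy, rfl⟩; simpa using hy
  · intro h; exact ⟨x - t, h, by simp⟩

theorem add_mem_tr {t x : Plane} {A : Set Plane} : x + t ∈ tr t A ↔ x ∈ A := by
  rw [mem_tr, add_sub_cancel_right]

theorem tr_tr (s t : Plane) (A : Set Plane) : tr s (tr t A) = tr (s + t) A := by
  ext x; rw [mem_tr, mem_tr, mem_tr, sub_sub]

@[simp] theorem tr_zero (A : Set Plane) : tr 0 A = A := by
  ext x; rw [mem_tr, sub_zero]

theorem tr_neg_tr (t : Plane) (A : Set Plane) : tr (-t) (tr t A) = A := by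
  rw [tr_tr, neg_add_cancel, tr_zero]

theorem tr_tr_neg (t : Plane) (A : Set Plane) : tr t (tr (-t) A) = A := by
  rw [tr_tr, add_neg_cancel, tr_zero]

theorem tr_injective (t : Plane) : Function.Injective (tr t) := fun A B h => by
  rw [← tr_neg_tr t A, h, tr_neg_tr]

theorem closure_tr (t : Plane) (A : Set Plane) : closure (tr t A) = tr t (closure A) :=
  ((Homeomorph.addRight t).image_closure A).symm

theorem tr_mono (t : Plane) {A B : Set Plane} (h : A ⊆ B) : tr t A ⊆ tr t B := image_mono h

theorem tr_union (t : Plane) (A B : Set Plane) : tr t (A ∪ B) = tr t A ∪ tr t B := image_union _ _ _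

/-- The set would be invariant under the translation by `s - t`, and iterating a nonzero translation
leaves every bounded set. -/
theorem eq_of_tr_eq {A : Set Plane} (hA : A.Nonempty) (hb : Bornology.IsBounded A) {s t : Plane}
    (h : tr s A = tr t A) : s = t := by
  by_contra hne
  have hd : 0 < ‖s - t‖ := norm_pos_iff.2 (sub_ne_zero.2 hne)
  have hstep : ∀ x ∈ A, x + (s - t) ∈ A := fun x hx => by
    have := add_mem_tr (t := s) |>.2 hx
    rw [h, mem_tr] at this
    rwa [← add_sub_assoc]
  obtain ⟨x, hx⟩ := hA
  have hn : ∀ n : ℕ, x + (n : ℝ) • (s - t) ∈ A := by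
    intro n
    induction n with
    | zero => simpa using hx
    | succ n ih =>
      have := hstep _ ih
      rw [Nat.cast_succ, add_smul, one_smul, ← add_assoc]
      exact this
  obtain ⟨B, hB⟩ := hb.exists_norm_le
  obtain ⟨n, hn'⟩ := exists_nat_gt ((B + ‖x‖) / ‖s - t‖)
  rw [div_lt_iff₀ hd] at hn'
  have h1 := hB _ (hn n)
  have h2 : ‖(n : ℝ) • (s - t)‖ ≤ ‖x + (n : ℝ) • (s - t)‖ + ‖x‖ := by
    calc _ = ‖(x + (n : ℝ) • (s - t)) - x‖ := by rw [add_sub_cancel_left]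
      _ ≤ _ := norm_sub_le _ _
  rw [norm_smul, Real.norm_natCast] at h2
  linarith

namespace PlaneMap

/-- The group of the translations that are automorphisms. -/
def transl (M : PlaneMap) : AddSubgroup Plane where
  carrier := {t | tr t M.verts = M.verts ∧ ∀ e, tr t e ∈ M.edges ↔ e ∈ M.edges}
  zero_mem' := by simp
  add_mem' := by
    rintro a b ⟨ha, ha'⟩ ⟨hb, hb'⟩
    refine ⟨by rw [← tr_tr, hb, ha], fun e => ?_⟩
    rw [← tr_tr, ha', hb']
  neg_mem' := by
    rintro a ⟨ha, ha'⟩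
    refine ⟨?_, fun e => ?_⟩
    · nth_rewrite 1 [← ha]; rw [tr_neg_tr]
    · rw [← ha', tr_tr_neg]

variable {M : PlaneMap}

theorem mem_transl_of_isAutomorphism {t : Plane} (h : M.IsAutomorphism (Homeomorph.addRight t)) :
    t ∈ M.transl := by
  refine ⟨h.1, fun e => ⟨fun he => ?_, fun he => ?_⟩⟩
  · have := h.2.ge he
    obtain ⟨e', he', h'⟩ := this
    rwa [← tr_injective t h']
  · exact h.2.le ⟨e, he, rfl⟩

theorem tr_mem_edges (t : M.transl) {e : Set Plane} : tr t e ∈ M.edges ↔ e ∈ M.edges := t.2.2 e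

theorem tr_verts (t : M.transl) : tr t M.verts = M.verts := t.2.1

theorem add_mem_verts (t : M.transl) {v : Plane} : v + t ∈ M.verts ↔ v ∈ M.verts := by
  nth_rewrite 1 [← tr_verts t]; exact add_mem_tr

theorem tr_skeleton (t : M.transl) : tr t M.skeleton = M.skeleton := by
  rw [skeleton, tr_union, tr_verts]
  congr 1
  ext x
  rw [mem_tr]
  constructor
  · rintro ⟨e, he, hx⟩
    exact ⟨tr t e, (tr_mem_edges t).2 he, mem_tr.2 hx⟩
  · rintro ⟨e, he, hx⟩
    refine ⟨tr (-t) e, (tr_mem_edges (-t)).2 he, mem_tr.2 ?_⟩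
    simpa using hx

theorem tr_mem_faces (t : M.transl) {F : Set Plane} (hF : F ∈ M.faces) : tr t F ∈ M.faces := by
  obtain ⟨x, hx, rfl⟩ := hF
  have himg : Homeomorph.addRight (t : Plane) '' M.skeletonᶜ = M.skeletonᶜ := by
    rw [image_compl_eq (Homeomorph.addRight (t : Plane)).bijective]
    exact congrArg compl (tr_skeleton t)
  refine ⟨x + t, ?_, ?_⟩
  · rw [← himg]; exact ⟨x, hx, rfl⟩
  · rw [tr, (Homeomorph.addRight (t : Plane)).image_connectedComponentIn hx, himg]; rfl

theorem finite_edges (M : PlaneMap) (r : ℝ) :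
    {e ∈ M.edges | ∃ v ∈ M.verts, v ∈ e ∧ ‖v‖ ≤ r}.Finite := by
  have hV : (Metric.closedBall 0 r ∩ M.verts).Finite :=
    Metric.finite_isBounded_inter_isClosed M.verts_isDiscrete Metric.isBounded_closedBall
      M.verts_isClosed
  refine (hV.biUnion fun v hv => M.locally_finite v hv.2).subset ?_
  rintro e ⟨he, v, hv, hve, hr⟩
  exact mem_biUnion (show v ∈ _ from ⟨by simpa using hr, hv⟩) ⟨he, hve⟩

/-- The standing global hypotheses: convex polygons as faces, and enough translations. -/
structure Periodic (M : PlaneMap) : Prop where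
  hasConvexPolygonFaces : M.HasConvexPolygonFaces
  cocompact : ∃ R : ℝ, ∀ x : Plane, ∃ t : M.transl, ‖x + t‖ ≤ R

namespace Periodic

/-- Up to translation there are only finitely many edges. -/
theorem exists_dist_edge_le (hP : M.Periodic) :
    ∃ D : ℝ, ∀ e ∈ M.edges, ∀ x ∈ e, ∀ y ∈ e, dist x y ≤ D := by
  obtain ⟨R, hR⟩ := hP.cocompact
  have hfin := finite_edges M R
  have hb : ∀ e ∈ {e ∈ M.edges | ∃ v ∈ M.verts, v ∈ e ∧ ‖v‖ ≤ R}, Bornology.IsBounded e := by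
    rintro e ⟨he, -⟩
    obtain ⟨a, ha, b, hb, hab, hs, hi⟩ := exists_edge_ends hP.hasConvexPolygonFaces he
    rw [hs, ← convexHull_pair]
    exact ((Set.toFinite {a, b}).isCompact_convexHull (𝕜 := ℝ)).isBounded
  obtain ⟨D, hD⟩ := Metric.isBounded_iff.1 ((Bornology.isBounded_biUnion hfin).2 hb)
  refine ⟨D, fun e he x hx y hy => ?_⟩
  obtain ⟨a, ha, b, -, -, hs, -⟩ := exists_edge_ends hP.hasConvexPolygonFaces he
  have hae : a ∈ e := hs ▸ left_mem_segment ℝ a b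
  obtain ⟨t, ht⟩ := hR a
  have hmem : tr t e ∈ {e ∈ M.edges | ∃ v ∈ M.verts, v ∈ e ∧ ‖v‖ ≤ R} :=
    ⟨(tr_mem_edges t).2 he, a + t, (add_mem_verts t).2 ha, add_mem_tr.2 hae, ht⟩
  have := hD (mem_biUnion hmem (add_mem_tr.2 hx)) (mem_biUnion hmem (add_mem_tr.2 hy))
  rwa [dist_add_right] at this

/-- Local finiteness at the vertices alone would allow long edges to accumulate at a point. With
bounded lengths, the edges that come near `x` have their ends in a fixed ball, so they are finitely
many closed sets, and those that miss `x` keep a distance from it. -/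
theorem tame (hP : M.Periodic) : M.Tame := by
  refine ⟨hP.hasConvexPolygonFaces, fun x => ?_⟩
  obtain ⟨D, hD⟩ := hP.exists_dist_edge_le
  have hfin := finite_edges M (‖x‖ + 1 + D)
  have hcl : IsClosed (⋃ e ∈ {e ∈ M.edges | ∃ v ∈ M.verts, v ∈ e ∧ ‖v‖ ≤ ‖x‖ + 1 + D} ∩ {e | x ∉ e}, e) :=
    (hfin.inter_of_left _).isClosed_biUnion
      fun e he => isClosed_edge hP.hasConvexPolygonFaces he.1.1
  have hx : x ∉ ⋃ e ∈ {e ∈ M.edges | ∃ v ∈ M.verts, v ∈ e ∧ ‖v‖ ≤ ‖x‖ + 1 + D} ∩ {e | x ∉ e}, e := by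
    simp only [mem_iUnion, not_exists]
    rintro e ⟨-, he⟩ h
    exact he h
  obtain ⟨ε₁, hε₁, h1⟩ := Metric.isOpen_iff.1 hcl.isOpen_compl x hx
  have hV : ((Metric.closedBall x 1 ∩ M.verts) \ {x}).Finite :=
    (Metric.finite_isBounded_inter_isClosed M.verts_isDiscrete Metric.isBounded_closedBall
      M.verts_isClosed).sdiff
  obtain ⟨ε₂, hε₂, h2⟩ := Metric.isOpen_iff.1 hV.isClosed.isOpen_compl x (by simp)
  refine ⟨min 1 (min ε₁ ε₂), by positivity, fun v hv hvx => ?_, fun e he y hy hyx => ?_⟩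
  · by_contra hne
    have hvx1 := hvx.trans_le (min_le_left _ _)
    exact h2 (show v ∈ Metric.ball x ε₂ from hvx.trans_le ((min_le_right _ _).trans (min_le_right _ _)))
      ⟨⟨hvx1.le, hv⟩, hne⟩
  · by_contra hxe
    refine h1 (show y ∈ Metric.ball x ε₁ from
      hyx.trans_le ((min_le_right _ _).trans (min_le_left _ _))) ?_
    obtain ⟨a, ha, b, -, -, hs, -⟩ := exists_edge_ends hP.hasConvexPolygonFaces he
    have hae : a ∈ e := hs ▸ left_mem_segment ℝ a b
    refine mem_biUnion (show e ∈ _ from ⟨⟨he, a, ha, hae, ?_⟩, hxe⟩) hy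
    have h3 := hyx.trans_le (min_le_left _ _)
    have h4 := hD e he a hae y hy
    have h5 : ‖a‖ ≤ dist a y + dist y x + ‖x‖ := by
      have := dist_triangle4 a y x 0
      rwa [dist_zero_right, dist_zero_right] at this
    linarith

end Periodic

theorem tr_pair_inter (t : M.transl) {e : Set Plane} {v w : Plane} (h : M.verts ∩ e = {v, w}) :
    M.verts ∩ tr t e = {v + (t : Plane), w + (t : Plane)} := by
  have h1 : M.verts ∩ tr t e = tr t (M.verts ∩ e) := by
    nth_rewrite 1 [← tr_verts t]
    exact (image_inter (Homeomorph.addRight (t : Plane)).injective).symm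
  rw [h1, h, tr, image_pair]; rfl

theorem edgeMid_tr (hM : M.HasConvexPolygonFaces) (t : M.transl) {e : Set Plane}
    (he : e ∈ M.edges) : M.edgeMid (tr t e) = M.edgeMid e + t := by
  obtain ⟨a, ha, b, hb, hab, hs, hi⟩ := exists_edge_ends hM he
  rw [edgeMid_eq hab.symm hi, edgeMid_eq _ (tr_pair_inter t hi)]
  · module
  · intro h; exact hab (add_right_cancel h).symm

instance : AddAction M.transl M.Flag where
  vadd t Φ := ⟨Φ.vert + t, tr t Φ.edge, tr t Φ.face, (add_mem_verts t).2 Φ.vert_mem,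
    (tr_mem_edges t).2 Φ.edge_mem, tr_mem_faces t Φ.face_mem, add_mem_tr.2 Φ.vert_edge, by
      rw [closure_tr]; exact tr_mono _ Φ.edge_face⟩
  zero_vadd Φ := Flag.ext (by change Φ.vert + (0 : Plane) = _; simp) (tr_zero _) (tr_zero _)
  add_vadd s t Φ := Flag.ext
    (by change Φ.vert + ((s : Plane) + t) = Φ.vert + t + s; abel)
    (tr_tr _ _ _).symm (tr_tr _ _ _).symm

@[simp] theorem vadd_vert (t : M.transl) (Φ : M.Flag) : (t +ᵥ Φ).vert = Φ.vert + t := rfl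
@[simp] theorem vadd_edge (t : M.transl) (Φ : M.Flag) : (t +ᵥ Φ).edge = tr t Φ.edge := rfl
@[simp] theorem vadd_face (t : M.transl) (Φ : M.Flag) : (t +ᵥ Φ).face = tr t Φ.face := rfl

theorem Flag.IsAdj.vadd {i : Fin 3} {Φ Ψ : M.Flag} (h : Φ.IsAdj i Ψ) (t : M.transl) :
    (t +ᵥ Φ).IsAdj i (t +ᵥ Ψ) := by
  refine ⟨fun h' => h.1 ((vadd_left_cancel_iff t).1 h'), fun hi => ?_, fun hi => ?_, fun hi => ?_⟩
  · simp [h.2.1 hi]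
  · simp [h.2.2.1 hi]
  · simp [h.2.2.2 hi]

theorem Tame.adj_vadd (hT : M.Tame) (i : Fin 3) (t : M.transl) (Φ : M.Flag) :
    (t +ᵥ Φ).adj i = t +ᵥ Φ.adj i :=
  (hT.eq_adj ((hT.isAdj_adj i Φ).vadd t)).symm

/-- Monodromy commutes with automorphisms. -/
theorem Tame.mon_vadd (hT : M.Tame) (g : M.Mon) (t : M.transl) (Φ : M.Flag) :
    (g : Equiv.Perm M.Flag) (t +ᵥ Φ) = t +ᵥ (g : Equiv.Perm M.Flag) Φ := by
  obtain ⟨g, hg⟩ := g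
  change g (t +ᵥ Φ) = t +ᵥ g Φ
  induction hg using Subgroup.closure_induction generalizing Φ with
  | mem x hx => obtain ⟨i, rfl⟩ := hx; exact hT.adj_vadd i t Φ
  | one => rfl
  | mul x y _ _ hx hy => rw [Equiv.Perm.mul_apply, Equiv.Perm.mul_apply, hy, hx]
  | inv x _ hx => rw [Equiv.Perm.inv_eq_iff_eq, hx]; simp

theorem Tame.finite_flags (hT : M.Tame) (r : ℝ) : {Φ : M.Flag | ‖Φ.vert‖ ≤ r}.Finite := by
  have hV : (Metric.closedBall 0 r ∩ M.verts).Finite :=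
    Metric.finite_isBounded_inter_isClosed M.verts_isDiscrete Metric.isBounded_closedBall
      M.verts_isClosed
  have hE := finite_edges M r
  have hF : (⋃ e ∈ {e ∈ M.edges | ∃ v ∈ M.verts, v ∈ e ∧ ‖v‖ ≤ r},
      {F ∈ M.faces | e ⊆ closure F}).Finite := by
    refine hE.biUnion fun e he => ?_
    obtain ⟨F₁, -, F₂, -, -, h⟩ := hT.exists_two_faces he.1
    refine (Set.toFinite {F₁, F₂}).subset ?_
    rintro F ⟨hF, heF⟩
    exact (h F hF).1 heF
  refine Set.Finite.of_finite_image (f := fun Φ : M.Flag => (Φ.vert, Φ.edge, Φ.face))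
    ((hV.prod (hE.prod hF)).subset ?_) ?_
  · rintro _ ⟨Φ, hΦ, rfl⟩
    have he : Φ.edge ∈ {e ∈ M.edges | ∃ v ∈ M.verts, v ∈ e ∧ ‖v‖ ≤ r} :=
      ⟨Φ.edge_mem, Φ.vert, Φ.vert_mem, Φ.vert_edge, hΦ⟩
    exact ⟨⟨by simpa using hΦ, Φ.vert_mem⟩, he, mem_biUnion he ⟨Φ.face_mem, Φ.edge_face⟩⟩
  · intro Φ _ Ψ _ h
    simp only [Prod.mk.injEq] at h
    exact Flag.ext h.1 h.2.1 h.2.2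

theorem Tame.countable_flag (hT : M.Tame) : Countable M.Flag := by
  rw [← countable_univ_iff]
  refine (countable_iUnion fun n : ℕ => (hT.finite_flags n).countable).mono fun Φ _ => ?_
  obtain ⟨n, hn⟩ := exists_nat_ge ‖Φ.vert‖
  exact mem_iUnion.2 ⟨n, hn⟩

theorem Tame.countable_corners (hT : M.Tame) (c : Set Plane → Plane) :
    (M.corners c).Countable := by
  have := hT.countable_flag
  exact countable_range _

namespace Periodic

theorem finite_orbits (hP : M.Periodic) :
    Finite (Quotient (AddAction.orbitRel M.transl M.Flag)) := by
  obtain ⟨R, hR⟩ := hP.cocompact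
  have := (hP.tame.finite_flags R).to_subtype
  refine Finite.of_surjective
    (fun Φ : {Φ : M.Flag | ‖Φ.vert‖ ≤ R} => Quotient.mk (AddAction.orbitRel M.transl M.Flag) Φ.1) ?_
  intro q
  induction q using Quotient.inductionOn with | h Φ => ?_
  obtain ⟨t, ht⟩ := hR Φ.vert
  refine ⟨⟨t +ᵥ Φ, ht⟩, Quotient.sound ?_⟩
  exact ⟨t, rfl⟩

theorem exists_dist_face_le (hP : M.Periodic) :
    ∃ D : ℝ, ∀ Φ : M.Flag, ∀ x ∈ closure Φ.face, dist Φ.vert x ≤ D := by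
  obtain ⟨R, hR⟩ := hP.cocompact
  have hfin := hP.tame.finite_flags R
  have hb : ∀ Φ ∈ {Φ : M.Flag | ‖Φ.vert‖ ≤ R}, Bornology.IsBounded (closure Φ.face) :=
    fun Φ _ => ((hP.hasConvexPolygonFaces.2 _ Φ.face_mem).2).closure
  obtain ⟨D, hD⟩ := Metric.isBounded_iff.1 ((Bornology.isBounded_biUnion hfin).2 hb)
  refine ⟨D, fun Φ x hx => ?_⟩
  obtain ⟨t, ht⟩ := hR Φ.vert
  have hmem : t +ᵥ Φ ∈ {Φ : M.Flag | ‖Φ.vert‖ ≤ R} := ht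
  have h1 : ∀ y ∈ closure Φ.face, y + t ∈ closure (t +ᵥ Φ).face := fun y hy => by
    rw [vadd_face, closure_tr]; exact add_mem_tr.2 hy
  have := hD (mem_biUnion hmem (h1 _ (Φ.edge_face Φ.vert_edge))) (mem_biUnion hmem (h1 _ hx))
  rwa [dist_add_right] at this

theorem locallyFinite_triangles (hP : M.Periodic) {c : Set Plane → Plane} (hc : M.IsCentre c) :
    LocallyFinite fun Φ : M.Flag => range (Φ.tau c) := by
  obtain ⟨D, hD⟩ := hP.exists_dist_face_le
  intro x
  refine ⟨Metric.ball x 1, Metric.ball_mem_nhds x one_pos,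
    (hP.tame.finite_flags (D + 1 + ‖x‖)).subset ?_⟩
  rintro Φ ⟨y, ⟨s, rfl⟩, hy⟩
  have h1 := hD Φ _ (hP.tame.tau_mem_closure hc Φ s)
  have h2 : dist (Φ.tau c s) x < 1 := hy
  have h3 := dist_triangle4 Φ.vert (Φ.tau c s) x 0
  rw [dist_zero_right, dist_zero_right] at h3
  change ‖Φ.vert‖ ≤ _
  linarith

end Periodic

/-! ### Centres that are invariant under translations -/

/-- The chosen points are invariant under translations. -/
def IsInvariantCentre (M : PlaneMap) (c : Set Plane → Plane) : Prop :=
  ∀ (t : M.transl), ∀ F ∈ M.faces, c (tr t F) = c F + t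

/-- Choose a point in one face of each orbit and translate it. The translation from the
representative to a face is unique because faces are bounded and nonempty, so no face gets two
points. -/
theorem exists_isInvariantCentre (hM : M.HasConvexPolygonFaces) :
    ∃ c, M.IsCentre c ∧ M.IsInvariantCentre c := by
  let r : Setoid (Set Plane) := ⟨fun A B => ∃ t : M.transl, B = tr t A, fun A => ⟨0, by simp⟩,
    by
      rintro A B ⟨t, rfl⟩
      exact ⟨-t, by simp [tr_neg_tr]⟩,
    by
      rintro A B C ⟨t, rfl⟩ ⟨s, rfl⟩
      exact ⟨s + t, by simp [tr_tr]⟩⟩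
  let rep : Set Plane → Set Plane := fun F => (Quotient.mk r F).out
  have hrep : ∀ F, ∃ t : M.transl, F = tr t (rep F) := fun F => Quotient.exact (Quotient.out_eq (Quotient.mk r F))
  have hrepF : ∀ F ∈ M.faces, rep F ∈ M.faces := by
    intro F hF
    obtain ⟨t, ht⟩ := hrep F
    have : rep F = tr (-t) F := by
      conv_rhs => rw [ht]
      rw [tr_neg_tr]
    rw [this]
    exact tr_mem_faces (-t) hF
  have hpick : ∀ F : Set Plane, ∃ x, F.Nonempty → x ∈ F := fun F => by
    by_cases h : F.Nonempty
    · exact ⟨h.some, fun _ => h.some_mem⟩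
    · exact ⟨0, fun h' => absurd h' h⟩
  choose s hs using hrep
  choose p hp using hpick
  refine ⟨fun F => p (rep F) + s F, fun F hF => ?_, fun t F hF => ?_⟩
  · have : p (rep F) + s F ∈ tr (s F) (rep F) :=
      add_mem_tr.2 (hp _ (face_nonempty (hrepF F hF)))
    rwa [← hs F] at this
  · have h1 : rep (tr t F) = rep F :=
      congrArg Quotient.out (Quotient.sound (⟨-t, by simp [tr_neg_tr]⟩ : r.r (tr t F) F))
    have h2 : tr (s (tr t F)) (rep F) = tr (t + s F) (rep F) := by
      rw [← tr_tr, ← hs F]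
      have := hs (tr t F)
      rw [h1] at this
      exact this.symm
    have h3 := eq_of_tr_eq (face_nonempty (hrepF F hF)) (hM.2 _ (hrepF F hF)).2 h2
    simp only [h1]
    rw [h3]; abel

theorem corner_vadd (hM : M.HasConvexPolygonFaces) {c : Set Plane → Plane}
    (hc : M.IsInvariantCentre c) (t : M.transl) (Φ : M.Flag) (j : Fin 3) :
    (t +ᵥ Φ).corner c j = Φ.corner c j + t := by
  have h3 : ∀ i : Fin 3, i = 0 ∨ i = 1 ∨ i = 2 := by decide
  rcases h3 j with rfl | rfl | rfl
  · rfl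
  · exact edgeMid_tr hM t Φ.edge_mem
  · exact hc t _ Φ.face_mem

theorem tau_vadd (hM : M.HasConvexPolygonFaces) {c : Set Plane → Plane}
    (hc : M.IsInvariantCentre c) (t : M.transl) (Φ : M.Flag) (x : stdSimplex ℝ (Fin 3)) :
    (t +ᵥ Φ).tau c x = Φ.tau c x + t := by
  simp only [Flag.tau, corner_vadd hM hc, smul_add, Finset.sum_add_distrib]
  rw [← Finset.sum_smul, x.2.2, one_smul]

theorem add_mem_corners (hM : M.HasConvexPolygonFaces) {c : Set Plane → Plane}
    (hc : M.IsInvariantCentre c) (t : M.transl) {x : Plane} :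
    x + t ∈ M.corners c ↔ x ∈ M.corners c := by
  have key : ∀ (t : M.transl) {x : Plane}, x ∈ M.corners c → x + t ∈ M.corners c := by
    rintro t _ ⟨⟨Φ, j⟩, rfl⟩
    exact ⟨(t +ᵥ Φ, j), corner_vadd hM hc t Φ j⟩
  refine ⟨fun h => ?_, key t⟩
  have := key (-t) h
  simpa using this

/-- Subtracting the integer parts of the coordinates moves any point into the fundamental
parallelogram. -/
theorem periodic_of_translations (hM : M.HasConvexPolygonFaces) {t₁ t₂ : Plane}
    (ht : LinearIndependent ℝ ![t₁, t₂]) (h₁ : t₁ ∈ M.transl) (h₂ : t₂ ∈ M.transl) :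
    M.Periodic := by
  refine ⟨hM, ‖t₁‖ + ‖t₂‖, fun x => ?_⟩
  let b := basisOfLinearIndependentOfCardEqFinrank ht (by simp)
  have hx := b.sum_repr x
  rw [Fin.sum_univ_two] at hx
  simp only [b, coe_basisOfLinearIndependentOfCardEqFinrank, Matrix.cons_val_zero,
    Matrix.cons_val_one] at hx
  generalize (basisOfLinearIndependentOfCardEqFinrank ht _).repr x 0 = p at hx
  generalize (basisOfLinearIndependentOfCardEqFinrank ht _).repr x 1 = q at hx
  refine ⟨⟨-(⌊p⌋ • t₁ + ⌊q⌋ • t₂),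
    neg_mem (add_mem (zsmul_mem h₁ _) (zsmul_mem h₂ _))⟩, ?_⟩
  have : x + -(⌊p⌋ • t₁ + ⌊q⌋ • t₂) = Int.fract p • t₁ + Int.fract q • t₂ := by
    rw [← hx, ← Int.cast_smul_eq_zsmul ℝ, ← Int.cast_smul_eq_zsmul ℝ, Int.fract, Int.fract]
    module
  change ‖x + -(⌊p⌋ • t₁ + ⌊q⌋ • t₂)‖ ≤ _
  rw [this]
  refine (norm_add_le _ _).trans (add_le_add ?_ ?_)
  · rw [norm_smul, Real.norm_of_nonneg (Int.fract_nonneg p)]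
    exact mul_le_of_le_one_left (norm_nonneg _) (Int.fract_lt_one p).le
  · rw [norm_smul, Real.norm_of_nonneg (Int.fract_nonneg q)]
    exact mul_le_of_le_one_left (norm_nonneg _) (Int.fract_lt_one q).le

end PlaneMap

/-! ### Transitivity of the monodromy group, and change of the centres -/

theorem one_lt_rank_plane : 1 < Module.rank ℝ Plane := by
  rw [← Module.finrank_eq_rank, finrank_euclideanSpace_fin]; norm_num

namespace PlaneMap

variable {M : PlaneMap}

/-- The corner `j` of the standard triangle. -/
def simplexCorner (j : Fin 3) : stdSimplex ℝ (Fin 3) := ⟨Pi.single j 1, single_mem_stdSimplex ℝ j⟩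

theorem Flag.tau_simplexCorner (c : Set Plane → Plane) (Φ : M.Flag) (j : Fin 3) :
    Φ.tau c (simplexCorner j) = Φ.corner c j := by
  rw [Flag.tau, Finset.sum_eq_single j]
  · simp [simplexCorner]
  · intro i _ hij
    simp [simplexCorner, hij]
  · simp

/-- The barycentre of the standard triangle. -/
def simplexBary : stdSimplex ℝ (Fin 3) :=
  ⟨fun _ => 3⁻¹, fun _ => by norm_num, by simp⟩

theorem Tame.eq_simplexCorner (hT : M.Tame) {c : Set Plane → Plane} (hc : M.IsCentre c)
    {Φ : M.Flag} {x : stdSimplex ℝ (Fin 3)} (h : Φ.tau c x ∈ M.corners c) :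
    ∃ j, x = simplexCorner j := by
  obtain ⟨⟨Ψ, j⟩, h⟩ := h
  have h : Ψ.corner c j = Φ.tau c x := h
  rw [← Flag.tau_simplexCorner] at h
  exact ⟨j, (hT.tau_inj hc h).1.symm⟩

theorem Tame.tau_simplexBary_notMem (hT : M.Tame) {c : Set Plane → Plane} (hc : M.IsCentre c)
    (Φ : M.Flag) : Φ.tau c simplexBary ∉ M.corners c := by
  intro h
  obtain ⟨j, hj⟩ := hT.eq_simplexCorner hc h
  have := congrFun (congrArg Subtype.val hj) j
  simp [simplexBary, simplexCorner] at this

theorem monGen_apply (i : Fin 3) (Φ : M.Flag) :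
    (M.monGen i : Equiv.Perm M.Flag) Φ = Φ.adj i := rfl

/-- The monodromy group is transitive on the flags. -/
theorem Periodic.exists_mon (hP : M.Periodic) (Φ Ψ : M.Flag) :
    ∃ g : M.Mon, (g : Equiv.Perm M.Flag) Φ = Ψ := by
  obtain ⟨c, hc, -⟩ := exists_isInvariantCentre hP.hasConvexPolygonFaces
  have hT := hP.tame
  have hLF := hP.locallyFinite_triangles hc
  let P : M.Flag → Prop := fun Ξ => ∃ g : M.Mon, (g : Equiv.Perm M.Flag) Φ = Ξ
  by_contra hΨ
  have hA : IsClosed (⋃ Ξ : {Ξ // P Ξ}, range (Ξ.1.tau c)) :=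
    (hLF.comp_injective Subtype.val_injective).isClosed_iUnion fun _ => Flag.isClosed_range_tau _ _
  have hB : IsClosed (⋃ Ξ : {Ξ // ¬ P Ξ}, range (Ξ.1.tau c)) :=
    (hLF.comp_injective Subtype.val_injective).isClosed_iUnion fun _ => Flag.isClosed_range_tau _ _
  -- The plane without the countably many corners is connected. Hence the triangles that can be
  -- reached from `Φ` and the others, two closed families, share a point that is no corner, and
  -- there the triangles are equal or adjacent.
  have hpre : IsPreconnected (M.corners c)ᶜ :=
    ((hT.countable_corners c).isPathConnected_compl_of_one_lt_rank
      one_lt_rank_plane).isConnected.isPreconnected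
  obtain ⟨z, hz, hzA, hzB⟩ := isPreconnected_closed_iff.1 hpre _ _ hA hB
    (fun y _ => by
      obtain ⟨Ξ, x, rfl⟩ := hT.exists_tau c y
      by_cases h : P Ξ
      · exact Or.inl (mem_iUnion.2 ⟨⟨Ξ, h⟩, mem_range_self x⟩)
      · exact Or.inr (mem_iUnion.2 ⟨⟨Ξ, h⟩, mem_range_self x⟩))
    ⟨_, hT.tau_simplexBary_notMem hc Φ, mem_iUnion.2 ⟨⟨Φ, 1, rfl⟩, mem_range_self _⟩⟩
    ⟨_, hT.tau_simplexBary_notMem hc Ψ, mem_iUnion.2 ⟨⟨Ψ, hΨ⟩, mem_range_self _⟩⟩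
  obtain ⟨⟨Ξ, g, hg⟩, x, hx⟩ := mem_iUnion.1 hzA
  obtain ⟨⟨Θ, hΘ⟩, y, hy⟩ := mem_iUnion.1 hzB
  apply hΘ
  rcases (hT.eq_or_adj hc (hx.trans hy.symm) (by rw [hx]; exact hz)).2 with h | ⟨i, -, h⟩
  · exact ⟨g, hg.trans h.symm⟩
  · exact ⟨M.monGen i * g, by
      rw [Subgroup.coe_mul, Equiv.Perm.mul_apply, hg, monGen_apply]; exact h.symm⟩

/-- Where triangles overlap, their points have equal barycentric coordinates, and corners of nonzero
weight are equal; so moving the centres gives a well defined map of the plane. -/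
theorem Tame.tau_congr (hT : M.Tame) {c : Set Plane → Plane} (hc : M.IsCentre c)
    (c' : Set Plane → Plane) {Φ Ψ : M.Flag} {x y : stdSimplex ℝ (Fin 3)}
    (h : Φ.tau c x = Ψ.tau c y) : Φ.tau c' x = Ψ.tau c' y := by
  obtain ⟨rfl, h0, h1, h2⟩ := hT.tau_inj hc h
  have key : ∀ {k : ℝ} {a b : Plane}, (k ≠ 0 → a = b) → k • a = k • b := by
    intro k a b h
    by_cases hk : k = 0
    · rw [hk, zero_smul, zero_smul]
    · rw [h hk]
  rw [Flag.tau_eq, Flag.tau_eq, key h0, key fun h => congrArg M.edgeMid (h1 h),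
    key fun h => congrArg c' (h2 h)]

/-- The piecewise affine map of the plane that moves the chosen points `c F` to `c' F`. -/
def Tame.transfer (hT : M.Tame) (c c' : Set Plane → Plane) (y : Plane) : Plane :=
  (hT.exists_tau c y).choose.tau c' (hT.exists_tau c y).choose_spec.choose

theorem Tame.transfer_tau (hT : M.Tame) {c : Set Plane → Plane} (hc : M.IsCentre c)
    (c' : Set Plane → Plane) (Φ : M.Flag) (x : stdSimplex ℝ (Fin 3)) :
    hT.transfer c c' (Φ.tau c x) = Φ.tau c' x :=
  hT.tau_congr hc c' (hT.exists_tau c (Φ.tau c x)).choose_spec.choose_spec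

theorem Tame.transfer_transfer (hT : M.Tame) {c c' : Set Plane → Plane} (hc : M.IsCentre c)
    (hc' : M.IsCentre c') (y : Plane) : hT.transfer c' c (hT.transfer c c' y) = y := by
  obtain ⟨Φ, x, rfl⟩ := hT.exists_tau c y
  rw [hT.transfer_tau hc, hT.transfer_tau hc']

/-- The preimage of a closed set is a locally finite union of compact pieces, one in each triangle.
-/
theorem Periodic.continuous_transfer (hP : M.Periodic) {c c' : Set Plane → Plane}
    (hc : M.IsCentre c) : Continuous (hP.tame.transfer c c') := by
  have hT := hP.tame
  rw [continuous_iff_isClosed]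
  intro Z hZ
  have : hT.transfer c c' ⁻¹' Z = ⋃ Φ : M.Flag, Φ.tau c '' (Φ.tau c' ⁻¹' Z) := by
    ext y
    constructor
    · intro hy
      obtain ⟨Φ, x, rfl⟩ := hT.exists_tau c y
      rw [mem_preimage, hT.transfer_tau hc] at hy
      exact mem_iUnion.2 ⟨Φ, x, hy, rfl⟩
    · intro hy
      obtain ⟨Φ, x, hx, rfl⟩ := mem_iUnion.1 hy
      rw [mem_preimage, hT.transfer_tau hc]
      exact hx
  rw [this]
  exact ((hP.locallyFinite_triangles hc).subset fun Φ => image_subset_range _ _).isClosed_iUnion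
    fun Φ => (Φ.isCompact_tau_image c (hZ.preimage (Φ.continuous_tau c'))).isClosed

/-- The homeomorphism of the plane that moves the chosen points `c F` to `c' F`. -/
def Periodic.transferHomeo (hP : M.Periodic) {c c' : Set Plane → Plane}
    (hc : M.IsCentre c) (hc' : M.IsCentre c') : Plane ≃ₜ Plane where
  toFun := hP.tame.transfer c c'
  invFun := hP.tame.transfer c' c
  left_inv := hP.tame.transfer_transfer hc hc'
  right_inv := hP.tame.transfer_transfer hc' hc
  continuous_toFun := hP.continuous_transfer hc
  continuous_invFun := hP.continuous_transfer hc'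

theorem Periodic.coverMap_transfer (hP : M.Periodic) {c c' : Set Plane → Plane}
    (hc : M.IsCentre c) (hc' : M.IsCentre c') (Φ₀ : M.Flag) :
    coverMap c' Φ₀ = hP.transferHomeo hc hc' ∘ coverMap c Φ₀ := by
  funext s
  induction s using Quot.ind with | mk a => ?_
  obtain ⟨g, x⟩ := a
  exact (hP.tame.transfer_tau hc c' _ x).symm

/-! ### The walk around a face, and branch points at its centre -/

/-- The walk around a face: the product of the first two generators. -/
def faceRot (M : PlaneMap) : M.Mon := M.monGen 1 * M.monGen 0

theorem monGen_mul_self (i : Fin 3) : M.monGen i * M.monGen i = 1 :=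
  Subtype.ext (Equiv.ext fun Φ => Flag.adj_adj i Φ)

theorem monGen_inv (i : Fin 3) : (M.monGen i)⁻¹ = M.monGen i :=
  inv_eq_of_mul_eq_one_left (monGen_mul_self i)

theorem monGen_mul_faceRot_zpow (k : ℤ) :
    M.monGen 0 * M.faceRot ^ k = M.faceRot ^ (-k) * M.monGen 0 := by
  have h : M.monGen 0 * M.faceRot * (M.monGen 0)⁻¹ = M.faceRot⁻¹ := by
    rw [faceRot, mul_inv_rev, monGen_inv, monGen_inv, mul_assoc, mul_assoc, monGen_mul_self, mul_one]
  have h2 := conj_zpow (a := M.monGen 0) (b := M.faceRot) (i := k)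
  rw [h, inv_zpow, ← zpow_neg] at h2
  rw [h2, inv_mul_cancel_right]

/-- The first two generators satisfy the dihedral relations. Equality would give a flag fixed by
generator 0 (even `k`) or by generator 1 (odd `k`), but no flag is adjacent to itself. -/
theorem Tame.faceRot_zpow_smul_ne (hT : M.Tame) (k : ℤ) (Φ : M.Flag) :
    M.faceRot ^ k • Φ ≠ M.monGen 0 • Φ := by
  intro h
  have hfix : ∀ (i : Fin 3) (Ψ : M.Flag), M.monGen i • Ψ ≠ Ψ := fun i Ψ => hT.adj_ne i Ψ
  obtain ⟨j, rfl | rfl⟩ := Int.even_or_odd' k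
  · rw [two_mul, zpow_add, mul_smul, ← eq_inv_smul_iff, ← zpow_neg, ← mul_smul,
      ← monGen_mul_faceRot_zpow, mul_smul] at h
    exact hfix 0 _ h.symm
  · rw [add_comm, two_mul, ← add_assoc, add_comm (1 + j), zpow_add, mul_smul, ← eq_inv_smul_iff,
      ← zpow_neg, ← mul_smul, ← monGen_mul_faceRot_zpow, mul_smul, zpow_add, mul_smul, zpow_one] at h
    nth_rewrite 1 [faceRot] at h
    rw [mul_smul] at h
    exact hfix 1 _ h

theorem faceRot_zpow_face (k : ℤ) (Φ : M.Flag) : (M.faceRot ^ k • Φ).face = Φ.face := by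
  have h1 : ∀ Ψ : M.Flag, (M.faceRot • Ψ).face = Ψ.face := fun Ψ =>
    ((Flag.adj_agree 1 _).2.2 (by decide)).trans ((Flag.adj_agree 0 _).2.2 (by decide))
  induction k using Int.induction_on with
  | zero => simp
  | succ n ih => rw [add_comm, zpow_add, zpow_one, mul_smul, h1, ih]
  | pred n ih =>
    rw [← ih, ← h1 (M.faceRot ^ (-(n : ℤ) - 1) • Φ), ← mul_smul, ← zpow_one_add]
    congr 2; ring_nf

theorem monGen_zero_edge (Φ : M.Flag) : (M.monGen 0 • Φ).edge = Φ.edge :=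
  (Flag.adj_agree 0 Φ).2.1 (by decide)

theorem monGen_zero_face (Φ : M.Flag) : (M.monGen 0 • Φ).face = Φ.face :=
  (Flag.adj_agree 0 Φ).2.2 (by decide)

theorem Tame.isPreconnected_frontier (hT : M.Tame) {F : Set Plane} (hF : F ∈ M.faces) :
    IsPreconnected (frontier F) := by
  obtain ⟨h, -, -, h3⟩ := exists_homeomorph_image_interior_closure_frontier_eq_unitBall
    (hT.convex_face hF) (by rw [(hT.isOpen_face hF).interior_eq]; exact face_nonempty hF)
    (hT.hasConvexPolygonFaces.2 F hF).2
  rw [← h.isPreconnected_image, h3]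
  exact (isConnected_sphere one_lt_rank_plane 0 zero_le_one).isPreconnected

theorem Tame.finite_face_edges (hT : M.Tame) {F : Set Plane} (hF : F ∈ M.faces) :
    {e ∈ M.edges | e ⊆ closure F}.Finite := by
  obtain ⟨r, hr⟩ := (hT.hasConvexPolygonFaces.2 F hF).2.closure.exists_norm_le
  refine (finite_edges M r).subset ?_
  rintro e ⟨he, heF⟩
  obtain ⟨v, hv, w, -, -, hs, -⟩ := exists_edge_ends hT.hasConvexPolygonFaces he
  have hve : v ∈ e := hs ▸ left_mem_segment ℝ v w
  exact ⟨he, v, hv, hve, hr v (heF hve)⟩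

/-- Walking around a face one meets all its edges. -/
theorem Tame.exists_faceRot_edge (hT : M.Tame) (Φ : M.Flag) {e : Set Plane} (he : e ∈ M.edges)
    (heF : e ⊆ closure Φ.face) : ∃ k : ℤ, (M.faceRot ^ k • Φ).edge = e := by
  -- The orbit of `Φ` under the dihedral group of generators 0 and 1.
  let R : Set M.Flag := {Ψ | ∃ k : ℤ, Ψ = M.faceRot ^ k • Φ ∨ Ψ = M.faceRot ^ k • M.monGen 0 • Φ}
  have hR0 : ∀ Ψ ∈ R, M.monGen 0 • Ψ ∈ R := by
    rintro _ ⟨k, rfl | rfl⟩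
    · exact ⟨-k, Or.inr (by rw [← mul_smul, monGen_mul_faceRot_zpow, mul_smul])⟩
    · exact ⟨-k, Or.inl (by rw [← mul_smul, monGen_mul_faceRot_zpow, mul_smul, ← mul_smul (M.monGen 0),
        monGen_mul_self, one_smul])⟩
  have hR1 : ∀ Ψ ∈ R, M.monGen 1 • Ψ ∈ R := by
    intro Ψ hΨ
    have h1 : M.monGen 1 • Ψ = M.faceRot • M.monGen 0 • Ψ := by
      rw [faceRot, ← mul_smul, mul_assoc, monGen_mul_self, mul_one]
    rw [h1]
    obtain ⟨k, h | h⟩ := hR0 Ψ hΨ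
    · exact ⟨1 + k, Or.inl (by rw [h, ← mul_smul, ← zpow_one_add])⟩
    · exact ⟨1 + k, Or.inr (by rw [h, ← mul_smul _ (M.faceRot ^ k), ← zpow_one_add])⟩
  have hRF : ∀ Ψ ∈ R, Ψ.face = Φ.face := by
    rintro _ ⟨k, rfl | rfl⟩
    · exact faceRot_zpow_face k Φ
    · rw [faceRot_zpow_face, monGen_zero_face]
  have hΦR : Φ ∈ R := ⟨0, Or.inl (by simp)⟩
  by_contra hno
  have hne : ∀ Ψ ∈ R, Ψ.edge ≠ e := by
    rintro _ ⟨k, rfl | rfl⟩ h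
    · exact hno ⟨k, h⟩
    · refine hno ⟨-k, ?_⟩
      rw [← h, ← mul_smul, ← neg_neg k, ← monGen_mul_faceRot_zpow, mul_smul, monGen_zero_edge, neg_neg]
  have hfin := hT.finite_face_edges Φ.face_mem
  let E₁ : Set (Set Plane) := {e ∈ M.edges | e ⊆ closure Φ.face} ∩ Flag.edge '' R
  let E₂ : Set (Set Plane) := {e ∈ M.edges | e ⊆ closure Φ.face} \ Flag.edge '' R
  have hc1 : IsClosed (⋃ e ∈ E₁, e) := (hfin.inter_of_left _).isClosed_biUnion
    fun e he => isClosed_edge hT.hasConvexPolygonFaces he.1.1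
  have hc2 : IsClosed (⋃ e ∈ E₂, e) := hfin.sdiff.isClosed_biUnion
    fun e he => isClosed_edge hT.hasConvexPolygonFaces he.1.1
  have hfr : ∀ e ∈ M.edges, e ⊆ closure Φ.face → e ⊆ frontier Φ.face := by
    intro e he heF x hx
    rw [(hT.isOpen_face Φ.face_mem).frontier_eq]
    exact ⟨heF hx, fun h => disjoint_face_skeleton Φ.face_mem h (Or.inr ⟨e, he, hx⟩)⟩
  have hΦE : Φ.edge ∈ E₁ := ⟨⟨Φ.edge_mem, Φ.edge_face⟩, Φ, hΦR, rfl⟩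
  have heE : e ∈ E₂ := ⟨⟨he, heF⟩, by rintro ⟨Ψ, h1, h2⟩; exact hne Ψ h1 h2⟩
  obtain ⟨u, -, w, -, -, hs, -⟩ := exists_edge_ends hT.hasConvexPolygonFaces he
  have hue : u ∈ e := hs ▸ left_mem_segment ℝ u w
  -- The boundary of the face is connected and covered by the edges of flags in `R` and the
  -- remaining edges, so two of them meet. They meet in a vertex `z`, and the step to the next edge
  -- at `z` stays in `R`.
  obtain ⟨z, -, hz1, hz2⟩ := isPreconnected_closed_iff.1
    (hT.isPreconnected_frontier Φ.face_mem) _ _ hc1 hc2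
    (by
      intro x hx
      rw [(hT.isOpen_face Φ.face_mem).frontier_eq] at hx
      obtain ⟨e', he', hx', heF'⟩ := hT.exists_edge_of_mem_closure Φ.face_mem hx.1 hx.2
      by_cases h : e' ∈ Flag.edge '' R
      · exact Or.inl (mem_biUnion (show e' ∈ E₁ from ⟨⟨he', heF'⟩, h⟩) hx')
      · exact Or.inr (mem_biUnion (show e' ∈ E₂ from ⟨⟨he', heF'⟩, h⟩) hx'))
    ⟨Φ.vert, hfr _ Φ.edge_mem Φ.edge_face Φ.vert_edge, mem_biUnion hΦE Φ.vert_edge⟩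
    ⟨u, hfr _ he heF hue, mem_biUnion heE hue⟩
  simp only [mem_iUnion] at hz1 hz2
  obtain ⟨_, ⟨-, Ψ, hΨ, rfl⟩, hz1⟩ := hz1
  obtain ⟨e', ⟨⟨he', heF'⟩, hne'⟩, hz2⟩ := hz2
  have hee : Ψ.edge ≠ e' := fun h => hne' ⟨Ψ, hΨ, h⟩
  have hzv := M.edge_inter _ Ψ.edge_mem _ he' hee ⟨hz1, hz2⟩
  obtain ⟨X, hX, hXe, hXv⟩ : ∃ X ∈ R, X.edge = Ψ.edge ∧ X.vert = z := by
    by_cases hv : Ψ.vert = z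
    · exact ⟨Ψ, hΨ, rfl, hv⟩
    · refine ⟨_, hR0 Ψ hΨ, monGen_zero_edge Ψ, ?_⟩
      have : Ψ.IsAdj 0 ⟨z, Ψ.edge, Ψ.face, hzv, Ψ.edge_mem, Ψ.face_mem, hz1, Ψ.edge_face⟩ :=
        ⟨fun h => hv (congrArg Flag.vert h).symm, fun h => absurd rfl h, fun _ => rfl, fun _ => rfl⟩
      exact (congrArg Flag.vert (hT.eq_adj this)).symm
  have hXF := hRF X hX
  have : X.IsAdj 1 ⟨z, e', X.face, hzv, he', X.face_mem, hz2, hXF ▸ heF'⟩ :=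
    ⟨fun h => hee (hXe.symm.trans (congrArg Flag.edge h).symm), fun _ => hXv.symm,
      fun h => absurd rfl h, fun _ => rfl⟩
  refine hne' ⟨_, hR1 X hX, ?_⟩
  exact (congrArg Flag.edge (hT.eq_adj this)).symm

/-- The size of a face is the period of the walk around it. -/
theorem Tame.faceSize_eq (hT : M.Tame) (Φ : M.Flag) :
    M.faceSize Φ.face = Function.minimalPeriod (M.faceRot • ·) Φ := by
  -- The other flag with the same edge and face is the 0-adjacent one, which no power of the walk
  -- reaches.
  have hinj : InjOn Flag.edge (MulAction.orbit (Subgroup.zpowers M.faceRot) Φ) := by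
    rintro _ ⟨⟨_, j, rfl⟩, rfl⟩ _ ⟨⟨_, k, rfl⟩, rfl⟩ h
    have h : (M.faceRot ^ j • Φ).edge = (M.faceRot ^ k • Φ).edge := h
    change M.faceRot ^ j • Φ = M.faceRot ^ k • Φ
    by_contra hne
    have hF : (M.faceRot ^ j • Φ).face = (M.faceRot ^ k • Φ).face := by
      rw [faceRot_zpow_face, faceRot_zpow_face]
    have hadj : (M.faceRot ^ k • Φ).IsAdj 0 (M.faceRot ^ j • Φ) :=
      ⟨hne, fun h => absurd rfl h, fun _ => h, fun _ => hF⟩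
    refine hT.faceRot_zpow_smul_ne (j - k) (M.faceRot ^ k • Φ) ?_
    rw [← mul_smul, ← zpow_add, sub_add_cancel]
    exact hT.eq_adj hadj
  have himg : Flag.edge '' (MulAction.orbit (Subgroup.zpowers M.faceRot) Φ) =
      {e ∈ M.edges | e ⊆ closure Φ.face} := by
    ext e
    constructor
    · rintro ⟨_, ⟨⟨_, j, rfl⟩, rfl⟩, rfl⟩
      have h1 := (M.faceRot ^ j • Φ).edge_face
      rw [faceRot_zpow_face] at h1
      exact ⟨(M.faceRot ^ j • Φ).edge_mem, h1⟩
    · rintro ⟨he, heF⟩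
      obtain ⟨k, rfl⟩ := hT.exists_faceRot_edge Φ he heF
      exact ⟨_, ⟨⟨_, k, rfl⟩, rfl⟩, rfl⟩
  have hfin := hT.finite_face_edges Φ.face_mem
  rw [← himg] at hfin
  have hfin' := Set.Finite.of_finite_image hfin hinj
  have := hfin'.fintype
  rw [faceSize, ← himg, hinj.encard_image, MulAction.minimalPeriod_eq_card,
    Set.encard_eq_coe_toFinset_card, Set.toFinset_card]

open Classical in
/-- The triangle that contains a given interior point of a triangle. -/
def triangleLabel (M : PlaneMap) : M.CoverSurface → Option M.Mon :=
  Quot.lift (fun a : M.Triangles => if ∀ j, a.2.1 j ≠ 0 then some a.1 else none) <| by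
    rintro ⟨g, x⟩ ⟨h, y⟩ ⟨i, hg, hx, hi⟩
    dsimp only at hg hx hi ⊢
    subst hx
    rw [if_neg fun h => h i hi, if_neg fun h => h i hi]

/-- A point of the triangle of `g` as a point of the surface. -/
def tri (g : M.Mon) (x : stdSimplex ℝ (Fin 3)) : M.CoverSurface := Quot.mk _ ⟨g, x⟩

theorem continuous_tri (g : M.Mon) : Continuous (tri g) :=
  continuous_quot_mk.comp continuous_sigmaMk

theorem exists_tri (s : M.CoverSurface) : ∃ (g : M.Mon) (x : stdSimplex ℝ (Fin 3)), s = tri g x := by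
  induction s using Quot.ind with | mk a => exact ⟨a.1, a.2, rfl⟩

theorem coverMap_tri (c : Set Plane → Plane) (Φ₀ : M.Flag) (g : M.Mon)
    (x : stdSimplex ℝ (Fin 3)) : coverMap c Φ₀ (tri g x) = (g • Φ₀).tau c x := rfl

theorem tri_monGen_mul (i : Fin 3) (g : M.Mon) {x : stdSimplex ℝ (Fin 3)} (hi : x.1 i = 0) :
    tri (M.monGen i * g) x = tri g x :=
  (Quot.sound ⟨i, rfl, rfl, hi⟩).symm

/-- Gluing affects only the sides, so `triangleLabel` recovers the triangle from an interior point.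
-/
theorem eq_of_tri_eq {g h : M.Mon} {x : stdSimplex ℝ (Fin 3)} (hx : ∀ j, x.1 j ≠ 0)
    (he : tri g x = tri h x) : g = h := by
  have := congrArg M.triangleLabel he
  simp only [triangleLabel, tri] at this
  rw [if_pos hx, if_pos hx] at this
  exact Option.some_injective _ this

/-- The triangles met on the walk share the corner at the centre of the face, as generators 0 and 1
glue along sides through corner 2. -/
theorem tri_faceRot_pow (n : ℕ) (g : M.Mon) :
    tri (M.faceRot ^ n * g) (simplexCorner 2) =
      tri g (simplexCorner 2) := by
  have step : ∀ (i : Fin 3) (g : M.Mon), i ≠ 2 →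
      tri (M.monGen i * g) (simplexCorner 2) = tri g (simplexCorner 2) := fun i g hi =>
    tri_monGen_mul i g (by simp [simplexCorner, hi])
  induction n with
  | zero => simp
  | succ n ih =>
    rw [pow_succ', mul_assoc, faceRot, mul_assoc, step 1 _ (by decide), step 0 _ (by decide)]
    exact ih

theorem exists_interior_mem {U : Set (stdSimplex ℝ (Fin 3))} (hU : IsOpen U)
    (h : simplexCorner 2 ∈ U) : ∃ x ∈ U, ∀ j, x.1 j ≠ 0 := by
  -- Clamping the parameter keeps the path `f` inside the triangle for all real `t`.
  let s : ℝ → ℝ := fun t => max 0 (min t 1)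
  have hs0 : ∀ t, 0 ≤ s t := fun t => le_max_left _ _
  have hs1 : ∀ t, s t ≤ 1 := fun t => max_le zero_le_one (min_le_right _ _)
  have hsc : Continuous s := by fun_prop
  let f : ℝ → stdSimplex ℝ (Fin 3) := fun t => ⟨![s t / 3, s t / 3, 1 - 2 * s t / 3], by
    intro i
    have := hs0 t
    have := hs1 t
    fin_cases i
    · change 0 ≤ s t / 3; linarith
    · change 0 ≤ s t / 3; linarith
    · change 0 ≤ 1 - 2 * s t / 3; linarith, by
    rw [Fin.sum_univ_three]
    change s t / 3 + s t / 3 + (1 - 2 * s t / 3) = 1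
    ring⟩
  have hf : Continuous f := by
    refine Continuous.subtype_mk (continuous_pi fun i => ?_) _
    fin_cases i
    · change Continuous fun t => s t / 3; fun_prop
    · change Continuous fun t => s t / 3; fun_prop
    · change Continuous fun t => 1 - 2 * s t / 3; fun_prop
  have hf0 : f 0 = simplexCorner 2 := by
    apply Subtype.ext
    funext i
    fin_cases i <;> simp [f, s, simplexCorner]
  have hev : ∀ᶠ t in 𝓝[>] (0 : ℝ), f t ∈ U :=
    (hf.continuousAt.eventually_mem (hU.mem_nhds (by rwa [hf0]))).filter_mono nhdsWithin_le_nhds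
  obtain ⟨t, ht, ht0⟩ := (hev.and self_mem_nhdsWithin).exists
  have ht0 : 0 < t := ht0
  refine ⟨f t, ht, fun j => ?_⟩
  have hpos : 0 < s t := lt_max_of_lt_right (lt_min ht0 one_pos)
  have := hs1 t
  fin_cases j
  · change s t / 3 ≠ 0; positivity
  · change s t / 3 ≠ 0; positivity
  · change 1 - 2 * s t / 3 ≠ 0
    intro h; linarith

/-- The triangles of `g` and `faceRot ^ n * g` share corner 2 and have the same image. If the
covering is injective near this corner, then interior points close to it coincide, and so do the
triangles. -/
theorem faceRot_pow_eq_one {c : Set Plane → Plane} {Φ₀ : M.Flag} {g : M.Mon}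
    (h : IsLocalHomeomorphOn (coverMap c Φ₀) {tri g (simplexCorner 2)})
    {n : ℕ} (hn : M.faceRot ^ n • g • Φ₀ = g • Φ₀) :
    M.faceRot ^ n = 1 := by
  obtain ⟨e, he, hfe⟩ := h _ rfl
  have hU := (e.open_source.preimage (continuous_tri g)).inter
    (e.open_source.preimage (continuous_tri (M.faceRot ^ n * g)))
  obtain ⟨x, ⟨hx1, hx2⟩, hx⟩ := exists_interior_mem hU
    ⟨he, by rw [mem_preimage, tri_faceRot_pow]; exact he⟩
  have heq : e (tri g x) = e (tri (M.faceRot ^ n * g) x) := by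
    rw [← hfe, coverMap_tri, coverMap_tri, mul_smul]
    congr 1
    exact hn.symm
  have := eq_of_tri_eq hx (e.injOn hx1 hx2 heq)
  exact right_eq_mul.1 this

end PlaneMap

theorem exists_simplexCorner_of_two_zeros {x : stdSimplex ℝ (Fin 3)} {i j : Fin 3} (hij : i ≠ j)
    (hi : x.1 i = 0) (hj : x.1 j = 0) : ∃ k, x = PlaneMap.simplexCorner k := by
  have hsum := PlaneMap.simplex_sum x
  have h3 : ∀ i j : Fin 3, i ≠ j → ∃ k, k ≠ i ∧ k ≠ j ∧ ∀ l, l = i ∨ l = j ∨ l = k := by decide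
  obtain ⟨k, hki, hkj, hl⟩ := h3 i j hij
  have hk : x.1 k = 1 := by
    have := x.2.2
    rwa [Finset.sum_eq_single k] at this
    · intro l _ hlk
      rcases hl l with rfl | rfl | rfl
      · exact hi
      · exact hj
      · exact absurd rfl hlk
    · simp
  refine ⟨k, Subtype.ext (funext fun l => ?_)⟩
  rcases hl l with rfl | rfl | rfl
  · simpa [PlaneMap.simplexCorner, hki.symm] using hi
  · simpa [PlaneMap.simplexCorner, hkj.symm] using hj
  · simpa [PlaneMap.simplexCorner] using hk

/-! ### Labellings: lifting along sets without corners -/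

namespace PlaneMap

variable {M : PlaneMap}

theorem Tame.adj_inj (hT : M.Tame) {i j : Fin 3} {Φ : M.Flag} (h : Φ.adj i = Φ.adj j) : i = j := by
  by_contra hij
  have hi := hT.isAdj_adj i Φ
  have hj := hT.isAdj_adj j Φ
  rw [← h] at hj
  refine hi.1 (Flag.ext ?_ ?_ ?_)
  · by_cases h0 : i = 0
    · exact hj.2.1 fun h => hij (h0.trans h.symm)
    · exact hi.2.1 h0
  · by_cases h0 : i = 1
    · exact hj.2.2.1 fun h => hij (h0.trans h.symm)
    · exact hi.2.2.1 h0
  · by_cases h0 : i = 2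
    · exact hj.2.2.2 fun h => hij (h0.trans h.symm)
    · exact hi.2.2.2 h0

/-- A labelling of the triangles met by a set `A`, by elements of the monodromy group: passing a
side `i` in a point of `A` multiplies the label by the generator `i`, and for every triangle the
label is locally constant on the part of `A` in this triangle. -/
structure IsLabelling (c : Set Plane → Plane) (A : Set Plane) (Φ₁ : M.Flag)
    (m : Plane → M.Flag → M.Mon) : Prop where
  notMem_corners : ∀ y ∈ A, y ∉ M.corners c
  adj : ∀ (Φ : M.Flag) (x : stdSimplex ℝ (Fin 3)) (i : Fin 3), Φ.tau c x ∈ A → x.1 i = 0 →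
    m (Φ.tau c x) (Φ.adj i) = M.monGen i * m (Φ.tau c x) Φ
  base : ∀ (Φ : M.Flag) (x : stdSimplex ℝ (Fin 3)), Φ.tau c x ∈ A → m (Φ.tau c x) Φ • Φ₁ = Φ
  finite : {w | ∃ (Φ : M.Flag) (x : stdSimplex ℝ (Fin 3)), Φ.tau c x ∈ A ∧
    m (Φ.tau c x) Φ = w}.Finite
  isClosed : ∀ (Φ : M.Flag) (W : Set M.Mon),
    IsClosed {y | y ∈ A ∧ y ∈ range (Φ.tau c) ∧ m y Φ ∈ W}

namespace IsLabelling

variable {c : Set Plane → Plane} {A B : Set Plane} {Φ₁ Φ₂ : M.Flag}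
  {m m' : Plane → M.Flag → M.Mon}

/-- At a point that is no corner, the label of one triangle determines the label of the other one by
the rule for adjacent triangles. -/
theorem eq_of_eq (hT : M.Tame) (hc : M.IsCentre c) (hA : IsLabelling c A Φ₁ m)
    (hB : IsLabelling c B Φ₂ m') {Φ Ψ : M.Flag} {x z : stdSimplex ℝ (Fin 3)}
    (hxA : Φ.tau c x ∈ A) (hxB : Φ.tau c x ∈ B) (h : m (Φ.tau c x) Φ = m' (Φ.tau c x) Φ)
    (hz : Ψ.tau c z = Φ.tau c x) : m (Φ.tau c x) Ψ = m' (Φ.tau c x) Ψ := by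
  rcases (hT.eq_or_adj hc hz.symm (hA.notMem_corners _ hxA)).2 with rfl | ⟨i, hi, rfl⟩
  · exact h
  · rw [hA.adj Φ x i hxA hi, hB.adj Φ x i hxB hi, h]

theorem mono (hA : IsLabelling c A Φ₁ m) (hB : IsClosed B) (h : B ⊆ A) :
    IsLabelling c B Φ₁ m where
  notMem_corners y hy := hA.notMem_corners y (h hy)
  adj Φ x i hx hi := hA.adj Φ x i (h hx) hi
  base Φ x hx := hA.base Φ x (h hx)
  finite := hA.finite.subset fun w ⟨Φ, x, hx, hw⟩ => ⟨Φ, x, h hx, hw⟩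
  isClosed Φ W := by
    convert hB.inter (hA.isClosed Φ W) using 1
    ext y
    exact ⟨fun hy => ⟨hy.1, h hy.1, hy.2⟩, fun hy => ⟨hy.1, hy.2.2⟩⟩

/-- Right multiplication commutes with the generators acting on the left; only the base flag
changes. -/
theorem mul (hA : IsLabelling c A Φ₁ m) (h : M.Mon) :
    IsLabelling c A (h⁻¹ • Φ₁) fun y Φ => m y Φ * h where
  notMem_corners := hA.notMem_corners
  adj Φ x i hx hi := by rw [hA.adj Φ x i hx hi, mul_assoc]
  base Φ x hx := by rw [mul_smul, smul_inv_smul, hA.base Φ x hx]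
  finite := (hA.finite.image (· * h)).subset fun w ⟨Φ, x, hx, hw⟩ => ⟨_, ⟨Φ, x, hx, rfl⟩, hw⟩
  isClosed Φ W := hA.isClosed Φ ((· * h) ⁻¹' W)

/-- The new labelling is `m` on all of `A`. On `B` it agrees with `m'` only for the triangles that
contain the point; other values of a labelling carry no information. -/
theorem union (hA : IsLabelling c A Φ₁ m) (hB : IsLabelling c B Φ₁ m')
    (h : ∀ (Φ : M.Flag) (x : stdSimplex ℝ (Fin 3)), Φ.tau c x ∈ A → Φ.tau c x ∈ B →
      m (Φ.tau c x) Φ = m' (Φ.tau c x) Φ) :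
    ∃ m'', IsLabelling c (A ∪ B) Φ₁ m'' ∧ (∀ y ∈ A, m'' y = m y) ∧
      ∀ (Φ : M.Flag) (x : stdSimplex ℝ (Fin 3)), Φ.tau c x ∈ B →
        m'' (Φ.tau c x) Φ = m' (Φ.tau c x) Φ := by
  classical
  let m'' : Plane → M.Flag → M.Mon := fun y => if y ∈ A then m y else m' y
  have h1 : ∀ y ∈ A, m'' y = m y := fun y hy => if_pos hy
  have h2 : ∀ (Φ : M.Flag) (x : stdSimplex ℝ (Fin 3)), Φ.tau c x ∈ B →
        m'' (Φ.tau c x) Φ = m' (Φ.tau c x) Φ := by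
    intro Φ x hx
    by_cases hxA : Φ.tau c x ∈ A
    · rw [h1 _ hxA]; exact h Φ x hxA hx
    · exact congrFun (if_neg hxA) Φ
  refine ⟨m'', ?_, h1, h2⟩
  refine ⟨?_, ?_, ?_, ?_, ?_⟩
  · rintro y (hy | hy)
    · exact hA.notMem_corners y hy
    · exact hB.notMem_corners y hy
  · rintro Φ x i (hx | hx) hi
    · rw [h1 _ hx]; exact hA.adj Φ x i hx hi
    · rw [h2 Φ x hx]
      have h3 := Flag.tau_adj c Φ hi
      have h4 := h2 (Φ.adj i) x (by rwa [h3])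
      rw [h3] at h4
      rw [h4]
      exact hB.adj Φ x i hx hi
  · rintro Φ x (hx | hx)
    · rw [h1 _ hx]; exact hA.base Φ x hx
    · rw [h2 Φ x hx]; exact hB.base Φ x hx
  · refine (hA.finite.union hB.finite).subset ?_
    rintro w ⟨Φ, x, hx | hx, hw⟩
    · rw [h1 _ hx] at hw; exact Or.inl ⟨Φ, x, hx, hw⟩
    · rw [h2 Φ x hx] at hw; exact Or.inr ⟨Φ, x, hx, hw⟩
  · intro Φ W
    convert (hA.isClosed Φ W).union (hB.isClosed Φ W) using 1
    ext y
    constructor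
    · rintro ⟨hy | hy, ⟨x, rfl⟩, hw⟩
      · rw [h1 _ hy] at hw; exact Or.inl ⟨hy, mem_range_self x, hw⟩
      · rw [h2 Φ x hy] at hw; exact Or.inr ⟨hy, mem_range_self x, hw⟩
    · rintro (⟨hy, ⟨x, rfl⟩, hw⟩ | ⟨hy, ⟨x, rfl⟩, hw⟩)
      · exact ⟨Or.inl hy, mem_range_self x, by rwa [h1 _ hy]⟩
      · exact ⟨Or.inr hy, mem_range_self x, by rwa [h2 Φ x hy]⟩

/-- Labellings on two sets with just one common point can be glued after a change of the base
flag. -/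
theorem extend (hT : M.Tame) (hc : M.IsCentre c) (hA : IsLabelling c A Φ₁ m)
    (hB : IsLabelling c B Φ₂ m') {y : Plane} (hyA : y ∈ A) (hyB : y ∈ B)
    (hAB : ∀ z ∈ A, z ∈ B → z = y) :
    ∃ m'', IsLabelling c (A ∪ B) Φ₁ m'' := by
  obtain ⟨Φ, x, rfl⟩ := hT.exists_tau c y
  -- The factor that makes the second labelling agree with the first at `y`; the base flags then
  -- agree automatically.
  let h : M.Mon := (m' (Φ.tau c x) Φ)⁻¹ * m (Φ.tau c x) Φ
  have hB' := hB.mul h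
  have hbase : h⁻¹ • Φ₂ = Φ₁ := by
    rw [inv_smul_eq_iff, mul_smul, hA.base Φ x hyA, eq_inv_smul_iff, hB.base Φ x hyB]
  rw [hbase] at hB'
  obtain ⟨m'', h1, -, -⟩ := hA.union hB' fun Ψ z hzA hzB => by
    have hz := hAB _ hzA hzB
    rw [hz]
    exact eq_of_eq hT hc hA hB' hyA hyB (by simp only [h, mul_inv_cancel_left]) hz
  exact ⟨m'', h1⟩

/-- Monodromy commutes with translations, so the labels themselves are unchanged when the set and
the flags are moved. -/
theorem vadd (hT : M.Tame) (hi : M.IsInvariantCentre c) (hA : IsLabelling c A Φ₁ m)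
    (t : M.transl) :
    IsLabelling c (tr t A) (t +ᵥ Φ₁) fun y Φ => m (y - t) (-t +ᵥ Φ) := by
  have htau : ∀ (Φ : M.Flag) x, Φ.tau c x - t = (-t +ᵥ Φ).tau c x := fun Φ x => by
    rw [tau_vadd hT.hasConvexPolygonFaces hi, sub_eq_add_neg]; rfl
  refine ⟨?_, ?_, ?_, ?_, ?_⟩
  · intro y hy hyc
    rw [mem_tr] at hy
    refine hA.notMem_corners _ hy ?_
    have := (add_mem_corners hT.hasConvexPolygonFaces hi (-t)).2 hyc
    rwa [NegMemClass.coe_neg, ← sub_eq_add_neg] at this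
  · intro Φ x i hx h0
    rw [mem_tr] at hx
    rw [htau] at hx ⊢
    rw [← hT.adj_vadd]
    exact hA.adj _ x i hx h0
  · intro Φ x hx
    rw [mem_tr] at hx
    rw [htau] at hx ⊢
    have := hT.mon_vadd (m ((-t +ᵥ Φ).tau c x) (-t +ᵥ Φ)) t Φ₁
    refine this.trans ?_
    rw [← eq_neg_vadd_iff]
    exact hA.base _ x hx
  · refine hA.finite.subset ?_
    rintro w ⟨Φ, x, hx, hw⟩
    rw [mem_tr] at hx
    rw [htau] at hx hw
    exact ⟨_, x, hx, hw⟩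
  · intro Φ W
    convert (hA.isClosed (-t +ᵥ Φ) W).preimage (continuous_sub_right (t : Plane)) using 1
    ext y
    refine and_congr mem_tr (and_congr ?_ Iff.rfl)
    constructor
    · rintro ⟨x, rfl⟩; exact ⟨x, (htau Φ x).symm⟩
    · rintro ⟨x, hx⟩
      refine ⟨x, ?_⟩
      change _ = y - (t : Plane) at hx
      rw [← htau] at hx
      exact sub_left_injective hx

end IsLabelling

/-! ### Labellings on small balls and along segments -/

variable {c : Set Plane → Plane}

/-- Around a point that is no corner there is a labelling. -/
theorem Periodic.exists_local_labelling (hP : M.Periodic) (hc : M.IsCentre c) {y : Plane}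
    (hy : y ∉ M.corners c) : ∃ ε > 0, ∃ (Φ : M.Flag) (m : Plane → M.Flag → M.Mon),
      ∀ A, IsClosed A → A ⊆ Metric.ball y ε → (∀ z ∈ A, z ∉ M.corners c) → IsLabelling c A Φ m := by
  classical
  have hT := hP.tame
  obtain ⟨Φ, x, rfl⟩ := hT.exists_tau c y
  -- By local finiteness, a small ball meets only triangles that contain its centre.
  obtain ⟨ε, hε, hball⟩ := Metric.mem_nhds_iff.1 ((hP.locallyFinite_triangles hc).iInter_compl_mem_nhds
    (fun Φ => Flag.isClosed_range_tau c Φ) (Φ.tau c x))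
  have hnear : ∀ (Ψ : M.Flag) z, Ψ.tau c z ∈ Metric.ball (Φ.tau c x) ε →
      ∃ w, Ψ.tau c w = Φ.tau c x := by
    intro Ψ z hz
    by_contra hno
    have := hball hz
    simp only [mem_iInter] at this
    exact this Ψ hno (mem_range_self z)
  -- On a side, `i` is the number of this side; in the interior of a triangle only `Φ` occurs and `i
  -- = 0` is arbitrary.
  obtain ⟨i, hi⟩ : ∃ i : Fin 3, ∀ (Ψ : M.Flag) w, Ψ.tau c w = Φ.tau c x → Ψ = Φ ∨ Ψ = Φ.adj i := by
    by_cases h0 : ∃ i, x.1 i = 0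
    · obtain ⟨i, hi⟩ := h0
      refine ⟨i, fun Ψ w hw => ?_⟩
      rcases (hT.eq_or_adj hc hw.symm hy).2 with h | ⟨j, hj, h⟩
      · exact Or.inl h
      · by_cases hij : i = j
        · subst hij; exact Or.inr h
        · obtain ⟨k, rfl⟩ := exists_simplexCorner_of_two_zeros hij hi hj
          exact absurd ⟨(Φ, k), (Φ.tau_simplexCorner c k).symm⟩ hy
    · refine ⟨0, fun Ψ w hw => ?_⟩
      rcases (hT.eq_or_adj hc hw.symm hy).2 with h | ⟨j, hj, h⟩
      · exact Or.inl h
      · exact absurd ⟨j, hj⟩ h0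
  have hΦi := hT.adj_ne i Φ
  refine ⟨ε, hε, Φ, fun _ Ψ => if Ψ = Φ then 1 else M.monGen i, fun A hA hAb hAc => ⟨hAc, ?_, ?_, ?_, ?_⟩⟩
  · intro Ψ z j hz hj
    obtain ⟨w, hw⟩ := hnear Ψ z (hAb hz)
    obtain ⟨w', hw'⟩ := hnear (Ψ.adj j) z (by rw [Flag.tau_adj c Ψ hj]; exact hAb hz)
    have hne := hT.adj_ne j Ψ
    rcases hi Ψ w hw with rfl | rfl
    · rcases hi _ w' hw' with h | h
      · exact absurd h hne
      · rw [if_neg hne, if_pos rfl, hT.adj_inj h, mul_one]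
    · rcases hi _ w' hw' with h | h
      · obtain rfl : j = i := hT.adj_inj (h.trans (Flag.adj_adj i Φ).symm)
        rw [if_pos h, if_neg hΦi, monGen_mul_self]
      · exact absurd h hne
  · intro Ψ z hz
    obtain ⟨w, hw⟩ := hnear Ψ z (hAb hz)
    rcases hi Ψ w hw with rfl | rfl
    · rw [if_pos rfl, one_smul]
    · rw [if_neg hΦi]; rfl
  · refine (Set.toFinite {1, M.monGen i}).subset ?_
    rintro w ⟨Ψ, z, -, rfl⟩
    by_cases h : Ψ = Φ
    · left; exact if_pos h
    · right; exact if_neg h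
  · intro Ψ W
    by_cases hW : (if Ψ = Φ then 1 else M.monGen i) ∈ W
    · convert hA.inter (Flag.isClosed_range_tau c Ψ) using 1
      ext z
      exact ⟨fun h => ⟨h.1, h.2.1⟩, fun h => ⟨h.1, h.2, hW⟩⟩
    · convert isClosed_empty using 1
      exact eq_empty_of_forall_notMem fun z hz => hW hz.2.2

/-- Along a segment without corners there is a labelling. -/
theorem Periodic.exists_segment_labelling (hP : M.Periodic) (hc : M.IsCentre c) {p t : Plane}
    (ht : t ≠ 0) {b : ℝ} (hb : 0 ≤ b)
    (hn : ∀ s ∈ Icc 0 b, p + s • t ∉ M.corners c) :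
    ∃ (Φ : M.Flag) (m : Plane → M.Flag → M.Mon),
      IsLabelling c ((fun s : ℝ => p + s • t) '' Icc 0 b) Φ m := by
  have hT := hP.tame
  let q : ℝ → Plane := fun s => p + s • t
  have hq : Continuous q := by fun_prop
  have hinj : Function.Injective q := fun s s' h => smul_left_injective ℝ ht (add_left_cancel h)
  have hcl : ∀ a a' : ℝ, IsClosed (q '' Icc a a') := fun a a' => (isCompact_Icc.image hq).isClosed
  choose! ε hε Ψ μ hμ using fun (y : Plane) (hy : y ∉ M.corners c) =>
    hP.exists_local_labelling hc hy
  -- By compactness the segment is a finite chain of pieces in small balls; consecutive pieces share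
  -- one point, so their labellings can be glued.
  obtain ⟨τ, h0, hmono, ⟨k, hk⟩, hcov⟩ := exists_monotone_Icc_subset_open_cover_Icc hb
    (c := fun s : Icc (0 : ℝ) b => (fun s' : Icc (0 : ℝ) b => q s') ⁻¹' Metric.ball (q s) (ε (q s)))
    (fun s => Metric.isOpen_ball.preimage (by fun_prop))
    (fun s _ => mem_iUnion.2 ⟨s, Metric.mem_ball_self (hε _ (hn s s.2))⟩)
  have hloc : ∀ n, ∃ (Φ : M.Flag) (m : Plane → M.Flag → M.Mon),
      IsLabelling c (q '' Icc (τ n : ℝ) (τ (n + 1))) Φ m := by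
    intro n
    obtain ⟨s, hs⟩ := hcov n
    have hs' : ∀ s' : Icc (0 : ℝ) b, τ n ≤ s' → s' ≤ τ (n + 1) → q s' ∈ Metric.ball (q s) (ε (q s)) :=
      fun s' h1 h2 => hs ⟨h1, h2⟩
    refine ⟨_, _, hμ (q s) (hn s s.2) _ (hcl _ _) ?_ ?_⟩
    · rintro _ ⟨a, ha, rfl⟩
      exact hs' ⟨a, (τ n).2.1.trans ha.1, ha.2.trans (τ (n + 1)).2.2⟩ ha.1 ha.2
    · rintro _ ⟨a, ha, rfl⟩
      exact hn a ⟨(τ n).2.1.trans ha.1, ha.2.trans (τ (n + 1)).2.2⟩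
  have hall : ∀ n, ∃ (Φ : M.Flag) (m : Plane → M.Flag → M.Mon),
      IsLabelling c (q '' Icc 0 (τ n : ℝ)) Φ m := by
    intro n
    induction n with
    | zero =>
      obtain ⟨Φ, m, h⟩ := hloc 0
      refine ⟨Φ, m, h.mono (hcl _ _) (image_mono ?_)⟩
      rw [h0]
      refine Icc_subset_Icc_right ?_
      exact (τ (0 + 1)).2.1
    | succ n ih =>
      obtain ⟨Φ, m, h⟩ := ih
      obtain ⟨Φ', m', h'⟩ := hloc n
      have hle : (τ n : ℝ) ≤ τ (n + 1) := hmono n.le_succ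
      obtain ⟨m'', h''⟩ := h.extend hT hc h' (y := q (τ n)) ⟨_, ⟨(τ n).2.1, le_rfl⟩, rfl⟩
        ⟨_, ⟨le_rfl, hle⟩, rfl⟩ (by
          rintro _ ⟨a, ha, rfl⟩ ⟨a', ha', haa⟩
          obtain rfl := hinj haa
          rw [le_antisymm ha.2 ha'.1])
      rw [← image_union, Icc_union_Icc_eq_Icc (τ n).2.1 hle] at h''
      exact ⟨Φ, m'', h''⟩
  have := hall k
  rwa [hk k le_rfl] at this

/-- Along a segment that ends in a translate of its start, and along the multiples of it. -/
theorem Periodic.exists_power_labelling (hP : M.Periodic) (hc : M.IsCentre c)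
    (hi : M.IsInvariantCentre c) {p : Plane} {t : M.transl} (ht : (t : Plane) ≠ 0)
    (hn : ∀ s : ℝ, p + s • (t : Plane) ∉ M.corners c) {Φ : M.Flag} {x : stdSimplex ℝ (Fin 3)}
    (hx : Φ.tau c x = p) :
    ∃ u : M.Mon, ∀ n : ℕ, ∃ m : Plane → M.Flag → M.Mon,
      IsLabelling c ((fun s : ℝ => p + s • (t : Plane)) '' Icc 0 n) Φ m ∧ m p Φ = 1 ∧
        m (p + (n • t : M.transl)) ((n • t : M.transl) +ᵥ Φ) = u ^ n := by
  have hT := hP.tame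
  let q : ℝ → Plane := fun s => p + s • (t : Plane)
  have hq : Continuous q := by fun_prop
  have hinj : Function.Injective q := fun s s' h => smul_left_injective ℝ ht (add_left_cancel h)
  have hq0 : q 0 = p := by simp [q]
  have hp0 : p ∈ q '' Icc 0 1 := ⟨0, by simp, hq0⟩
  have hqn : ∀ n : ℕ, q n = p + (n • t : M.transl) := fun n => by
    simp only [q]; rw [Nat.cast_smul_eq_nsmul]; rfl
  obtain ⟨Φ₁, m₁, h₁⟩ := hP.exists_segment_labelling hc ht zero_le_one fun s _ => hn s
  -- Normalise the label at the start to 1, so that `Φ` becomes the base flag.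
  obtain ⟨m, hm, hm1⟩ : ∃ m, IsLabelling c (q '' Icc 0 1) Φ m ∧ m p Φ = 1 := by
    refine ⟨fun y Ψ => m₁ y Ψ * (m₁ p Φ)⁻¹, ?_, mul_inv_cancel (m₁ p Φ)⟩
    have := h₁.mul (m₁ p Φ)⁻¹
    have hb := h₁.base Φ x (by rw [hx]; exact hp0)
    rw [hx] at hb
    rwa [inv_inv, hb] at this
  refine ⟨m (p + t) (t +ᵥ Φ), fun n => ?_⟩
  have htau : ∀ s : M.transl, (s +ᵥ Φ).tau c x = p + s := fun s => by
    rw [tau_vadd hT.hasConvexPolygonFaces hi, hx]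
  induction n with
  | zero =>
    refine ⟨m, hm.mono (isCompact_Icc.image hq).isClosed (image_mono ?_), hm1, ?_⟩
    · rw [Nat.cast_zero]; exact Icc_subset_Icc_right zero_le_one
    · simpa using hm1
  | succ n ih =>
    obtain ⟨m', hm', hm1', hmn'⟩ := ih
    have hend : p + (n • t : M.transl) ∈ q '' Icc 0 (n : ℝ) :=
      ⟨n, ⟨n.cast_nonneg, le_rfl⟩, hqn n⟩
    have hbase := hm'.base ((n • t) +ᵥ Φ) x (by rw [htau]; exact hend)
    rw [htau, hmn'] at hbase
    -- The labelling of the first segment, moved to the end of the part already labelled and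
    -- multiplied by `u ^ n`, the label reached there.
    have hadd := (hm.vadd hT hi (n • t)).mul (m (p + t) (t +ᵥ Φ) ^ n)
    rw [← hbase, inv_smul_smul] at hadd
    have himg : tr (n • t : M.transl) (q '' Icc 0 1) = q '' Icc (n : ℝ) (n + 1) := by
      ext y
      rw [mem_tr]
      constructor
      · rintro ⟨s, hs, hsy⟩
        refine ⟨n + s, ⟨by linarith [hs.1], by linarith [hs.2]⟩, ?_⟩
        rw [eq_comm, sub_eq_iff_eq_add] at hsy
        rw [hsy, show ((n • t : M.transl) : Plane) = (n : ℝ) • (t : Plane) by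
          rw [Nat.cast_smul_eq_nsmul]; rfl]
        simp only [q]; module
      · rintro ⟨s, hs, rfl⟩
        refine ⟨s - n, ⟨by linarith [hs.1], by linarith [hs.2]⟩, ?_⟩
        rw [show ((n • t : M.transl) : Plane) = (n : ℝ) • (t : Plane) by
          rw [Nat.cast_smul_eq_nsmul]; rfl]
        simp only [q]; module
    have hend' : p + (n • t : M.transl) ∈ tr (n • t : M.transl) (q '' Icc 0 1) :=
      add_mem_tr.2 hp0
    obtain ⟨m'', h1, h2, h3⟩ := hm'.union hadd fun Ψ z hz1 hz2 => by
      have hz : Ψ.tau c z = ((n • t) +ᵥ Φ).tau c x := by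
        rw [himg] at hz2
        obtain ⟨a, ha, haz⟩ := hz1
        obtain ⟨a', ha', haz'⟩ := hz2
        obtain rfl := hinj (haz.trans haz'.symm)
        obtain rfl := le_antisymm ha.2 ha'.1
        rw [← haz, htau]; exact hqn n
      rw [hz]
      refine hm'.eq_of_eq hT hc hadd (Φ := (n • t) +ᵥ Φ) (x := x) (by rw [htau]; exact hend)
        (by rw [htau]; exact hend') ?_ hz
      rw [htau, hmn', neg_vadd_vadd, add_sub_cancel_right, hm1, one_mul]
    rw [himg, ← image_union, Icc_union_Icc_eq_Icc n.cast_nonneg (by linarith), ← Nat.cast_succ] at h1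
    refine ⟨m'', h1, ?_, ?_⟩
    · rw [h2 _ ⟨0, ⟨le_rfl, n.cast_nonneg⟩, hq0⟩, hm1']
    · have h4 : ((n + 1) • t : M.transl) = n • t + t := succ_nsmul t n
      have h5 := h3 (((n + 1) • t) +ᵥ Φ) x (by
        rw [htau, h4, mem_tr]
        refine ⟨1, by simp, ?_⟩
        simp [q]; abel)
      rw [htau] at h5
      rw [h5, h4, add_vadd, neg_vadd_vadd, AddSubgroup.coe_add, pow_succ']
      congr 2
      abel

/-! ### Commuting powers in the monodromy group -/

/-- A suitable power of all elements of the monodromy group preserves all orbits of flags under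
translations. -/
theorem Periodic.exists_pow_orbit (hP : M.Periodic) : ∃ N : ℕ, 0 < N ∧ ∀ (u : M.Mon) (Φ : M.Flag),
    ∃ t : M.transl, u ^ N • Φ = t +ᵥ Φ := by
  have hT := hP.tame
  let Q := Quotient (AddAction.orbitRel M.transl M.Flag)
  have : Finite Q := hP.finite_orbits
  -- Every element of the monodromy group permutes the finitely many orbits; the order of the
  -- symmetric group kills this permutation.
  refine ⟨Nat.card (Equiv.Perm Q), Nat.card_pos, fun u Φ => ?_⟩
  let U : Equiv.Perm Q := Quotient.congr (u : Equiv.Perm M.Flag) (by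
    intro Φ Ψ
    constructor
    · rintro ⟨t, rfl⟩; exact ⟨t, (hT.mon_vadd u t Ψ).symm⟩
    · rintro ⟨t, ht⟩
      refine ⟨t, (u : Equiv.Perm M.Flag).injective ?_⟩
      exact (hT.mon_vadd u t Ψ).trans ht)
  have hU : ∀ n : ℕ, (U ^ n) (Quotient.mk _ Φ) = Quotient.mk _ (u ^ n • Φ) := by
    intro n
    induction n with
    | zero => rfl
    | succ n ih => rw [pow_succ', Equiv.Perm.mul_apply, ih, pow_succ', mul_smul]; rfl
  have h := hU (Nat.card (Equiv.Perm Q))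
  rw [pow_card_eq_one', Equiv.Perm.one_apply] at h
  obtain ⟨t, ht⟩ := Quotient.exact h.symm
  exact ⟨t, ht.symm⟩

/-- The translations depend on the flag, but `u` and `v` commute with them. Hence both products move
a flag by the sum of its two translations, and translations commute. -/
theorem Tame.commute_of_orbit (hT : M.Tame) {u v : M.Mon}
    (hu : ∀ Φ : M.Flag, ∃ t : M.transl, u • Φ = t +ᵥ Φ)
    (hv : ∀ Φ : M.Flag, ∃ t : M.transl, v • Φ = t +ᵥ Φ) : u * v = v * u := by
  refine Subtype.ext (Equiv.ext fun Φ => ?_)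
  change (u * v) • Φ = (v * u) • Φ
  obtain ⟨s, hs⟩ := hu Φ
  obtain ⟨t, ht⟩ := hv Φ
  have h1 : u • (t +ᵥ Φ) = t +ᵥ u • Φ := hT.mon_vadd u t Φ
  have h2 : v • (s +ᵥ Φ) = s +ᵥ v • Φ := hT.mon_vadd v s Φ
  rw [mul_smul, mul_smul, hs, ht, h1, h2, hs, ht, ← add_vadd, ← add_vadd, add_comm]

end PlaneMap

/-! ### Simple closed curves -/

/-- An injective continuous self-map of the circle is surjective. -/
theorem Circle.surjective_of_injective {k : Circle → Circle} (hk : Continuous k)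
    (hi : Function.Injective k) : Function.Surjective k := by
  intro w
  by_contra hw
  push Not at hw
  -- If `w` is not a value of `k`, then `f` avoids -1, and its argument is a continuous injective
  -- real function on the circle.
  let f : Circle → ℂ := fun z => -((k z : ℂ) / w)
  have hf : Continuous f := by
    have : ∀ _ : Circle, (w : ℂ) ≠ 0 := fun _ => w.coe_ne_zero
    exact ((continuous_subtype_val.comp hk).div continuous_const this).neg
  have hnorm : ∀ z, ‖f z‖ = 1 := fun z => by
    rw [norm_neg, norm_div, Circle.norm_coe, Circle.norm_coe, div_one]
  have hslit : ∀ z, f z ∈ Complex.slitPlane := by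
    intro z
    rw [Complex.mem_slitPlane_iff_not_le_zero]
    intro hle
    have h1 : f z = -(‖f z‖ : ℂ) := by
      obtain ⟨h1, h2⟩ := Complex.le_def.1 hle
      have h3 : f z = ((f z).re : ℂ) := Complex.ext rfl (by simpa using h2)
      rw [h3, Complex.norm_real, Real.norm_of_nonpos h1]
      simp
    rw [hnorm] at h1
    simp only [f, Complex.ofReal_one, neg_inj] at h1
    rw [div_eq_one_iff_eq w.coe_ne_zero] at h1
    exact hw z (Circle.ext h1)
  have hg : Continuous fun z => Complex.arg (f z) := by
    rw [continuous_iff_continuousAt]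
    intro z
    exact (Complex.continuousAt_arg (hslit z)).comp hf.continuousAt
  have hginj : Function.Injective fun z => Complex.arg (f z) := by
    intro z z' h
    have h1 : f z = f z' := Complex.ext_norm_arg ((hnorm z).trans (hnorm z').symm) h
    simp only [f, neg_inj] at h1
    rw [div_left_inj' w.coe_ne_zero] at h1
    exact hi (Circle.ext h1)
  -- Difference of the arguments at antipodal points. It takes opposite values at 0 and π, so it
  -- vanishes somewhere, against injectivity.
  let G : ℝ → ℝ := fun θ => Complex.arg (f (Circle.exp θ)) - Complex.arg (f (Circle.exp (θ + Real.pi)))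
  have hG : Continuous G := by
    refine (hg.comp Circle.exp.continuous).sub (hg.comp (Circle.exp.continuous.comp ?_))
    fun_prop
  have hGpi : G Real.pi = -G 0 := by
    simp only [G]
    rw [zero_add, show Real.pi + Real.pi = 0 + 2 * Real.pi by ring, Circle.exp_add_two_pi]
    ring
  obtain ⟨θ, hθ⟩ : ∃ θ, G θ = 0 := by
    rcases le_total 0 (G 0) with h | h
    · exact mem_range_of_exists_le_of_exists_ge hG ⟨Real.pi, by linarith⟩ ⟨0, h⟩
    · exact mem_range_of_exists_le_of_exists_ge hG ⟨0, h⟩ ⟨Real.pi, by linarith⟩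
  have h2 := hginj (sub_eq_zero.1 hθ)
  rw [Circle.exp_add] at h2
  have h3 := congrArg (fun z : Circle => (z : ℂ)) (left_eq_mul.1 h2)
  simp at h3
  norm_num at h3

theorem IsSimpleClosedCurve.isCompact {X : Type*} [TopologicalSpace X] {C : Set X}
    (h : IsSimpleClosedCurve C) : IsCompact C := by
  obtain ⟨f, hf, rfl⟩ := h
  exact isCompact_range hf.continuous

theorem IsSimpleClosedCurve.isPreconnected {X : Type*} [TopologicalSpace X] {C : Set X}
    (h : IsSimpleClosedCurve C) : IsPreconnected C := by
  obtain ⟨f, hf, rfl⟩ := h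
  have h1 : range f = range (f ∘ Circle.exp) :=
    (Circle.exp_surjective.range_comp f).symm
  rw [h1]
  exact (isPreconnected_range (hf.continuous.comp Circle.exp.continuous))

/-- A simple closed curve does not embed properly into a simple closed curve. -/
theorem IsSimpleClosedCurve.surjOn {X Y : Type*} [TopologicalSpace X] [TopologicalSpace Y]
    {C : Set X} {D : Set Y} (hC : IsSimpleClosedCurve C) (hD : IsSimpleClosedCurve D) {π : X → Y}
    (hπ : Continuous π) (hinj : InjOn π C) (hm : MapsTo π C D) : SurjOn π C D := by
  obtain ⟨f, hf, rfl⟩ := hC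
  obtain ⟨g, hg, rfl⟩ := hD
  choose k hk using fun z => hm (mem_range_self z)
  have hkc : Continuous k := by
    rw [hg.continuous_iff]
    have : g ∘ k = π ∘ f := funext hk
    rw [this]
    exact hπ.comp hf.continuous
  have hki : Function.Injective k := fun z z' h => by
    have h1 : π (f z) = π (f z') := by rw [← hk, ← hk, h]
    exact hf.injective (hinj (mem_range_self z) (mem_range_self z') h1)
  rintro _ ⟨w, rfl⟩
  obtain ⟨z, rfl⟩ := Circle.surjective_of_injective hkc hki w
  exact ⟨f z, mem_range_self z, (hk z).symm⟩

/-- Compactness of `C` turns the continuous bijection into a homeomorphism. -/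
theorem IsSimpleClosedCurve.of_bijOn {X Y : Type*} [TopologicalSpace X] [TopologicalSpace Y]
    [T2Space Y] {C : Set X} {D : Set Y} (hC : IsCompact C) (hD : IsSimpleClosedCurve D) {π : X → Y}
    (hπ : Continuous π) (h : BijOn π C D) : IsSimpleClosedCurve C := by
  obtain ⟨g, hg, rfl⟩ := hD
  have : CompactSpace C := isCompact_iff_compactSpace.1 hC
  let e : C ≃ range g := h.equiv π
  have he : Continuous e := Continuous.subtype_mk (hπ.comp continuous_subtype_val) _
  let E : C ≃ₜ range g := he.homeoOfEquivCompactToT2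
  let G : Circle ≃ₜ range g := hg.toHomeomorph
  refine ⟨Subtype.val ∘ E.symm ∘ G, IsEmbedding.subtypeVal.comp
    (E.symm.isEmbedding.comp G.isEmbedding), ?_⟩
  rw [(E.symm.surjective.comp G.surjective).range_comp, Subtype.range_coe]

theorem IsSimpleClosedCurve.image {X Y : Type*} [TopologicalSpace X] [TopologicalSpace Y]
    {C : Set X} (hC : IsSimpleClosedCurve C) {h : X → Y} (hh : IsEmbedding h) :
    IsSimpleClosedCurve (h '' C) := by
  obtain ⟨f, hf, rfl⟩ := hC
  exact ⟨h ∘ f, hh.comp hf, range_comp h f⟩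

/-- The unit circle of the plane is a simple closed curve. -/
theorem isSimpleClosedCurve_sphere : IsSimpleClosedCurve (Metric.sphere (0 : Plane) 1) := by
  let L := Complex.orthonormalBasisOneI.repr
  refine ⟨fun z : Circle => L z, L.toHomeomorph.isEmbedding.comp IsEmbedding.subtypeVal, ?_⟩
  ext y
  constructor
  · rintro ⟨z, rfl⟩
    rw [mem_sphere_zero_iff_norm, L.norm_map, Circle.norm_coe]
  · intro hy
    have hn : ‖L.symm y‖ = 1 := by simpa using hy
    exact ⟨⟨L.symm y, mem_sphere_zero_iff_norm.2 hn⟩, L.apply_symm_apply y⟩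

/-- The boundary of a bounded convex set with interior points in the plane is a simple closed
curve. -/
theorem isSimpleClosedCurve_frontier {P : Set Plane} (hP : Convex ℝ P) (hne : (interior P).Nonempty)
    (hb : Bornology.IsBounded P) : IsSimpleClosedCurve (frontier P) := by
  obtain ⟨h, -, -, h3⟩ := exists_homeomorph_image_interior_closure_frontier_eq_unitBall hP hne hb
  have : frontier P = h.symm '' Metric.sphere 0 1 := by
    rw [← h3, ← image_comp]; simp
  rw [this]
  exact isSimpleClosedCurve_sphere.image h.symm.isEmbedding

/-! ### The preimage of a labelled simple closed curve -/

namespace PlaneMap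

variable {M : PlaneMap}

theorem continuous_coverMap (c : Set Plane → Plane) (Φ₀ : M.Flag) : Continuous (coverMap c Φ₀) := by
  refine continuous_coinduced_dom.2 ?_
  rw [continuous_sigma_iff]
  exact fun g => (g • Φ₀).continuous_tau c

theorem isClosed_coverSurface {D : Set M.CoverSurface} :
    IsClosed D ↔ ∀ g : M.Mon, IsClosed (tri g ⁻¹' D) :=
  isClosed_coinduced.trans isClosed_sigma_iff

/-- A labelling along a simple closed curve splits its preimage into simple closed curves. -/
theorem Periodic.preimage_of_labelling (hP : M.Periodic) {c : Set Plane → Plane}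
    (hc : M.IsCentre c) {γ : Set Plane} (hγ : IsSimpleClosedCurve γ) {Φ₁ : M.Flag}
    {m : Plane → M.Flag → M.Mon} (hm : IsLabelling c γ Φ₁ m) (Φ₀ : M.Flag) :
    (∃ 𝒞 : Set (Set M.CoverSurface),
        IsDisjointUnion (coverMap c Φ₀ ⁻¹' γ) 𝒞 ∧ ∀ C ∈ 𝒞, IsSimpleClosedCurve C) ∧
      (∀ C : Set M.CoverSurface, IsSimpleClosedCurve C → C ⊆ coverMap c Φ₀ ⁻¹' γ →
        Set.BijOn (coverMap c Φ₀) C γ) := by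
  classical
  have hT := hP.tame
  -- The sheet of a point over γ. Crossing side `i` multiplies both the triangle and the label by
  -- generator `i` on the left, so the quotient is well defined. Off γ the value 1 is a dummy.
  obtain ⟨l, hl⟩ : ∃ l : M.CoverSurface → M.Mon, ∀ (g : M.Mon) x, (g • Φ₀).tau c x ∈ γ →
      l (tri g x) = (m ((g • Φ₀).tau c x) (g • Φ₀))⁻¹ * g := by
    refine ⟨Quot.lift (fun a : M.Triangles => if (a.1 • Φ₀).tau c a.2 ∈ γ then
      (m ((a.1 • Φ₀).tau c a.2) (a.1 • Φ₀))⁻¹ * a.1 else 1) ?_, fun g x hx => if_pos hx⟩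
    rintro ⟨g, x⟩ ⟨h, y⟩ ⟨i, hg, hx, hi⟩
    dsimp only at hg hx hi ⊢
    subst hx hg
    have h1 : ((M.monGen i * g) • Φ₀) = (g • Φ₀).adj i := by rw [mul_smul]; rfl
    rw [h1, Flag.tau_adj c _ hi]
    by_cases hin : (g • Φ₀).tau c y ∈ γ
    · rw [if_pos hin, if_pos hin, hm.adj _ y i hin hi, mul_inv_rev, mul_assoc, inv_mul_cancel_left]
    · rw [if_neg hin, if_neg hin]
  let S : M.Mon → Set M.CoverSurface := fun h => {s | coverMap c Φ₀ s ∈ γ ∧ l s = h}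
  -- The union of the other sheets is closed too, so each sheet is open in the preimage.
  have hcompl : ∀ h, IsClosed {s | coverMap c Φ₀ s ∈ γ ∧ l s ≠ h} := by
    intro h
    rw [isClosed_coverSurface]
    intro g
    convert (hm.isClosed (g • Φ₀) {w | w⁻¹ * g ≠ h}).preimage ((g • Φ₀).continuous_tau c) using 1
    ext x
    constructor
    · rintro ⟨h1, h2⟩
      rw [hl g x h1] at h2
      exact ⟨h1, mem_range_self x, h2⟩
    · rintro ⟨h1, -, h2⟩
      refine ⟨h1, ?_⟩
      rw [hl g x h1]
      exact h2
  have hScl : ∀ h, IsClosed (S h) := by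
    intro h
    rw [isClosed_coverSurface]
    intro g
    convert (hm.isClosed (g • Φ₀) {w | w⁻¹ * g = h}).preimage ((g • Φ₀).continuous_tau c) using 1
    ext x
    constructor
    · rintro ⟨h1, h2⟩
      rw [hl g x h1] at h2
      exact ⟨h1, mem_range_self x, h2⟩
    · rintro ⟨h1, -, h2⟩
      refine ⟨h1, ?_⟩
      rw [hl g x h1]
      exact h2
  have hScomp : ∀ h, IsCompact (S h) := by
    intro h
    -- A sheet meets only the triangles of `w * h`, with `w` one of the finitely many labels.
    have hK : IsCompact (⋃ w ∈ {w | ∃ (Φ : M.Flag) (x : stdSimplex ℝ (Fin 3)), Φ.tau c x ∈ γ ∧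
        m (Φ.tau c x) Φ = w}, range (tri (w * h))) :=
      hm.finite.isCompact_biUnion fun w _ => isCompact_range (continuous_tri (w * h))
    refine hK.of_isClosed_subset (hScl h) ?_
    rintro s ⟨h1, h2⟩
    obtain ⟨g, x, rfl⟩ := exists_tri s
    rw [coverMap_tri] at h1
    rw [hl g x h1] at h2
    refine mem_biUnion (show m _ (g • Φ₀) ∈ _ from ⟨g • Φ₀, x, h1, rfl⟩) ⟨x, ?_⟩
    rw [← h2, mul_inv_cancel_left]
  -- Two points of one sheet over the same point lie in the same triangle, or in adjacent triangles
  -- on their common side, and there they are identified.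
  have hSinj : ∀ h, InjOn (coverMap c Φ₀) (S h) := by
    rintro h s ⟨h1, h2⟩ s' ⟨h1', h2'⟩ heq
    obtain ⟨g, x, rfl⟩ := exists_tri s
    obtain ⟨g', x', rfl⟩ := exists_tri s'
    rw [coverMap_tri] at h1 h1'
    rw [coverMap_tri, coverMap_tri] at heq
    rw [hl g x h1, inv_mul_eq_iff_eq_mul] at h2
    rw [hl g' x' h1', inv_mul_eq_iff_eq_mul, ← heq] at h2'
    obtain ⟨rfl, h3 | ⟨i, hi, h3⟩⟩ := hT.eq_or_adj hc heq (hm.notMem_corners _ h1)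
    · rw [h3, ← h2] at h2'
      rw [h2']
    · rw [h3, hm.adj _ x i h1 hi, mul_assoc, ← h2] at h2'
      rw [h2', tri_monGen_mul i g hi]
  have hSbij : ∀ h, h • Φ₀ = Φ₁ → BijOn (coverMap c Φ₀) (S h) γ := by
    intro h hh
    refine ⟨fun s hs => hs.1, hSinj h, fun y hy => ?_⟩
    obtain ⟨Φ, x, rfl⟩ := hT.exists_tau c y
    have hΦ : (m (Φ.tau c x) Φ * h) • Φ₀ = Φ := by rw [mul_smul, hh, hm.base Φ x hy]
    refine ⟨tri (m (Φ.tau c x) Φ * h) x, ⟨?_, ?_⟩, ?_⟩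
    · rw [coverMap_tri, hΦ]; exact hy
    · rw [hl _ x (by rw [hΦ]; exact hy), hΦ, inv_mul_cancel_left]
    · rw [coverMap_tri, hΦ]
  have hbase : ∀ s, coverMap c Φ₀ s ∈ γ → l s • Φ₀ = Φ₁ := by
    intro s hs
    obtain ⟨g, x, rfl⟩ := exists_tri s
    rw [coverMap_tri] at hs
    rw [hl g x hs, mul_smul, inv_smul_eq_iff, hm.base _ x hs]
  have hcont := continuous_coverMap c Φ₀
  refine ⟨⟨S '' {h | h • Φ₀ = Φ₁}, ⟨?_, ?_, ?_⟩, ?_⟩, ?_⟩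
  · ext s
    constructor
    · rintro ⟨_, ⟨h, -, rfl⟩, hs⟩; exact hs.1
    · intro hs; exact ⟨_, ⟨l s, hbase s hs, rfl⟩, hs, rfl⟩
  · rintro _ ⟨h, -, rfl⟩ _ ⟨h', -, rfl⟩ hne
    refine disjoint_left.2 fun s hs hs' => hne ?_
    have h1 : l s = h := hs.2
    have h2 : l s = h' := hs'.2
    rw [← h1, ← h2]
  · rintro _ ⟨h, -, rfl⟩
    refine ⟨_, (hcompl h).isOpen_compl, ?_⟩
    ext s
    constructor
    · rintro ⟨h1, h2⟩; exact ⟨fun h => h.2 h2, h1⟩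
    · rintro ⟨h1, h2⟩; exact ⟨h2, by_contra fun h => h1 ⟨h2, h⟩⟩
  · rintro _ ⟨h, hh, rfl⟩
    exact IsSimpleClosedCurve.of_bijOn (hScomp h) hγ hcont (hSbij h hh)
  · intro C hC hCγ
    -- A connected set cannot leave a sheet that is open and closed in the preimage.
    have hsub : ∃ h, C ⊆ S h := by
      obtain ⟨f, -, hf⟩ := id hC
      have hs₀ : f 1 ∈ C := hf ▸ mem_range_self 1
      refine ⟨l (f 1), fun s hs => ⟨hCγ hs, ?_⟩⟩
      by_contra hne
      obtain ⟨z, -, hz1, hz2⟩ := isPreconnected_closed_iff.1 hC.isPreconnected _ _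
        (hScl (l (f 1))) (hcompl (l (f 1)))
        (fun z hz => by
          by_cases h : l z = l (f 1)
          · exact Or.inl ⟨hCγ hz, h⟩
          · exact Or.inr ⟨hCγ hz, h⟩)
        ⟨f 1, hs₀, hCγ hs₀, rfl⟩ ⟨s, hs, hCγ hs, hne⟩
      exact hz2.2 hz1.2
    obtain ⟨h, hsub⟩ := hsub
    have hinj := (hSinj h).mono hsub
    exact ⟨hCγ, hinj, hC.surjOn hγ hcont hinj hCγ⟩

end PlaneMap

/-! ### The boundary of a parallelogram has a labelling -/

theorem exists_coordinates {t₁ t₂ : Plane} (ht : LinearIndependent ℝ ![t₁, t₂]) :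
    ∃ e : (ℝ × ℝ) ≃L[ℝ] Plane, ∀ a, e a = a.1 • t₁ + a.2 • t₂ := by
  let b := basisOfLinearIndependentOfCardEqFinrank ht (by simp)
  refine ⟨(ContinuousLinearEquiv.finTwoArrow ℝ ℝ).symm.trans b.equivFunL.symm, fun a => ?_⟩
  change b.equivFun.symm _ = _
  rw [Module.Basis.equivFun_symm_apply, Fin.sum_univ_two]
  simp [b]

/-- The boundary is grouped as two paths from (0, 0) to (N, N): bottom and right side, left and top
side. -/
theorem frontier_square {N : ℝ} (hN : 0 < N) :
    frontier (Icc (0 : ℝ) N ×ˢ Icc (0 : ℝ) N) =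
      (Icc 0 N ×ˢ {0} ∪ {N} ×ˢ Icc 0 N) ∪ ({0} ×ˢ Icc 0 N ∪ Icc 0 N ×ˢ {N}) := by
  rw [frontier_prod_eq, frontier_Icc hN.le, isClosed_Icc.closure_eq]
  ext ⟨a, b⟩
  simp only [mem_union, mem_prod, mem_insert_iff, mem_singleton_iff]
  tauto

namespace PlaneMap

variable {M : PlaneMap} {c : Set Plane → Plane}

namespace IsLabelling

variable {A B : Set Plane} {Φ : M.Flag} {m m' : Plane → M.Flag → M.Mon}

/-- With equal base flags, agreement at each common point has to be checked in one triangle only. -/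
theorem union_of_point (hT : M.Tame) (hc : M.IsCentre c) (hA : IsLabelling c A Φ m)
    (hB : IsLabelling c B Φ m')
    (h : ∀ z ∈ A, z ∈ B → ∃ (Ψ : M.Flag) (x : stdSimplex ℝ (Fin 3)), Ψ.tau c x = z ∧
      m z Ψ = m' z Ψ) :
    ∃ m'', IsLabelling c (A ∪ B) Φ m'' ∧ (∀ y ∈ A, m'' y = m y) ∧
      ∀ (Ψ : M.Flag) (x : stdSimplex ℝ (Fin 3)), Ψ.tau c x ∈ B →
        m'' (Ψ.tau c x) Ψ = m' (Ψ.tau c x) Ψ := by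
  refine hA.union hB fun Ψ x hxA hxB => ?_
  obtain ⟨Ξ, y, hy, hm⟩ := h _ hxA hxB
  rw [← hy] at hm hxA hxB ⊢
  exact hA.eq_of_eq hT hc hB hxA hxB hm hy.symm

/-- Labellings along two sets, the second one being moved to the end of the first one. -/
theorem concat (hT : M.Tame) (hc : M.IsCentre c) (hi : M.IsInvariantCentre c)
    (hA : IsLabelling c A Φ m) (hB : IsLabelling c B Φ m') {p : Plane} {T₁ T₂ : M.transl}
    {u v : M.Mon} {x : stdSimplex ℝ (Fin 3)} (hx : Φ.tau c x = p) (hpA : p ∈ A)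
    (hpA' : p + T₁ ∈ A) (hm : m p Φ = 1) (hmu : m (p + T₁) (T₁ +ᵥ Φ) = u)
    (hpB' : p + T₂ ∈ B) (hm' : m' p Φ = 1) (hmv : m' (p + T₂) (T₂ +ᵥ Φ) = v)
    (hAB : ∀ z ∈ A, z ∈ tr T₁ B → z = p + T₁) :
    ∃ m'', IsLabelling c (A ∪ tr T₁ B) Φ m'' ∧ m'' p Φ = 1 ∧
      m'' (p + (T₁ + T₂ : M.transl)) ((T₁ + T₂) +ᵥ Φ) = v * u := by
  have htau : ∀ s : M.transl, (s +ᵥ Φ).tau c x = p + s := fun s => by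
    rw [tau_vadd hT.hasConvexPolygonFaces hi, hx]
  have hbase := hA.base (T₁ +ᵥ Φ) x (by rw [htau]; exact hpA')
  rw [htau, hmu] at hbase
  have hB' := (hB.vadd hT hi T₁).mul u
  rw [← hbase, inv_smul_smul] at hB'
  obtain ⟨m'', h1, h2, h3⟩ := hA.union_of_point hT hc hB' fun z hzA hzB =>
    ⟨T₁ +ᵥ Φ, x, by rw [htau, hAB z hzA hzB], by
      rw [hAB z hzA hzB, hmu, neg_vadd_vadd, add_sub_cancel_right, hm', one_mul]⟩
  refine ⟨m'', h1, by rw [h2 p hpA, hm], ?_⟩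
  have h4 := h3 ((T₁ + T₂) +ᵥ Φ) x (by
    rw [htau, AddSubgroup.coe_add, add_comm (T₁ : Plane), ← add_assoc]
    exact add_mem_tr.2 hpB')
  rw [htau] at h4
  rw [h4, add_vadd, neg_vadd_vadd, ← hmv, AddSubgroup.coe_add]
  congr 2
  abel

end IsLabelling

theorem image_coordinates {p t₁ t₂ : Plane} {e : (ℝ × ℝ) ≃L[ℝ] Plane}
    (he : ∀ a, e a = a.1 • t₁ + a.2 • t₂) (S : Set ℝ) :
    (fun s : ℝ => p + s • t₁) '' S = (fun a => p + e a) '' (S ×ˢ {0}) ∧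
      (fun s : ℝ => p + s • t₂) '' S = (fun a => p + e a) '' ({0} ×ˢ S) := by
  constructor <;> ext y <;> constructor
  · rintro ⟨s, hs, rfl⟩; exact ⟨(s, 0), ⟨hs, rfl⟩, by simp [he]⟩
  · rintro ⟨⟨s, _⟩, ⟨hs, rfl⟩, rfl⟩; exact ⟨s, hs, by simp [he]⟩
  · rintro ⟨s, hs, rfl⟩; exact ⟨(0, s), ⟨rfl, hs⟩, by simp [he]⟩
  · rintro ⟨⟨_, s⟩, ⟨rfl, hs⟩, rfl⟩; exact ⟨s, hs, by simp [he]⟩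

theorem tr_image_coordinates {p : Plane} {e : (ℝ × ℝ) ≃L[ℝ] Plane} (d : ℝ × ℝ)
    (S : Set (ℝ × ℝ)) :
    tr (e d) ((fun a => p + e a) '' S) = (fun a => p + e a) '' ((· + d) '' S) := by
  rw [tr, ← image_comp, ← image_comp]
  refine image_congr fun a _ => ?_
  simp [add_assoc]

/-- The boundary of a suitable parallelogram in general position carries a labelling. -/
theorem Periodic.exists_parallelogram_labelling (hP : M.Periodic) (hc : M.IsCentre c)
    (hi : M.IsInvariantCentre c) {t₁ t₂ : M.transl} {e : (ℝ × ℝ) ≃L[ℝ] Plane}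
    (he : ∀ a, e a = a.1 • (t₁ : Plane) + a.2 • (t₂ : Plane)) {p : Plane}
    (hn₁ : ∀ s : ℝ, p + s • (t₁ : Plane) ∉ M.corners c)
    (hn₂ : ∀ s : ℝ, p + s • (t₂ : Plane) ∉ M.corners c) :
    ∃ N : ℕ, 0 < N ∧ ∃ (Φ : M.Flag) (m : Plane → M.Flag → M.Mon),
      IsLabelling c ((fun a => p + e a) '' frontier (Icc (0 : ℝ) N ×ˢ Icc (0 : ℝ) N)) Φ m := by
  have hT := hP.tame
  obtain ⟨Φ, x, hx⟩ := hT.exists_tau c p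
  have h10 : (t₁ : Plane) ≠ 0 := by
    have : e (1, 0) ≠ 0 := by simp
    rw [he] at this
    simpa using this
  have h20 : (t₂ : Plane) ≠ 0 := by
    have : e (0, 1) ≠ 0 := by simp
    rw [he] at this
    simpa using this
  obtain ⟨u, hu⟩ := hP.exists_power_labelling hc hi h10 hn₁ hx
  obtain ⟨v, hv⟩ := hP.exists_power_labelling hc hi h20 hn₂ hx
  obtain ⟨N, hN, hpow⟩ := hP.exists_pow_orbit
  obtain ⟨m₁, hm₁, hm1, hmu⟩ := hu N
  obtain ⟨m₂, hm₂, hm2, hmv⟩ := hv N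
  -- Commutativity makes the labels of the two boundary paths agree at the opposite vertex.
  have hcomm : u ^ N * v ^ N = v ^ N * u ^ N := hT.commute_of_orbit (hpow u) (hpow v)
  refine ⟨N, hN, Φ, ?_⟩
  have hN' : (0 : ℝ) < N := Nat.cast_pos.2 hN
  have hT1 : ((N • t₁ : M.transl) : Plane) = e (N, 0) := by
    rw [he]; simp only [zero_smul, add_zero]; rw [Nat.cast_smul_eq_nsmul]; rfl
  have hT2 : ((N • t₂ : M.transl) : Plane) = e (0, N) := by
    rw [he]; simp only [zero_smul, zero_add]; rw [Nat.cast_smul_eq_nsmul]; rfl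
  let Λ : ℝ × ℝ → Plane := fun a => p + e a
  have hΛ : Function.Injective Λ := fun a b h => e.injective (add_left_cancel h)
  rw [(image_coordinates he _).1] at hm₁
  rw [(image_coordinates he _).2] at hm₂
  have hp0 : p = Λ (0, 0) := by
    change p = p + e 0
    simp
  have hs0 : (0 : ℝ) ∈ Icc (0 : ℝ) N := ⟨le_rfl, hN'.le⟩
  have hsN : (N : ℝ) ∈ Icc (0 : ℝ) N := ⟨hN'.le, le_rfl⟩
  have hp1 : p ∈ Λ '' (Icc (0 : ℝ) N ×ˢ {0}) := ⟨(0, 0), ⟨hs0, rfl⟩, hp0.symm⟩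
  have hp2 : p ∈ Λ '' ({0} ×ˢ Icc (0 : ℝ) N) := ⟨(0, 0), ⟨rfl, hs0⟩, hp0.symm⟩
  have hp1' : p + (N • t₁ : M.transl) ∈ Λ '' (Icc (0 : ℝ) N ×ˢ {0}) :=
    ⟨(N, 0), ⟨hsN, rfl⟩, by rw [hT1]⟩
  have hp2' : p + (N • t₂ : M.transl) ∈ Λ '' ({0} ×ˢ Icc (0 : ℝ) N) :=
    ⟨(0, N), ⟨rfl, hsN⟩, by rw [hT2]⟩
  have htr1 : tr (N • t₁ : M.transl) (Λ '' ({0} ×ˢ Icc (0 : ℝ) N)) = Λ '' ({(N : ℝ)} ×ˢ Icc (0 : ℝ) N) := by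
    rw [hT1, tr_image_coordinates]
    congr 1
    ext ⟨a, b⟩
    simp [add_neg_eq_zero]
  have htr2 : tr (N • t₂ : M.transl) (Λ '' (Icc (0 : ℝ) N ×ˢ {0})) = Λ '' (Icc (0 : ℝ) N ×ˢ {(N : ℝ)}) := by
    rw [hT2, tr_image_coordinates]
    congr 1
    ext ⟨a, b⟩
    simp [add_neg_eq_zero]
  obtain ⟨m₃, hm₃, hm3, hmuv⟩ := hm₁.concat hT hc hi hm₂ hx hp1 hp1' hm1 hmu hp2' hm2 hmv (by
    rw [htr1]
    rintro _ ⟨⟨a, b⟩, ⟨-, hb⟩, rfl⟩ ⟨⟨a', b'⟩, ⟨ha', -⟩, h⟩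
    obtain ⟨rfl, rfl⟩ := Prod.mk.inj (hΛ h)
    obtain rfl : b' = 0 := hb
    obtain rfl : a' = N := ha'
    rw [hT1])
  obtain ⟨m₄, hm₄, hm4, hmvu⟩ := hm₂.concat hT hc hi hm₁ hx hp2 hp2' hm2 hmv hp1' hm1 hmu (by
    rw [htr2]
    rintro _ ⟨⟨a, b⟩, ⟨ha, -⟩, rfl⟩ ⟨⟨a', b'⟩, ⟨-, hb'⟩, h⟩
    obtain ⟨rfl, rfl⟩ := Prod.mk.inj (hΛ h)
    obtain rfl : a' = 0 := ha
    obtain rfl : b' = N := hb'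
    rw [hT2])
  rw [htr1, ← image_union] at hm₃
  rw [htr2, ← image_union] at hm₄
  -- The two paths meet only in their ends: at the start both labels are 1, at the other end they
  -- are `v ^ N * u ^ N` and `u ^ N * v ^ N`.
  obtain ⟨m, hm, -, -⟩ := hm₃.union_of_point hT hc hm₄ (by
    rintro _ ⟨⟨a, b⟩, hab, rfl⟩ ⟨⟨a', b'⟩, hab', h⟩
    obtain ⟨rfl, rfl⟩ := Prod.mk.inj (hΛ h)
    have hcase : (a' = 0 ∧ b' = 0) ∨ (a' = N ∧ b' = N) := by
      rcases hab with ⟨-, h1⟩ | ⟨h1, -⟩ <;> rcases hab' with ⟨h2, -⟩ | ⟨-, h2⟩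
      · exact Or.inl ⟨h2, h1⟩
      · have h1 : b' = 0 := h1
        have h2 : b' = N := h2
        exact absurd (h1.symm.trans h2) hN'.ne
      · have h1 : a' = N := h1
        have h2 : a' = 0 := h2
        exact absurd (h2.symm.trans h1) hN'.ne
      · exact Or.inr ⟨h1, h2⟩
    rcases hcase with ⟨rfl, rfl⟩ | ⟨rfl, rfl⟩
    · refine ⟨Φ, x, hx.trans hp0, ?_⟩
      change m₃ (Λ (0, 0)) Φ = m₄ (Λ (0, 0)) Φ
      rw [← hp0, hm3, hm4]
    · have hend : p + (N • t₁ + N • t₂ : M.transl) = Λ (N, N) := by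
        rw [AddSubgroup.coe_add, hT1, hT2, ← map_add]
        simp [Λ]
      refine ⟨(N • t₁ + N • t₂) +ᵥ Φ, x, ?_, ?_⟩
      · rw [tau_vadd hT.hasConvexPolygonFaces hi, hx, hend]
      · change m₃ (Λ (N, N)) _ = m₄ (Λ (N, N)) _
        rw [← hend, hmuv, add_comm (N • t₁), hmvu, hcomm])
  rw [← image_union, ← frontier_square hN'] at hm
  exact ⟨m, hm⟩

/-! ### Existence of branch points -/

/-- A map with faces of different sizes has a face all whose translates have branch points as
centres. -/
theorem Periodic.exists_branchPoint (hP : M.Periodic)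
    (hsize : ∃ F ∈ M.faces, ∃ F' ∈ M.faces, M.faceSize F ≠ M.faceSize F')
    (c : Set Plane → Plane) (Φ₀ : M.Flag) :
    ∃ Φ : M.Flag, ∀ t : M.transl, IsBranchPoint (coverMap c Φ₀) ((t +ᵥ Φ).corner c 2) := by
  have hT := hP.tame
  have hflag : ∀ F ∈ M.faces, ∃ Φ : M.Flag, Φ.face = F := by
    intro F hF
    obtain ⟨f, hf⟩ := face_nonempty hF
    obtain ⟨z, hz, hzF, -⟩ := hT.exists_frontier_ray hF (c := f) hf
    obtain ⟨e, he, -, heF⟩ := hT.exists_edge_of_mem_closure hF hz hzF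
    obtain ⟨v, hv, w, -, -, hs, -⟩ := exists_edge_ends hT.hasConvexPolygonFaces he
    exact ⟨⟨v, e, F, hv, he, hF, hs ▸ left_mem_segment ℝ v w, heF⟩, rfl⟩
  -- By transitivity some triangle lies over the flag `t +ᵥ Φ`. The walk has the same period at all
  -- translates of `Φ`.
  have key : ∀ Φ : M.Flag, M.faceRot ^ Function.minimalPeriod (M.faceRot • ·) Φ ≠ 1 →
      ∀ t : M.transl, IsBranchPoint (coverMap c Φ₀) ((t +ᵥ Φ).corner c 2) := by
    intro Φ hne t
    obtain ⟨g, hg⟩ := hP.exists_mon Φ₀ (t +ᵥ Φ)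
    have hg : g • Φ₀ = t +ᵥ Φ := hg
    refine ⟨tri g (simplexCorner 2), ?_, fun hloc => hne (faceRot_pow_eq_one hloc ?_)⟩
    · rw [coverMap_tri, hg, Flag.tau_simplexCorner]
    · rw [hg]
      refine (hT.mon_vadd _ t Φ).trans (congrArg (t +ᵥ ·) ?_)
      change M.faceRot ^ _ • Φ = Φ
      rw [MulAction.pow_smul_eq_iff_minimalPeriod_dvd]
  obtain ⟨F, hF, F', hF', hne⟩ := hsize
  obtain ⟨Φ, rfl⟩ := hflag F hF
  obtain ⟨Φ', rfl⟩ := hflag F' hF'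
  by_cases h1 : M.faceRot ^ Function.minimalPeriod (M.faceRot • ·) Φ = 1
  · by_cases h2 : M.faceRot ^ Function.minimalPeriod (M.faceRot • ·) Φ' = 1
    · exfalso
      apply hne
      rw [hT.faceSize_eq Φ, hT.faceSize_eq Φ']
      congr 1
      -- If both powers of the walk are trivial, then each period divides the other.
      apply Nat.dvd_antisymm
      · rw [← MulAction.pow_smul_eq_iff_minimalPeriod_dvd, h2, one_smul]
      · rw [← MulAction.pow_smul_eq_iff_minimalPeriod_dvd, h1, one_smul]
    · exact ⟨Φ', key Φ' h2⟩
  · exact ⟨Φ, key Φ h1⟩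

/-! ### Transport to other centres, general position, and conclusion -/

/-- The statement for a homeomorphic image of the curve. -/
theorem curve_conclusion_of_homeomorph {f : M.CoverSurface → Plane} (h : Plane ≃ₜ Plane)
    {γ : Set Plane} (h1 : IsSimpleClosedCurve γ)
    (h2 : ∃ 𝒞 : Set (Set M.CoverSurface), IsDisjointUnion (f ⁻¹' γ) 𝒞 ∧
      ∀ C ∈ 𝒞, IsSimpleClosedCurve C)
    (h3 : ∀ C : Set M.CoverSurface, IsSimpleClosedCurve C → C ⊆ f ⁻¹' γ → Set.BijOn f C γ)
    (h4 : ∃ b : Plane, IsBranchPoint f b ∧ b ∉ γ ∧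
      Bornology.IsBounded (connectedComponentIn γᶜ b)) :
    ∃ γ : Set Plane, IsSimpleClosedCurve γ ∧
      (∃ 𝒞 : Set (Set M.CoverSurface),
        IsDisjointUnion ((h ∘ f) ⁻¹' γ) 𝒞 ∧ ∀ C ∈ 𝒞, IsSimpleClosedCurve C) ∧
      (∀ C : Set M.CoverSurface, IsSimpleClosedCurve C → C ⊆ (h ∘ f) ⁻¹' γ →
        Set.BijOn (h ∘ f) C γ) ∧
      ∃ b : Plane, IsBranchPoint (h ∘ f) b ∧
        b ∉ γ ∧ Bornology.IsBounded (connectedComponentIn γᶜ b) := by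
  have hpre : (h ∘ f) ⁻¹' (h '' γ) = f ⁻¹' γ := by
    rw [preimage_comp, preimage_image_eq _ h.injective]
  refine ⟨h '' γ, h1.image h.isEmbedding, ?_, ?_, ?_⟩
  · rw [hpre]; exact h2
  · rw [hpre]
    intro C hC hCγ
    exact (h.injective.injOn.bijOn_image).comp (h3 C hC hCγ)
  · obtain ⟨b, ⟨s, rfl, hs⟩, hb, hbd⟩ := h4
    refine ⟨h (f s), ⟨s, rfl, fun hloc => hs ?_⟩, ?_, ?_⟩
    · obtain ⟨E, hE, hfE⟩ := hloc s rfl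
      rintro _ rfl
      refine ⟨E.trans h.symm.toOpenPartialHomeomorph, by simpa using hE, ?_⟩
      funext z
      have := congrFun hfE z
      simp only [Function.comp_apply] at this
      simp [← this]
    · rwa [h.injective.mem_set_image]
    · have hc : (h '' γ)ᶜ = h '' γᶜ := (image_compl_eq h.bijective).symm
      rw [hc, ← h.image_connectedComponentIn hb]
      have := hbd.isCompact_closure.image h.continuous
      exact this.isBounded.subset (image_mono subset_closure)

/-- There is a point such that the lines through it in two given directions avoid a countable
set. -/
theorem exists_generic_point {t₁ t₂ : Plane} {e : (ℝ × ℝ) ≃L[ℝ] Plane}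
    (he : ∀ a, e a = a.1 • t₁ + a.2 • t₂) {Q : Set Plane} (hQ : Q.Countable) :
    ∃ p : Plane, (∀ s : ℝ, p + s • t₁ ∉ Q) ∧ ∀ s : ℝ, p + s • t₂ ∉ Q := by
  -- A line in a coordinate direction has one constant coordinate; it suffices that this value is
  -- not a coordinate of a point of `Q`.
  obtain ⟨α, hα⟩ := ((hQ.image fun z => (e.symm z).1).dense_compl ℝ).nonempty
  obtain ⟨β, hβ⟩ := ((hQ.image fun z => (e.symm z).2).dense_compl ℝ).nonempty
  refine ⟨e (α, β), fun s h => hβ ⟨_, h, ?_⟩, fun s h => hα ⟨_, h, ?_⟩⟩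
  · have : e (α, β) + s • t₁ = e (α + s, β) := by rw [he, he]; module
    simp only [this, ContinuousLinearEquiv.symm_apply_apply]
  · have : e (α, β) + s • t₂ = e (α, β + s) := by rw [he, he]; module
    simp only [this, ContinuousLinearEquiv.symm_apply_apply]

end PlaneMap

theorem mainTheorem7 (M : PlaneMap) (hM : M.HasConvexPolygonFaces)
    (t₁ t₂ : Plane) (ht : LinearIndependent ℝ ![t₁, t₂])
    (h₁ : M.IsAutomorphism (Homeomorph.addRight t₁))
    (h₂ : M.IsAutomorphism (Homeomorph.addRight t₂))
    (hsize : ∃ F ∈ M.faces, ∃ F' ∈ M.faces, M.faceSize F ≠ M.faceSize F')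
    (c : Set Plane → Plane) (hc : ∀ F ∈ M.faces, c F ∈ F) (Φ₀ : M.Flag) :
    ∃ γ : Set Plane, IsSimpleClosedCurve γ ∧
      (∃ 𝒞 : Set (Set M.CoverSurface),
        IsDisjointUnion (PlaneMap.coverMap c Φ₀ ⁻¹' γ) 𝒞 ∧ ∀ C ∈ 𝒞, IsSimpleClosedCurve C) ∧
      (∀ C : Set M.CoverSurface, IsSimpleClosedCurve C → C ⊆ PlaneMap.coverMap c Φ₀ ⁻¹' γ →
        Set.BijOn (PlaneMap.coverMap c Φ₀) C γ) ∧
      ∃ b : Plane, IsBranchPoint (PlaneMap.coverMap c Φ₀) b ∧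
        b ∉ γ ∧ Bornology.IsBounded (connectedComponentIn γᶜ b) := by
  obtain ⟨s₁, rfl⟩ : ∃ s : M.transl, (s : Plane) = t₁ := ⟨⟨_, PlaneMap.mem_transl_of_isAutomorphism h₁⟩, rfl⟩
  obtain ⟨s₂, rfl⟩ : ∃ s : M.transl, (s : Plane) = t₂ := ⟨⟨_, PlaneMap.mem_transl_of_isAutomorphism h₂⟩, rfl⟩
  have hP := PlaneMap.periodic_of_translations hM ht s₁.2 s₂.2
  have hT := hP.tame
  obtain ⟨c', hc', hi⟩ := PlaneMap.exists_isInvariantCentre hM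
  obtain ⟨e, he⟩ := exists_coordinates ht
  obtain ⟨p, hp1, hp2⟩ := PlaneMap.exists_generic_point he (hT.countable_corners c')
  obtain ⟨N, hN, Φ, m, hm⟩ := hP.exists_parallelogram_labelling hc' hi he hp1 hp2
  -- From here on the curve is constructed for the invariant centres `c'`; the homeomorphism carries
  -- it to the given `c`.
  rw [hP.coverMap_transfer hc' hc Φ₀]
  have hN' : (1 : ℝ) ≤ N := Nat.one_le_cast.2 hN
  let Λ : (ℝ × ℝ) ≃ₜ Plane := e.toHomeomorph.trans (Homeomorph.addLeft p)
  have hΛ : ∀ a, Λ a = p + e a := fun a => rfl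
  let K : Set (ℝ × ℝ) := Icc (0 : ℝ) N ×ˢ Icc (0 : ℝ) N
  have hKint : interior K = Ioo (0 : ℝ) N ×ˢ Ioo (0 : ℝ) N := by
    rw [interior_prod_eq, interior_Icc]
  have hγ : (fun a => p + e a) '' frontier K = frontier (Λ '' K) := Λ.image_frontier K
  change PlaneMap.IsLabelling c' ((fun a => p + e a) '' frontier K) Φ m at hm
  rw [hγ] at hm
  have hKb : Bornology.IsBounded (Λ '' K) :=
    ((isCompact_Icc.prod isCompact_Icc).image Λ.continuous).isBounded
  have hconv : Convex ℝ (Λ '' K) := by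
    have : Λ '' K = (fun z => p + z) '' (e.toLinearMap '' K) := by
      rw [← image_comp]; rfl
    rw [this]
    exact (((convex_Icc _ _).prod (convex_Icc _ _)).linear_image _).translate p
  obtain ⟨Ψ, hΨ⟩ := hP.exists_branchPoint hsize c' Φ₀
  obtain ⟨t, ht⟩ : ∃ t : M.transl, (t +ᵥ Ψ).corner c' 2 ∈ interior (Λ '' K) := by
    obtain ⟨⟨a, b⟩, hab⟩ := Λ.surjective (Ψ.corner c' 2)
    -- Reducing the coordinates of the centre relative to `p` modulo 1 moves it into the first cell
    -- of the parallelogram.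
    let t : M.transl := -(⌊a⌋ • s₁ + ⌊b⌋ • s₂)
    have htc : (t +ᵥ Ψ).corner c' 2 = Λ (Int.fract a, Int.fract b) := by
      rw [PlaneMap.corner_vadd hM hi, ← hab, hΛ, hΛ, he, he]
      have : (t : Plane) = -((⌊a⌋ : ℝ) • (s₁ : Plane) + (⌊b⌋ : ℝ) • (s₂ : Plane)) := by
        rw [Int.cast_smul_eq_zsmul, Int.cast_smul_eq_zsmul]; rfl
      rw [this, Int.fract, Int.fract]
      module
    have hcor : Λ (Int.fract a, Int.fract b) ∈ M.corners c' := ⟨(t +ᵥ Ψ, 2), htc⟩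
    refine ⟨t, ?_⟩
    rw [htc, ← Λ.image_interior, hKint]
    refine mem_image_of_mem _ ⟨⟨(Int.fract_nonneg a).lt_of_ne' fun h => ?_,
      (Int.fract_lt_one a).trans_le hN'⟩, ⟨(Int.fract_nonneg b).lt_of_ne' fun h => ?_,
      (Int.fract_lt_one b).trans_le hN'⟩⟩
    -- A vanishing fractional part would put this corner on one of the two lines through `p` that
    -- avoid all corners.
    · rw [hΛ, he] at hcor
      simp only [h, zero_smul, zero_add] at hcor
      exact hp2 _ hcor
    · rw [hΛ, he] at hcor
      simp only [h, zero_smul, add_zero] at hcor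
      exact hp1 _ hcor
  have hcurve := isSimpleClosedCurve_frontier hconv ⟨_, ht⟩ hKb
  obtain ⟨r1, r2⟩ := hP.preimage_of_labelling hc' hcurve hm Φ₀
  have hbγ : (t +ᵥ Ψ).corner c' 2 ∉ frontier (Λ '' K) := fun h => h.2 ht
  refine PlaneMap.curve_conclusion_of_homeomorph _ hcurve r1 r2 ⟨_, hΨ t, hbγ, hKb.subset ?_⟩
  -- The component cannot leave the parallelogram: being connected, it would meet the boundary,
  -- which is the curve.
  intro y hy
  by_contra hyK
  obtain ⟨z, hz, hz1, hz2⟩ := isPreconnected_connectedComponentIn.exists_mem_closure_diff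
    (isOpen_interior (s := Λ '' K)) ⟨_, mem_connectedComponentIn hbγ, ht⟩
    ⟨y, hy, fun h => hyK (interior_subset h)⟩
  exact connectedComponentIn_subset _ _ hz ⟨closure_mono interior_subset hz1, hz2⟩

end
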